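/- For complex $q$ with $|q|<1$ let $G(q)=\sum_{n\ge 0}\frac{q^{n^2}}{(q;q)_n}$ and $H(q)=\sum_{n\ge 0}\frac{q^{n(n+1)}}{(q;q)_n}$, where $(a;q)_n=\prod_{k=0}^{n-1}(1-aq^k)$. Let $f(a,b)=\sum_{n\in\mathbb Z}a^{n(n+1)/2}b^{n(n-1)/2}$ for $|ab|<1$, and put $\varphi(q)=f(q,q)$, $\psi(q)=f(q,q^3)$, $E(q)=f(-q,-q^2)=\prod_{n\ge1}(1-q^n)$. For positive integers $r,s$ let $$U(r,s,q)=\begin{cases}G(q^r)G(q^s)+q^{(s+r)/5}H(q^r)H(q^s), & r+s\equiv 0 \pmod 5,\\ H(q^r)G(q^s)-q^{(s-r)/5}G(q^r)H(q^s), & s-r\equiv 0\pmod 5.\end{cases}$$ For a positive definite form write $(a,b,c)$ for its theta series $\sum_{n,m\in\mathbb Z}q^{an^2+bnm+cm^2}$. **Theorem** (discriminant $-1664$). Let $|q|<1$ and $Q=q^{13}$. Then $$2q^3E(q^{16})E(Q^8)\,U(2,13,q^8)=(3,2,139)-(12,4,35),$$ $$2q^7E(q^8)E(Q^{16})\,U(1,26,q^8)=(7,4,60)-(15,4,28),$$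 $$2q^9E(q^8)E(Q^{16})=(9,8,48)-(17,6,25),$$ $$2q^5E(q^{16})E(Q^8)=(5,4,84)-(20,4,21),$$ $$\begin{aligned}2q^5E(q^8)E(Q^{16})\,U(1,26,q^8)^2&=(5,4,84)+(21,10,21)-(13,0,32)-(20,4,21)\\&=2q^5E(q^{16})E(Q^8)-2q^{13}\psi(Q^8)\varphi(-q^8),\end{aligned}$$ $$\begin{aligned}2qE(q^{16})E(Q^8)\,U(2,13,q^8)^2&=(1,0,416)+(17,6,25)-(4,4,105)-(9,8,48)\\&=2q\psi(q^8)\varphi(-Q^8)-2q^9E(q^8)E(Q^{16}),\end{aligned}$$ and $$\begin{aligned}\frac{(5,4,84)+(21,10,21)-(13,0,32)-(20,4,21)}{(1,0,416)+(17,6,25)-(4,4,105)-(9,8,48)}&=\frac{(9,8,48)-(17,6,25)}{(5,4,84)-(20,4,21)}=\frac{(7,4,60)-(15,4,28)}{(3,2,139)-(12,4,35)}\\&=q^4\,\frac{E(q^8)E(Q^{16})}{E(q^{16})E(Q^8)}.\end{aligned}$$ The last chain holds for $0<|q|<1$ wherever the denominators involved do not vanish: $E(q^{16})E(Q^8)$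 and $(5,4,84)-(20,4,21)$ vanish nowhere in $0<|q|<1$, and the other two denominators vanish at most on a discrete relatively closed subset of $|q|<1$. -/

import Mathlib

open Filter Topology

noncomputable section

namespace RogersRamanujan

/-- The finite `q`-Pochhammer symbol `(a; q)_n = ∏_{k=0}^{n-1} (1 - a q^k)`. -/
def qPoch (a q : ℂ) (n : ℕ) : ℂ := ∏ k ∈ Finset.range n, (1 - a * q ^ k)

/-- The Rogers--Ramanujan function `G(q) = ∑_{n ≥ 0} q^{n^2} / (q; q)_n`, for `|q| < 1`. -/
def G (q : ℂ) : ℂ := ∑' n : ℕ, q ^ (n ^ 2) / qPoch q q n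

/-- The Rogers--Ramanujan function `H(q) = ∑_{n ≥ 0} q^{n(n+1)} / (q; q)_n`, for `|q| < 1`. -/
def H (q : ℂ) : ℂ := ∑' n : ℕ, q ^ (n * (n + 1)) / qPoch q q n

/-- Ramanujan's general theta function
`f(a, b) = ∑_{n ∈ ℤ} a^{n(n+1)/2} b^{n(n-1)/2}`, for `|ab| < 1`.
Both exponents are nonnegative integers, so the integer divisions are exact. -/
def f (a b : ℂ) : ℂ := ∑' n : ℤ, a ^ (n * (n + 1) / 2) * b ^ (n * (n - 1) / 2)

/-- `φ(q) = f(q, q) = ∑_{n ∈ ℤ} q^{n^2}`. -/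
def phi (q : ℂ) : ℂ := f q q

/-- `ψ(q) = f(q, q^3)`. -/
def psi (q : ℂ) : ℂ := f q (q ^ 3)

/-- `E(q) = f(-q, -q^2) = (q; q)_∞`. -/
def E (q : ℂ) : ℂ := f (-q) (-q ^ 2)

/-- The function `U(r, s, q)`, defined when `r + s ≡ 0` or `s - r ≡ 0` modulo `5`
(and given the value `0` for all other `r`, `s`). -/
def U (r s : ℕ) (q : ℂ) : ℂ :=
  if (r + s) % 5 = 0 then
    G (q ^ r) * G (q ^ s) + q ^ ((s + r) / 5) * H (q ^ r) * H (q ^ s)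
  else if (5 : ℤ) ∣ (s : ℤ) - (r : ℤ) then
    H (q ^ r) * G (q ^ s) - q ^ (((s : ℤ) - (r : ℤ)) / 5) * G (q ^ r) * H (q ^ s)
  else 0

/-- The generating function `∑_{n, m ∈ ℤ} q^{a n^2 + b n m + c m^2}` of the positive definite
binary quadratic form `(a, b, c)`, for `|q| < 1`. -/
def theta (a b c : ℤ) (q : ℂ) : ℂ :=
  ∑' p : ℤ × ℤ, q ^ (a * p.1 ^ 2 + b * p.1 * p.2 + c * p.2 ^ 2)

end RogersRamanujan

end

noncomputable section

namespace RogersRamanujan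

/-! Two mechanisms combine, one arithmetic and one modular.

Arithmetic. Put x = c y + 2N s with c, y odd. For suitable α, β, D the quotient (α x² + β y²)/D is
an integral binary form in (y, s). Summed over odd y with sign (-1)^s, it is a difference of two
theta series (`signedTheta_eq`). Read in (x, y), the same sum splits into residue classes modulo 2N
(`tsum_fold`), and on each class it factors into two alternating theta series (`cosetSum_eq_mul`). N
= 3 yields products of two values of E. N = 5 yields products of the series equal to G·E and H·E by
the Rogers-Ramanujan identities (`G_mul_E`, `H_mul_E`), hence U. Diagonal forms yield products ψφ.
This settles every identity in which U is not squared.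

Modular. With v = E(q²)E(q¹³)/(E(q)E(q²⁶)), the squared identities reduce to U(2,13,q) = U(1,26,q)
and U² = v - q/v, because φ and ψ are quotients of values of E. The functions q^(-1/60) G and
q^(11/60) H are mixed by τ ↦ -1/τ through an explicit 2 × 2 matrix. Hence the normalized functions
u₁ = q^(-1/4) U(2,13), u₂ = q^(-1/4) U(1,26) and t = v²/q can be followed under Atkin-Lehner
transformations of level 26: up to a fourth root of unity these either fix u₁, u₂, t or exchange u₁
with u₂ and invert t (`Linked`). So |u₁ - u₂| is invariant and, once u₁ = u₂, so is |u₁⁴ - t - 1/t +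
2|. Four transformations, integer translations and the reflection in the imaginary axis carry any
point into the strip 0 ≤ Re τ ≤ 1/2, Im τ ≥ 1/60 (`LinkInvariant.exists_mem_strip`). Both functions
tend to 0 as Im τ → ∞, by a first-order expansion at q = 0, and the maximum modulus principle makes
them vanish (`eq_zero_of_linkInvariant`). The second gives U⁴ = (v - q/v)², and the sign of the
square root is read off at q = 0. -/

/-- The alternating theta series `∑ (-1)^n q^{(N n² + r n)/2}`. -/
def altTheta (N r : ℤ) (q : ℂ) : ℂ := ∑' n : ℤ, (-1) ^ n * q ^ ((N * n ^ 2 + r * n) / 2)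

/-! ### Convergence, holomorphy and first Taylor coefficient of theta series -/

lemma summable_pow_natAbs {r : ℝ} (h0 : 0 ≤ r) (h1 : r < 1) :
    Summable fun n : ℤ => r ^ n.natAbs := by
  rw [summable_int_iff_summable_nat_and_neg]
  simp [summable_geometric_of_lt_one h0 h1]

lemma norm_zpow_le {q : ℂ} (hq : ‖q‖ ≤ 1) {n : ℕ} {k : ℤ} (h : (n : ℤ) ≤ k) :
    ‖q ^ k‖ ≤ ‖q‖ ^ n := by
  lift k to ℕ using (by omega)
  rw [zpow_natCast, norm_pow]
  exact pow_le_pow_of_le_one (norm_nonneg _) hq (by exact_mod_cast h)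

lemma norm_neg_one_zpow (n : ℤ) : ‖((-1 : ℂ)) ^ n‖ = 1 := by simp

section GeneralSeries

variable {c : ℤ → ℂ} {k : ℤ → ℤ}

lemma norm_series_term_le (hc : ∀ n, ‖c n‖ ≤ 1) (hk : ∀ n, (n.natAbs : ℤ) ≤ k n)
    {q : ℂ} {r : ℝ} (hr : r ≤ 1) (hq : ‖q‖ ≤ r) (n : ℤ) : ‖c n * q ^ k n‖ ≤ r ^ n.natAbs := by
  rw [norm_mul]
  calc _ ≤ 1 * ‖q‖ ^ n.natAbs :=
        mul_le_mul (hc n) (norm_zpow_le (hq.trans hr) (hk n)) (norm_nonneg _) zero_le_one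
    _ ≤ _ := by rw [one_mul]; gcongr

lemma summable_norm_series (hc : ∀ n, ‖c n‖ ≤ 1) (hk : ∀ n, (n.natAbs : ℤ) ≤ k n)
    {q : ℂ} (hq : ‖q‖ < 1) : Summable fun n => ‖c n * q ^ k n‖ :=
  Summable.of_nonneg_of_le (fun _ => norm_nonneg _)
    (fun n => norm_series_term_le hc hk hq.le le_rfl n)
    (summable_pow_natAbs (norm_nonneg q) hq)

lemma differentiableOn_series (hc : ∀ n, ‖c n‖ ≤ 1) (hk : ∀ n, (n.natAbs : ℤ) ≤ k n) :
    DifferentiableOn ℂ (fun q => ∑' n, c n * q ^ k n) (Metric.ball 0 1) := by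
  intro q hq
  rw [mem_ball_zero_iff] at hq
  obtain ⟨r, h1, h2⟩ := exists_between hq
  have := Complex.differentiableOn_tsum_of_summable_norm (F := fun n q => c n * q ^ k n)
    (summable_pow_natAbs ((norm_nonneg q).trans h1.le) h2)
    (fun n => fun w _ => ((differentiableAt_zpow.2 (Or.inr
      (by have := hk n; omega))).const_mul (c n)).differentiableWithinAt)
    (Metric.isOpen_ball (x := (0 : ℂ)) (ε := r))
    (fun n w hw => norm_series_term_le hc hk h2.le (mem_ball_zero_iff.1 hw).le n)
  exact (this.differentiableAt (Metric.isOpen_ball.mem_nhds (by simpa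
      using h1))).differentiableWithinAt

/-- Termwise differentiation: at 0 only the terms with exponent exactly 1 survive. -/
lemma deriv_series_zero (hc : ∀ n, ‖c n‖ ≤ 1) (hk : ∀ n, (n.natAbs : ℤ) ≤ k n) :
    deriv (fun q => ∑' n, c n * q ^ k n) 0 = ∑' n, if k n = 1 then c n else 0 := by
  have := Complex.hasSum_deriv_of_summable_norm (F := fun n q => c n * q ^ k n)
    (summable_pow_natAbs (r := 1 / 2) (by norm_num) (by norm_num))
    (fun n => fun w _ => ((differentiableAt_zpow.2 (Or.inr
      (by have := hk n; omega))).const_mul (c n)).differentiableWithinAt)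
    (Metric.isOpen_ball (x := (0 : ℂ)) (ε := 1 / 2))
    (fun n w hw => norm_series_term_le hc hk (by norm_num) (mem_ball_zero_iff.1 hw).le n)
    (z := 0) (by simp)
  rw [← this.tsum_eq]
  refine tsum_congr fun n => ?_
  have h0 : 0 ≤ k n := by have := hk n; omega
  lift k n to ℕ using h0 with m
  simp only [zpow_natCast, deriv_const_mul_field']
  rw [deriv_pow_field]
  rcases m with _ | _ | m <;> simp
  intro h; omega

end GeneralSeries

/-- Since |n| ≤ n², one has N n² + r n ≥ N|n| - (N - 2)|n| = 2|n|. This linear growth dominates the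
series by a geometric one. -/
lemma altTheta_exponent (N r n : ℤ) (hN : 3 ≤ N) (hr : |r| ≤ N - 2) :
    (n.natAbs : ℤ) ≤ (N * n ^ 2 + r * n) / 2 := by
  rw [Int.natCast_natAbs, Int.le_ediv_iff_mul_le (by norm_num)]
  have h1 : |n| ≤ n ^ 2 := by
    rw [← sq_abs]; rcases eq_or_lt_of_le (abs_nonneg n) with h | h <;> nlinarith
  have h2 : -(|r| * |n|) ≤ r * n := by rw [← abs_mul]; exact neg_abs_le _
  nlinarith [abs_nonneg n]

lemma differentiableOn_altTheta {N r : ℤ} (hN : 3 ≤ N) (hr : |r| ≤ N - 2) :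
    DifferentiableOn ℂ (altTheta N r) (Metric.ball 0 1) :=
  differentiableOn_series (fun n => (norm_neg_one_zpow n).le)
    (fun n => altTheta_exponent N r n hN hr)

lemma summable_norm_altTheta {N r : ℤ} (hN : 3 ≤ N) (hr : |r| ≤ N - 2) {q : ℂ} (hq : ‖q‖ < 1) :
    Summable fun n : ℤ => ‖(-1 : ℂ) ^ n * q ^ ((N * n ^ 2 + r * n) / 2)‖ :=
  summable_norm_series (fun n => (norm_neg_one_zpow n).le)
    (fun n => altTheta_exponent N r n hN hr) hq

lemma altTheta_neg (N r : ℤ) (q : ℂ) : altTheta N (-r) q = altTheta N r q := by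
  unfold altTheta
  rw [← (Equiv.neg ℤ).tsum_eq]
  refine tsum_congr fun n => ?_
  simp only [Equiv.neg_apply]
  rw [zpow_neg, ← inv_zpow, inv_neg_one]
  congr 3; ring

lemma altTheta_zero {N r : ℤ} (hN : 3 ≤ N) (hr : |r| ≤ N - 2) : altTheta N r 0 = 1 := by
  unfold altTheta
  rw [tsum_eq_single 0]
  · simp
  · intro n hn
    have := altTheta_exponent N r n hN hr
    rw [zero_zpow _ (by omega), mul_zero]

lemma deriv_altTheta_zero {N r : ℤ} (hN : 3 ≤ N) (hr : |r| ≤ N - 2) :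
    deriv (altTheta N r) 0 = ∑' n : ℤ, if (N * n ^ 2 + r * n) / 2 = 1 then (-1) ^ n else 0 :=
  deriv_series_zero (fun n => (norm_neg_one_zpow n).le)
    (fun n => altTheta_exponent N r n hN hr)

lemma exists_nat_triangular (n : ℤ) :
    ∃ a b : ℕ, 2 * (a : ℤ) = n * (n + 1) ∧ 2 * (b : ℤ) = n * (n - 1) := by
  have h1 : 0 ≤ n * (n + 1) := by
    rcases lt_or_ge n 0 with h | h <;> nlinarith
  have h2 : 0 ≤ n * (n - 1) := by
    rcases lt_or_ge 0 n with h | h <;> nlinarith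
  have h3 := Int.even_mul_succ_self n
  have h4 : Even (n * (n - 1)) := by rw [mul_comm]; simpa using Int.even_mul_succ_self (n - 1)
  obtain ⟨a, ha⟩ := h3
  obtain ⟨b, hb⟩ := h4
  exact ⟨a.toNat, b.toNat, by omega, by omega⟩

lemma f_neg_neg_term (s t : ℕ) (q : ℂ) (n : ℤ) :
    (-q ^ s) ^ (n * (n + 1) / 2) * (-q ^ t) ^ (n * (n - 1) / 2)
      = (-1) ^ n * q ^ ((((s : ℤ) + t) * n ^ 2 + (s - t) * n) / 2) := by
  obtain ⟨a, b, ha, hb⟩ := exists_nat_triangular n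
  rw [show n * (n + 1) / 2 = (a : ℤ) by omega, show n * (n - 1) / 2 = (b : ℤ) by omega,
    show (((s : ℤ) + t) * n ^ 2 + (s - t) * n) / 2 = ((s * a + t * b : ℕ) : ℤ) from
      Int.ediv_eq_of_eq_mul_left two_ne_zero (by push_cast; linear_combination s * (-ha) + t *
          (-hb)),
    zpow_natCast, zpow_natCast, zpow_natCast]
  -- The total exponent of -1 is a + b = n + 2b, which has the parity of n.
  have h : ((-1 : ℂ)) ^ n = (-1) ^ (a + b) := by
    rw [← zpow_natCast, show ((a + b : ℕ) : ℤ) = n + 2 * b by push_cast; linarith,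
      zpow_add₀ (by norm_num), zpow_mul]
    simp
  rw [h, neg_pow, neg_pow (q ^ t)]
  ring

/-- Theta functions with a sign: `f(-q^s, -q^t)` as an alternating theta series. -/
lemma f_neg_neg (s t : ℕ) (q : ℂ) :
    f (-q ^ s) (-q ^ t) = altTheta (s + t) (s - t) q :=
  tsum_congr (f_neg_neg_term s t q)

lemma E_eq_altTheta (q : ℂ) : E q = altTheta 3 1 q := by
  have := f_neg_neg 1 2 q
  rw [pow_one] at this
  rw [E, this, ← altTheta_neg]; norm_num

lemma psi_term (q : ℂ) (n : ℤ) :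
    q ^ (n * (n + 1) / 2) * (q ^ 3) ^ (n * (n - 1) / 2) = q ^ (2 * n ^ 2 - n) := by
  obtain ⟨a, b, ha, hb⟩ := exists_nat_triangular n
  rw [show n * (n + 1) / 2 = (a : ℤ) by omega, show n * (n - 1) / 2 = (b : ℤ) by omega,
    show 2 * n ^ 2 - n = ((a + 3 * b : ℕ) : ℤ) by push_cast; linarith]
  simp only [zpow_natCast]
  ring

lemma psi_eq_tsum (q : ℂ) : psi q = ∑' n : ℤ, q ^ (2 * n ^ 2 - n) :=
  tsum_congr (psi_term q)

lemma phi_neg_eq_tsum (q : ℂ) : phi (-q) = ∑' n : ℤ, (-1) ^ n * q ^ (n ^ 2) := by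
  have := f_neg_neg 1 1 q
  rw [pow_one] at this
  rw [phi, this, altTheta]
  refine tsum_congr fun n => ?_
  congr 2
  push_cast
  ring_nf
  omega

/-! ### The Jacobi triple product and product formulas for E, φ, ψ -/

/-- The infinite `q`-Pochhammer symbol `(a; q)_∞`. -/
def qPochInf (a q : ℂ) : ℂ := ∏' k : ℕ, (1 - a * q ^ k)

lemma summable_norm_mul_pow (a : ℂ) {q : ℂ} (hq : ‖q‖ < 1) :
    Summable fun k : ℕ => ‖-(a * q ^ k)‖ := by
  simp only [norm_neg, norm_mul, norm_pow]
  exact (summable_geometric_of_lt_one (norm_nonneg _) hq).mul_left _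

lemma tendsto_qPoch (a : ℂ) {q : ℂ} (hq : ‖q‖ < 1) :
    Tendsto (qPoch a q) atTop (𝓝 (qPochInf a q)) := by
  have h := multipliable_one_add_of_summable (summable_norm_mul_pow a hq)
  simp only [← sub_eq_add_neg] at h
  exact h.tendsto_prod_tprod_nat

lemma one_sub_pow_ne_zero {q : ℂ} (hq : ‖q‖ < 1) (n : ℕ) : 1 - q ^ (n + 1) ≠ 0 := by
  intro h
  have h1 : ‖q ^ (n + 1)‖ = 1 := by rw [← sub_eq_zero.1 h]; simp
  rw [norm_pow] at h1
  exact absurd h1 (pow_lt_one₀ (norm_nonneg _) hq (by omega)).ne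

lemma qPochInf_self_ne_zero {q : ℂ} (hq : ‖q‖ < 1) : qPochInf q q ≠ 0 := by
  have := tprod_one_add_ne_zero_of_summable (f := fun k : ℕ => -(q * q ^ k))
    (fun k => by rw [← pow_succ', ← sub_eq_add_neg]; exact one_sub_pow_ne_zero hq k)
    (summable_norm_mul_pow q hq)
  simpa only [qPochInf, sub_eq_add_neg] using this

lemma qPoch_self_ne_zero {q : ℂ} (hq : ‖q‖ < 1) (n : ℕ) : qPoch q q n ≠ 0 :=
  Finset.prod_ne_zero_iff.2 fun k _ => by
    rw [← pow_succ']; exact one_sub_pow_ne_zero hq k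

lemma qPoch_zero (a q : ℂ) : qPoch a q 0 = 1 := by simp [qPoch]

lemma qPoch_succ (a q : ℂ) (n : ℕ) : qPoch a q (n + 1) = qPoch a q n * (1 - a * q ^ n) := by
  simp [qPoch, Finset.prod_range_succ]

lemma qPoch_succ' (a q : ℂ) (n : ℕ) : qPoch a q (n + 1) = (1 - a) * qPoch (a * q) q n := by
  simp only [qPoch, Finset.prod_range_succ']
  rw [mul_comm]
  simp [pow_succ', mul_assoc]

lemma exists_bound_qPoch (a : ℂ) {q : ℂ} (hq : ‖q‖ < 1) : ∃ C : ℝ, ∀ n, ‖qPoch a q n‖ ≤ C := by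
  obtain ⟨C, hC⟩ := (tendsto_qPoch a hq).norm.bddAbove_range
  exact ⟨C, fun n => hC ⟨n, rfl⟩⟩

lemma exists_bound_qPoch_inv {q : ℂ} (hq : ‖q‖ < 1) :
    ∃ C : ℝ, ∀ n, ‖(qPoch q q n)⁻¹‖ ≤ C := by
  obtain ⟨C, hC⟩ := ((tendsto_qPoch q hq).inv₀ (qPochInf_self_ne_zero hq)).norm.bddAbove_range
  exact ⟨C, fun n => hC ⟨n, rfl⟩⟩

/-- `1 / (p; p)_n`, extended by zero to negative `n`. -/
def invPoch (p : ℂ) (n : ℤ) : ℂ := if n < 0 then 0 else (qPoch p p n.toNat)⁻¹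

lemma invPoch_natCast (p : ℂ) (n : ℕ) : invPoch p n = (qPoch p p n)⁻¹ := by
  simp [invPoch]

lemma invPoch_of_neg (p : ℂ) {n : ℤ} (h : n < 0) : invPoch p n = 0 := by
  simp [invPoch, h]

/-- Extension by zero keeps the recursion valid at all integers: at n = 0 the factor 1 - p^0
vanishes. No boundary cases then arise in the recursion of the binomials. -/
lemma invPoch_sub_one {p : ℂ} (hp : ‖p‖ < 1) (n : ℤ) :
    invPoch p (n - 1) = (1 - p ^ n) * invPoch p n := by
  rcases lt_trichotomy n 0 with h | rfl | h
  · rw [invPoch_of_neg p h, invPoch_of_neg p (by omega), mul_zero]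
  · rw [invPoch_of_neg p (by omega)]; simp
  · obtain ⟨m, rfl⟩ : ∃ m : ℕ, n = (m + 1 : ℕ) := ⟨(n - 1).toNat, by omega⟩
    rw [show ((m + 1 : ℕ) : ℤ) - 1 = (m : ℕ) by push_cast; ring, invPoch_natCast, invPoch_natCast,
      qPoch_succ, ← pow_succ', zpow_natCast]
    have := one_sub_pow_ne_zero hp m
    have := qPoch_self_ne_zero hp m
    field_simp

/-- The central `q`-binomial coefficient `[2N; N + j]`. -/
def centralBinom (p : ℂ) (N : ℕ) (j : ℤ) : ℂ :=
  qPoch p p (2 * N) * (invPoch p (N + j) * invPoch p (N - j))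

lemma centralBinom_eq_zero (p : ℂ) (N : ℕ) (j : ℤ) (hj : j ∉ Finset.Icc (-(N : ℤ)) N) :
    centralBinom p N j = 0 := by
  rw [Finset.mem_Icc, not_and_or] at hj
  rcases hj with h | h
  · rw [centralBinom, invPoch_of_neg p (by omega : (N : ℤ) + j < 0)]; simp
  · rw [centralBinom, invPoch_of_neg p (by omega : (N : ℤ) - j < 0)]; simp

/-- A double q-Pascal rule, shaped to match the expansion of (1 + a p^N)(1 + b p^N) with p = ab in
the finite triple product. -/
lemma centralBinom_succ {p : ℂ} (hp : ‖p‖ < 1) (hp0 : p ≠ 0) (N : ℕ) (j : ℤ) :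
    centralBinom p (N + 1) j = (1 + p ^ (2 * N + 1)) * centralBinom p N j
      + p ^ (N - j + 1) * centralBinom p N (j - 1) + p ^ (N + j + 1) * centralBinom p N (j + 1) :=
          by
  unfold centralBinom
  have e1 := invPoch_sub_one hp (N + j + 1)
  have e2 := invPoch_sub_one hp (N + j)
  have e3 := invPoch_sub_one hp (N - j + 1)
  have e4 := invPoch_sub_one hp (N - j)
  rw [add_sub_cancel_right] at e1 e3
  rw [show ((N + 1 : ℕ) : ℤ) + j = N + j + 1 by push_cast; ring,
    show ((N + 1 : ℕ) : ℤ) - j = N - j + 1 by push_cast; ring,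
    show (N : ℤ) + (j - 1) = N + j - 1 by ring, show (N : ℤ) - (j - 1) = N - j + 1 by ring,
    show (N : ℤ) + (j + 1) = N + j + 1 by ring, show (N : ℤ) - (j + 1) = N - j - 1 by ring,
    e2, e4, e1, e3, show 2 * (N + 1) = 2 * N + 1 + 1 by ring, qPoch_succ, qPoch_succ]
  have h : p * p ^ (2 * N) = p * (p ^ ((N : ℤ) + j) * p ^ ((N : ℤ) - j)) := by
    rw [← zpow_add₀ hp0, ← zpow_natCast]; congr 2; push_cast; ring
  rw [zpow_add_one₀ hp0, zpow_add_one₀ hp0, pow_succ' p (2 * N), mul_left_comm, h]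
  ring

lemma theta_term_sub_one {a b : ℂ} (ha : a ≠ 0) (hb : b ≠ 0) (N : ℕ) (j : ℤ) :
    a * (a * b) ^ N * (a ^ ((j - 1) * (j - 1 + 1) / 2) * b ^ ((j - 1) * (j - 1 - 1) / 2))
      = (a * b) ^ ((N : ℤ) - j + 1) * (a ^ (j * (j + 1) / 2) * b ^ (j * (j - 1) / 2)) := by
  have h1 : j * (j + 1) / 2 = (j - 1) * (j - 1 + 1) / 2 + j := by
    rw [← Int.add_mul_ediv_right _ _ two_ne_zero]; congr 1; ring
  have h2 : j * (j - 1) / 2 = (j - 1) * (j - 1 - 1) / 2 + (j - 1) := by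
    rw [← Int.add_mul_ediv_right _ _ two_ne_zero]; congr 1; ring
  rw [h1, h2, zpow_add₀ ha, zpow_add₀ hb, ← zpow_natCast, mul_zpow, mul_zpow,
    show a ^ (N : ℤ) = a ^ ((N : ℤ) - j + 1) * a ^ j * a⁻¹ by
      rw [← zpow_add₀ ha, ← zpow_sub_one₀ ha]; congr 1; ring,
    show b ^ (N : ℤ) = b ^ ((N : ℤ) - j + 1) * b ^ (j - 1) by
      rw [← zpow_add₀ hb]; congr 1; ring]
  field_simp

lemma theta_term_swap (a b : ℂ) (j : ℤ) :
    a ^ (-j * (-j + 1) / 2) * b ^ (-j * (-j - 1) / 2)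
      = b ^ (j * (j + 1) / 2) * a ^ (j * (j - 1) / 2) := by
  rw [mul_comm]; congr 3 <;> ring

lemma theta_term_add_one {a b : ℂ} (ha : a ≠ 0) (hb : b ≠ 0) (N : ℕ) (j : ℤ) :
    b * (a * b) ^ N * (a ^ ((j + 1) * (j + 1 + 1) / 2) * b ^ ((j + 1) * (j + 1 - 1) / 2))
      = (a * b) ^ ((N : ℤ) + j + 1) * (a ^ (j * (j + 1) / 2) * b ^ (j * (j - 1) / 2)) := by
  have h := theta_term_sub_one hb ha N (-j)
  rw [theta_term_swap, show -j - 1 = -(j + 1) by ring, theta_term_swap] at h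
  rw [mul_comm a b, h]
  congr 2; ring

/-- The finite form of the Jacobi triple product. -/
lemma finite_triple_product {a b : ℂ} (ha : a ≠ 0) (hb : b ≠ 0) (hab : ‖a * b‖ < 1) (N : ℕ) :
    qPoch (-a) (a * b) N * qPoch (-b) (a * b) N
      = ∑' j : ℤ, a ^ (j * (j + 1) / 2) * b ^ (j * (j - 1) / 2) * centralBinom (a * b) N j := by
  induction N with
  | zero =>
    rw [tsum_eq_single 0]
    · have := invPoch_natCast (a * b) 0
      simp only [Nat.cast_zero] at this
      simp [qPoch_zero, centralBinom, this]
    · intro j hj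
      rw [centralBinom_eq_zero, mul_zero]
      simpa using hj
  | succ N ih =>
    set t : ℤ → ℂ := fun j => a ^ (j * (j + 1) / 2) * b ^ (j * (j - 1) / 2) with ht
    have hs : Summable fun j => t j * centralBinom (a * b) N j :=
      summable_of_ne_finset_zero (s := Finset.Icc (-(N : ℤ)) N) fun j hj => by
        rw [centralBinom_eq_zero _ _ _ hj, mul_zero]
    have h0 := hs.hasSum
    have h1 := ((Equiv.subRight (1 : ℤ)).hasSum_iff.2 h0).mul_left (a * (a * b) ^ N)
    have h2 := ((Equiv.addRight (1 : ℤ)).hasSum_iff.2 h0).mul_left (b * (a * b) ^ N)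
    rw [qPoch_succ, qPoch_succ, mul_mul_mul_comm, ih]
    -- Since ab = p, (1 + a p^N)(1 + b p^N) = 1 + p^(2N+1) + a p^N + b p^N. The last two terms shift
    -- the summation index by one in either direction.
    calc _ = (1 + (a * b) ^ (2 * N + 1)) * (∑' j, t j * centralBinom (a * b) N j)
          + a * (a * b) ^ N * (∑' j, t j * centralBinom (a * b) N j)
          + b * (a * b) ^ N * (∑' j, t j * centralBinom (a * b) N j) := by ring
      _ = ∑' j, ((1 + (a * b) ^ (2 * N + 1)) * (t j * centralBinom (a * b) N j)
          + a * (a * b) ^ N * (t (j - 1) * centralBinom (a * b) N (j - 1))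
          + b * (a * b) ^ N * (t (j + 1) * centralBinom (a * b) N (j + 1))) :=
        (((h0.mul_left _).add h1).add h2).tsum_eq.symm
      _ = _ := by
        refine tsum_congr fun j => ?_
        have h1 := theta_term_sub_one ha hb N j
        have h2 := theta_term_add_one ha hb N j
        rw [centralBinom_succ hab (mul_ne_zero ha hb), ← mul_assoc (a * (a * b) ^ N),
          ← mul_assoc (b * (a * b) ^ N), ht]
        simp only
        rw [h1, h2]
        ring

/-- The Jacobi triple product in Ramanujan's form. -/
theorem triple_product {a b : ℂ} (ha : a ≠ 0) (hb : b ≠ 0) (hab : ‖a * b‖ < 1)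
    (hs : Summable fun j : ℤ => ‖a ^ (j * (j + 1) / 2) * b ^ (j * (j - 1) / 2)‖) :
    f a b = qPochInf (-a) (a * b) * qPochInf (-b) (a * b) * qPochInf (a * b) (a * b) := by
  set p := a * b with hp
  obtain ⟨C, hC⟩ := exists_bound_qPoch p hab
  obtain ⟨D, hD⟩ := exists_bound_qPoch_inv hab
  have hC0 : 0 ≤ C := (norm_nonneg _).trans (hC 0)
  have hD0 : 0 ≤ D := (norm_nonneg _).trans (hD 0)
  have hD' : ∀ n : ℤ, ‖invPoch p n‖ ≤ D := by
    intro n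
    unfold invPoch
    split_ifs with h
    · simpa using hD0
    · exact hD _
  have hinv : ∀ u : ℕ → ℤ, Tendsto u atTop atTop →
      Tendsto (fun N => invPoch p (u N)) atTop (𝓝 (qPochInf p p)⁻¹) := by
    intro u hu
    have h1 : Tendsto (fun N => (u N).toNat) atTop atTop :=
      tendsto_atTop.2 fun m => (tendsto_atTop.1 hu m).mono fun N h => by omega
    refine (((tendsto_qPoch p hab).inv₀ (qPochInf_self_ne_zero hab)).comp h1).congr' ?_
    filter_upwards [tendsto_atTop.1 hu 0] with N h
    simp [invPoch, not_lt.2 h]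
  have hbin : ∀ j : ℤ, Tendsto (fun N => centralBinom p N j) atTop (𝓝 (qPochInf p p)⁻¹) := by
    intro j
    have h2 : Tendsto (fun N : ℕ => qPoch p p (2 * N)) atTop (𝓝 (qPochInf p p)) :=
      (tendsto_qPoch p hab).comp (tendsto_id.const_mul_atTop' (by norm_num))
    have := h2.mul ((hinv (fun N => N + j)
      (tendsto_atTop_add_const_right _ _ tendsto_natCast_atTop_atTop)).mul (hinv (fun N => N - j)
      (tendsto_atTop_add_const_right _ _ tendsto_natCast_atTop_atTop)))
    rwa [mul_inv_cancel_left₀ (qPochInf_self_ne_zero hab)] at this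
  -- Passage to the limit under the sum: the binomials are bounded uniformly in N and j, and each
  -- tends to 1/(p; p)_∞.
  have key : Tendsto (fun N : ℕ => ∑' j : ℤ,
      a ^ (j * (j + 1) / 2) * b ^ (j * (j - 1) / 2) * centralBinom p N j) atTop
      (𝓝 (∑' j : ℤ, a ^ (j * (j + 1) / 2) * b ^ (j * (j - 1) / 2) * (qPochInf p p)⁻¹)) := by
    refine tendsto_tsum_of_dominated_convergence (hs.mul_right (C * (D * D)))
      (fun j => (hbin j).const_mul _) (Eventually.of_forall fun N j => ?_)
    rw [norm_mul]
    refine mul_le_mul_of_nonneg_left ?_ (norm_nonneg _)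
    rw [centralBinom, norm_mul, norm_mul]
    exact mul_le_mul (hC _) (mul_le_mul (hD' _) (hD' _) (norm_nonneg _) hD0) (by positivity) hC0
  simp_rw [hp, ← finite_triple_product ha hb hab] at key
  have := tendsto_nhds_unique key ((tendsto_qPoch (-a) hab).mul (tendsto_qPoch (-b) hab))
  rw [tsum_mul_right] at this
  rw [← hp] at this
  rw [← this, f, inv_mul_cancel_right₀ (qPochInf_self_ne_zero hab)]

lemma qPoch_two_mul (a q : ℂ) (N : ℕ) :
    qPoch a q (2 * N) = qPoch a (q ^ 2) N * qPoch (a * q) (q ^ 2) N := by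
  induction N with
  | zero => simp [qPoch_zero]
  | succ N ih =>
    rw [show 2 * (N + 1) = 2 * N + 1 + 1 by ring, qPoch_succ, qPoch_succ, qPoch_succ, qPoch_succ,
        ih]
    ring

lemma qPoch_three_mul (a q : ℂ) (N : ℕ) : qPoch a q (3 * N)
    = qPoch a (q ^ 3) N * qPoch (a * q) (q ^ 3) N * qPoch (a * q ^ 2) (q ^ 3) N := by
  induction N with
  | zero => simp [qPoch_zero]
  | succ N ih =>
    rw [show 3 * (N + 1) = 3 * N + 1 + 1 + 1 by ring]
    simp only [qPoch_succ, ih]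
    ring

lemma norm_pow_lt_one {q : ℂ} (hq : ‖q‖ < 1) {n : ℕ} (hn : n ≠ 0) : ‖q ^ n‖ < 1 := by
  rw [norm_pow]; exact pow_lt_one₀ (norm_nonneg _) hq hn

lemma qPochInf_two (a : ℂ) {q : ℂ} (hq : ‖q‖ < 1) :
    qPochInf a q = qPochInf a (q ^ 2) * qPochInf (a * q) (q ^ 2) := by
  have h := norm_pow_lt_one hq two_ne_zero
  refine tendsto_nhds_unique ((tendsto_qPoch a hq).comp
    (tendsto_id.const_mul_atTop' (show 0 < 2 by norm_num))) ?_
  exact ((tendsto_qPoch a h).mul (tendsto_qPoch (a * q) h)).congr fun N =>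
    (qPoch_two_mul a q N).symm

lemma qPochInf_three (a : ℂ) {q : ℂ} (hq : ‖q‖ < 1) : qPochInf a q
    = qPochInf a (q ^ 3) * qPochInf (a * q) (q ^ 3) * qPochInf (a * q ^ 2) (q ^ 3) := by
  have h := norm_pow_lt_one hq three_ne_zero
  refine tendsto_nhds_unique ((tendsto_qPoch a hq).comp
    (tendsto_id.const_mul_atTop' (show 0 < 3 by norm_num))) ?_
  exact (((tendsto_qPoch a h).mul (tendsto_qPoch (a * q) h)).mul
    (tendsto_qPoch (a * q ^ 2) h)).congr fun N => (qPoch_three_mul a q N).symm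

lemma qPochInf_mul_neg (a : ℂ) {q : ℂ} (hq : ‖q‖ < 1) :
    qPochInf a q * qPochInf (-a) q = qPochInf (a ^ 2) (q ^ 2) := by
  refine tendsto_nhds_unique ((tendsto_qPoch a hq).mul (tendsto_qPoch (-a) hq)) ?_
  refine (tendsto_qPoch (a ^ 2) (norm_pow_lt_one hq two_ne_zero)).congr fun N => ?_
  rw [qPoch, qPoch, qPoch, ← Finset.prod_mul_distrib]
  exact Finset.prod_congr rfl fun k _ => by ring

lemma summable_norm_f_neg {s t : ℕ} (q : ℂ) (hq : ‖q‖ < 1)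
    (h : ∀ n : ℤ, (n.natAbs : ℤ) ≤ (((s : ℤ) + t) * n ^ 2 + (s - t) * n) / 2) :
    Summable fun n : ℤ => ‖(-q ^ s) ^ (n * (n + 1) / 2) * (-q ^ t) ^ (n * (n - 1) / 2)‖ := by
  refine (summable_norm_series (c := fun n => (-1) ^ n) (fun n => (norm_neg_one_zpow n).le)
    h hq).congr fun n => ?_
  rw [f_neg_neg_term]

theorem E_eq_qPochInf {q : ℂ} (hq : ‖q‖ < 1) : E q = qPochInf q q := by
  rcases eq_or_ne q 0 with rfl | h0
  · rw [E_eq_altTheta, altTheta_zero (by norm_num) (by norm_num)]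
    simp [qPochInf]
  have hs := summable_norm_f_neg (s := 1) (t := 2) q hq (by
    intro n
    have := altTheta_exponent 3 (-1) n le_rfl (by norm_num)
    norm_num at this ⊢; exact this)
  have h := triple_product (a := -q) (b := -q ^ 2) (by simpa) (by simpa)
    (by rw [neg_mul_neg, ← pow_succ']; exact norm_pow_lt_one hq (by norm_num))
    (by simpa using hs)
  rw [E, h, qPochInf_three q hq, neg_neg, neg_neg, neg_mul_neg, ← pow_succ', ← pow_two]

theorem E_ne_zero {q : ℂ} (hq : ‖q‖ < 1) : E q ≠ 0 := by
  rw [E_eq_qPochInf hq]; exact qPochInf_self_ne_zero hq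

/-- φ(-q) = (q; q²)²(q²; q²), while E(q) = (q; q²)(q²; q²), all products being infinite. -/
theorem phi_neg_mul_E {q : ℂ} (hq : ‖q‖ < 1) (h0 : q ≠ 0) : phi (-q) * E (q ^ 2) = E q ^ 2 := by
  have h2 := norm_pow_lt_one hq two_ne_zero
  have hs := summable_norm_f_neg (s := 1) (t := 1) q hq (by
    intro n
    rw [show (((1 : ℕ) : ℤ) + (1 : ℕ)) * n ^ 2 + (((1 : ℕ) : ℤ) - (1 : ℕ)) * n = n ^ 2 * 2 by
      push_cast; ring, Int.mul_ediv_cancel _ two_ne_zero, ← Int.natAbs_sq]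
    exact_mod_cast Nat.le_self_pow two_ne_zero _)
  have h := triple_product (a := -q) (b := -q) (by simpa) (by simpa)
    (by rw [neg_mul_neg, ← pow_two]; exact h2)
    (by simpa using hs)
  rw [neg_neg, show -q * -q = q ^ 2 by ring] at h
  rw [phi, h, E_eq_qPochInf hq, E_eq_qPochInf h2, qPochInf_two q hq, show q * q = q ^ 2 by ring]
  ring

/-- The triple product gives ψ(q) = (-q; q²)(q⁴; q⁴). Then (q; q²)(-q; q²) = (q²; q⁴), and (q²;
q⁴)(q⁴; q⁴) = (q²; q²). -/
theorem psi_mul_E {q : ℂ} (hq : ‖q‖ < 1) (h0 : q ≠ 0) : psi q * E q = E (q ^ 2) ^ 2 := by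
  have h2 := norm_pow_lt_one hq two_ne_zero
  have h := triple_product (a := q) (b := q ^ 3) h0 (by simpa)
    (by rw [← pow_succ']; exact norm_pow_lt_one hq (by norm_num))
    ((summable_norm_series (c := fun n => 1) (k := fun n => 2 * n ^ 2 - n) (by simp) (fun n => by
        have h1 : |n| ≤ n ^ 2 := by
          rw [← sq_abs]; rcases eq_or_lt_of_le (abs_nonneg n) with h | h <;> nlinarith
        rw [Int.natCast_natAbs]
        linarith [le_abs_self n]) hq).congr fun n => by rw [one_mul, psi_term])
  rw [psi, h, E_eq_qPochInf hq, E_eq_qPochInf h2, ← pow_succ']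
  norm_num
  have e1 := qPochInf_two (-q) hq
  have e2 := qPochInf_two (-q) h2
  have e3 := qPochInf_two (q ^ 2) h2
  have e4 := qPochInf_mul_neg q h2
  rw [show -q * q ^ 2 = -q ^ 3 by ring, ← pow_mul] at e2
  rw [← pow_two, ← pow_mul] at e3
  rw [← pow_mul] at e4
  rw [← e2, qPochInf_two q hq, ← pow_two, pow_two (qPochInf (q ^ 2) _)]
  nth_rewrite 2 [e3]
  norm_num at e4 ⊢
  rw [← e4]
  ring

/-! ### The Rogers-Ramanujan identities -/

lemma exists_bound_prod_one_add_pow {x : ℝ} (h0 : 0 ≤ x) (h1 : x < 1) :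
    ∃ B : ℝ, ∀ n : ℕ, ∏ k ∈ Finset.range n, (1 + x ^ k) ≤ B := by
  refine ⟨Real.exp (∑' k : ℕ, x ^ k), fun n => ?_⟩
  calc _ ≤ ∏ k ∈ Finset.range n, Real.exp (x ^ k) :=
        Finset.prod_le_prod (fun k _ => by positivity) fun k _ => by
          rw [add_comm]; exact Real.add_one_le_exp _
    _ = Real.exp (∑ k ∈ Finset.range n, x ^ k) := (Real.exp_sum _ _).symm
    _ ≤ _ := Real.exp_le_exp.2
        ((summable_geometric_of_lt_one h0 h1).sum_le_tsum _ fun k _ => by positivity)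

/-- Uniformity in a is what allows the later limit along a = q^(n+1) → 0 inside the series. -/
lemma exists_bound_qPoch_div {q : ℂ} (hq : ‖q‖ < 1) :
    ∃ C : ℝ, 0 ≤ C ∧ ∀ a : ℂ, ‖a‖ ≤ 1 → ∀ r, ‖qPoch a q r / qPoch q q r‖ ≤ C := by
  obtain ⟨B, hB⟩ := exists_bound_prod_one_add_pow (norm_nonneg q) hq
  obtain ⟨D, hD⟩ := exists_bound_qPoch_inv hq
  have hB0 : 0 ≤ B := zero_le_one.trans (by simpa using hB 0)
  refine ⟨B * D, mul_nonneg hB0 ((norm_nonneg _).trans (hD 0)), fun a ha r => ?_⟩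
  rw [div_eq_mul_inv, norm_mul]
  refine mul_le_mul ?_ (hD r) (norm_nonneg _) hB0
  refine le_trans ?_ (hB r)
  rw [qPoch, norm_prod]
  refine Finset.prod_le_prod (fun _ _ => norm_nonneg _) fun k _ => ?_
  calc ‖1 - a * q ^ k‖ ≤ ‖(1 : ℂ)‖ + ‖a * q ^ k‖ := norm_sub_le _ _
    _ ≤ 1 + ‖q‖ ^ k := by
      rw [norm_one, norm_mul, norm_pow]
      gcongr
      exact mul_le_of_le_one_left (by positivity) ha

/-- A typical term in Rogers' series. -/
def rogersTerm (k l : ℕ → ℕ) (w : ℕ → ℂ) (a q : ℂ) (r : ℕ) : ℂ :=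
  (-1) ^ r * a ^ k r * q ^ l r * w r * (qPoch a q r / qPoch q q r)

lemma norm_rogersTerm_le {k l : ℕ → ℕ} {w : ℕ → ℂ} {a q : ℂ} {C : ℝ} (hq : ‖q‖ < 1)
    (ha : ‖a‖ ≤ 1) (hl : ∀ r, r ≤ l r) (hw : ∀ r, ‖w r‖ ≤ 2)
    (hC : ∀ r, ‖qPoch a q r / qPoch q q r‖ ≤ C) (r : ℕ) :
    ‖rogersTerm k l w a q r‖ ≤ ‖q‖ ^ r * (2 * C) := by
  have hC0 : 0 ≤ C := (norm_nonneg _).trans (hC 0)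
  rw [rogersTerm, norm_mul, norm_mul, norm_mul, norm_mul, norm_pow, norm_neg, norm_one, one_pow,
    one_mul, norm_pow, norm_pow, mul_assoc]
  refine mul_le_mul ?_ (mul_le_mul (hw r) (hC r) (norm_nonneg _) (by norm_num)) (by positivity)
    (by positivity)
  calc _ ≤ 1 * ‖q‖ ^ r := mul_le_mul (pow_le_one₀ (norm_nonneg _) ha)
        (pow_le_pow_of_le_one (norm_nonneg _) hq.le (hl r)) (by positivity) zero_le_one
    _ = _ := one_mul _

lemma summable_rogersTerm {k l : ℕ → ℕ} {w : ℕ → ℂ} {a q : ℂ} (hq : ‖q‖ < 1)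
    (ha : ‖a‖ ≤ 1) (hl : ∀ r, r ≤ l r) (hw : ∀ r, ‖w r‖ ≤ 2) :
    Summable (rogersTerm k l w a q) := by
  obtain ⟨C, -, hC⟩ := exists_bound_qPoch_div hq
  exact Summable.of_norm_bounded ((summable_geometric_of_lt_one (norm_nonneg _) hq).mul_right _)
    (norm_rogersTerm_le hq ha hl hw (hC a ha))

lemma norm_one_sub_le_two {z : ℂ} (hz : ‖z‖ ≤ 1) : ‖1 - z‖ ≤ 2 := by
  calc _ ≤ ‖(1 : ℂ)‖ + ‖z‖ := norm_sub_le _ _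
    _ ≤ 2 := by rw [norm_one]; linarith

/-- Rogers' series specializing to `f(-q, -q^4)`. -/
def rogersOne (a q : ℂ) : ℂ := ∑' r, rogersTerm (fun r => 2 * r)
  (fun r => 5 * r.choose 2 + 2 * r) (fun r => 1 - a * q ^ (2 * r)) a q r

/-- Rogers' series specializing to `f(-q^2, -q^3)`. -/
def rogersTwo (a q : ℂ) : ℂ := ∑' r, rogersTerm (fun r => 2 * r)
  (fun r => 5 * r.choose 2 + r) (fun r => 1 - a ^ 2 * q ^ (4 * r)) a q r

/-- Because X 0 = 0, shifting X by one does not change its sum; both sides equal ∑X + ∑Y. -/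
lemma tsum_eq_of_telescope {u v X Y : ℕ → ℂ} (hX : Summable X) (hY : Summable Y) (h0 : X 0 = 0)
    (hu : ∀ r, u r = X r + Y r) (hv : ∀ r, v r = X (r + 1) + Y r) : ∑' r, u r = ∑' r, v r := by
  simp_rw [hu, hv]
  rw [hX.tsum_add hY, ((summable_nat_add_iff 1).2 hX).tsum_add hY, hX.tsum_eq_zero_add, h0,
    zero_add]

lemma choose_succ_two (r : ℕ) : (r + 1).choose 2 = r.choose 2 + r := by
  rw [Nat.choose_succ_succ' r 1]; simp [add_comm]

lemma norm_mul_pow_le_one {a q : ℂ} (hq : ‖q‖ < 1) (ha : ‖a‖ ≤ 1) (n : ℕ) : ‖a * q ^ n‖ ≤ 1 := by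
  rw [norm_mul, norm_pow]
  exact mul_le_one₀ ha (by positivity) (pow_le_one₀ (norm_nonneg _) hq.le)

/-- Split 1 - a q^(2r) = (1 - q^r) + q^r (1 - a q^r). The first factor cancels the last factor of
(q; q)_r and is reindexed; the second extends (a; q)_r to (a; q)_(r+1) = (1 - a)(aq; q)_r. -/
lemma rogersOne_eq {a q : ℂ} (hq : ‖q‖ < 1) (ha : ‖a‖ ≤ 1) :
    rogersOne a q = (1 - a) * rogersTwo (a * q) q := by
  rw [rogersTwo, ← tsum_mul_left]
  refine tsum_eq_of_telescope
    (X := rogersTerm (fun r => 2 * r) (fun r => 5 * r.choose 2 + 2 * r) (fun r => 1 - q ^ r) a q)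
    (Y := rogersTerm (fun r => 2 * r) (fun r => 5 * r.choose 2 + 3 * r) (fun r => 1 - a *
        q ^ r) a q)
    (summable_rogersTerm hq ha (fun r => by omega) fun r => norm_one_sub_le_two (by
      simpa using norm_mul_pow_le_one (a := 1) hq (by simp) r))
    (summable_rogersTerm hq ha (fun r => by omega) fun r =>
      norm_one_sub_le_two (norm_mul_pow_le_one hq ha r)) (by simp [rogersTerm]) (fun r => ?_)
    (fun r => ?_)
  · simp only [rogersTerm]; ring
  · have h1 := qPoch_self_ne_zero hq r
    have h2 := one_sub_pow_ne_zero hq r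
    have e : qPoch a q r * (1 - a * q ^ r) = (1 - a) * qPoch (a * q) q r := by
      rw [← qPoch_succ, qPoch_succ']
    simp only [rogersTerm, choose_succ_two]
    rw [qPoch_succ' a, qPoch_succ q, ← pow_succ']
    field_simp
    rw [show ∀ x y z : ℂ, x * y * z = x * (y * z) from mul_assoc] at *
    linear_combination (-(-1) ^ r * a ^ (2 * r) * q ^ (5 * r.choose 2 + 3 * r)) * e

/-- Same telescoping, from q^r(1 - a²q^(4r)) - q^(2r)(1 - a q^(2r)) = q^r(1 - q^r) + a q^(4r)(1 - a
q^r). -/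
lemma rogersTwo_sub_rogersOne {a q : ℂ} (hq : ‖q‖ < 1) (ha : ‖a‖ ≤ 1) :
    rogersTwo a q - rogersOne a q = a * (1 - a) * rogersOne (a * q) q := by
  have haq : ‖a ^ 2‖ ≤ 1 := by rw [norm_pow]; exact pow_le_one₀ (norm_nonneg _) ha
  rw [rogersTwo, rogersOne, rogersOne, ← tsum_mul_left, ← Summable.tsum_sub
    (summable_rogersTerm hq ha (fun r => by omega) fun r =>
      norm_one_sub_le_two (norm_mul_pow_le_one hq haq _))
    (summable_rogersTerm hq ha (fun r => by omega) fun r =>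
      norm_one_sub_le_two (norm_mul_pow_le_one hq ha _))]
  refine tsum_eq_of_telescope
    (X := rogersTerm (fun r => 2 * r) (fun r => 5 * r.choose 2 + r) (fun r => 1 - q ^ r) a q)
    (Y := rogersTerm (fun r => 2 * r + 1) (fun r => 5 * r.choose 2 + 4 * r)
      (fun r => 1 - a * q ^ r) a q)
    (summable_rogersTerm hq ha (fun r => by omega) fun r => norm_one_sub_le_two (by
      simpa using norm_mul_pow_le_one (a := 1) hq (by simp) r))
    (summable_rogersTerm hq ha (fun r => by omega) fun r =>
      norm_one_sub_le_two (norm_mul_pow_le_one hq ha r)) (by simp [rogersTerm]) (fun r => ?_)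
    (fun r => ?_)
  · simp only [rogersTerm]; ring
  · have h1 := qPoch_self_ne_zero hq r
    have h2 := one_sub_pow_ne_zero hq r
    have e : qPoch a q r * (1 - a * q ^ r) = (1 - a) * qPoch (a * q) q r := by
      rw [← qPoch_succ, qPoch_succ']
    simp only [rogersTerm, choose_succ_two]
    rw [qPoch_succ' a, qPoch_succ q, ← pow_succ']
    field_simp
    linear_combination (-(-1) ^ r * a ^ (2 * r + 1) * q ^ (5 * r.choose 2 + 4 * r)) * e

lemma rogersTwo_rec {a q : ℂ} (hq : ‖q‖ < 1) (ha : ‖a‖ ≤ 1) : rogersTwo a q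
    = (1 - a) * rogersTwo (a * q) q + a * (1 - a) * (1 - a * q) * rogersTwo (a * q ^ 2) q := by
  have h1 := rogersOne_eq hq ha
  have h2 := rogersTwo_sub_rogersOne hq ha
  have h3 := rogersOne_eq hq (a := a * q) (by simpa using norm_mul_pow_le_one hq ha 1)
  rw [show a * q * q = a * q ^ 2 by ring] at h3
  linear_combination h1 + h2 + a * (1 - a) * h3

/-- The Rogers--Ramanujan series `∑ q^{n s + s^2} / (q; q)_s`. -/
def rrSeries (q : ℂ) (n : ℕ) : ℂ := ∑' s : ℕ, q ^ (n * s + s ^ 2) / qPoch q q s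

lemma norm_rrSeries_term_le {q : ℂ} {D : ℝ} (hq : ‖q‖ < 1) (hD : ∀ n, ‖(qPoch q q n)⁻¹‖ ≤ D)
    (n s : ℕ) : ‖q ^ (n * s + s ^ 2) / qPoch q q s‖ ≤ ‖q‖ ^ s * D := by
  rw [div_eq_mul_inv, norm_mul, norm_pow]
  refine mul_le_mul (pow_le_pow_of_le_one (norm_nonneg _) hq.le ?_) (hD s) (norm_nonneg _)
    (by positivity)
  nlinarith [Nat.le_self_pow two_ne_zero s, Nat.zero_le (n * s)]

lemma summable_rrSeries {q : ℂ} (hq : ‖q‖ < 1) (n : ℕ) :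
    Summable fun s : ℕ => q ^ (n * s + s ^ 2) / qPoch q q s := by
  obtain ⟨D, hD⟩ := exists_bound_qPoch_inv hq
  exact Summable.of_norm_bounded ((summable_geometric_of_lt_one (norm_nonneg _) hq).mul_right _)
    (norm_rrSeries_term_le hq hD n)

/-- In the difference of consecutive series the factor 1 - q^s cancels the last factor of (q; q)_s,
and s is shifted by one. -/
lemma rrSeries_rec {q : ℂ} (hq : ‖q‖ < 1) (n : ℕ) :
    rrSeries q n = rrSeries q (n + 1) + q ^ (n + 1) * rrSeries q (n + 2) := by
  have h0 := summable_rrSeries hq n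
  have h1 := summable_rrSeries hq (n + 1)
  rw [← sub_eq_iff_eq_add', rrSeries, rrSeries, rrSeries, ← h0.tsum_sub h1, ← tsum_mul_left,
    (h0.sub h1).tsum_eq_zero_add]
  simp only [mul_zero, zero_pow two_ne_zero, add_zero, sub_self, zero_add]
  refine tsum_congr fun s => ?_
  have h1 := qPoch_self_ne_zero hq s
  have h2 := one_sub_pow_ne_zero hq s
  rw [qPoch_succ q, ← pow_succ']
  field_simp
  ring

lemma tendsto_rrSeries {q : ℂ} (hq : ‖q‖ < 1) : Tendsto (rrSeries q) atTop (𝓝 1) := by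
  obtain ⟨D, hD⟩ := exists_bound_qPoch_inv hq
  have : Tendsto (rrSeries q) atTop (𝓝 (∑' s : ℕ, if s = 0 then 1 else 0)) := by
    refine tendsto_tsum_of_dominated_convergence
      ((summable_geometric_of_lt_one (norm_nonneg _) hq).mul_right D) (fun s => ?_)
      (Eventually.of_forall fun n s => norm_rrSeries_term_le hq hD n s)
    rcases s with _ | s
    · simp [qPoch_zero]
    · simp only [Nat.add_eq_zero_iff, one_ne_zero, and_false, if_false]
      have h1 : Tendsto (fun n : ℕ => q ^ (n * (s + 1) + (s + 1) ^ 2)) atTop (𝓝 0) :=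
        (tendsto_pow_atTop_nhds_zero_of_norm_lt_one hq).comp
          (tendsto_atTop_mono (fun n => (Nat.le_mul_of_pos_right n s.succ_pos).trans
            (Nat.le_add_right _ _)) tendsto_id)
      simpa using h1.div_const (qPoch q q (s + 1))
  simpa using this

lemma tendsto_rogersTwo {q : ℂ} (hq : ‖q‖ < 1) :
    Tendsto (fun n : ℕ => rogersTwo (q ^ (n + 1)) q) atTop (𝓝 1) := by
  obtain ⟨C, -, hC⟩ := exists_bound_qPoch_div hq
  have hn : ∀ n : ℕ, ‖q ^ (n + 1)‖ ≤ 1 := fun n => (norm_pow_lt_one hq (by omega)).le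
  have : Tendsto (fun n : ℕ => rogersTwo (q ^ (n + 1)) q) atTop
      (𝓝 (∑' s : ℕ, if s = 0 then 1 else 0)) := by
    refine tendsto_tsum_of_dominated_convergence
      ((summable_geometric_of_lt_one (norm_nonneg _) hq).mul_right (2 * C)) (fun r => ?_)
      (Eventually.of_forall fun n r => norm_rogersTerm_le hq (hn n) (fun r => by omega)
        (fun r => norm_one_sub_le_two (norm_mul_pow_le_one hq
          (by rw [norm_pow]; exact pow_le_one₀ (norm_nonneg _) (hn n)) _)) (hC _ (hn n)) r)
    have hc : Continuous fun a : ℂ => rogersTerm (fun r => 2 * r)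
        (fun r => 5 * r.choose 2 + r) (fun r => 1 - a ^ 2 * q ^ (4 * r)) a q r := by
      unfold rogersTerm qPoch
      fun_prop
    have h1 := (hc.tendsto 0).comp ((tendsto_pow_atTop_nhds_zero_of_norm_lt_one hq).comp
      (tendsto_add_atTop_nat 1))
    have e : rogersTerm (fun r => 2 * r) (fun r => 5 * r.choose 2 + r)
        (fun r => 1 - 0 ^ 2 * q ^ (4 * r)) 0 q r = if r = 0 then 1 else 0 := by
      rcases r with _ | r <;> simp [rogersTerm, qPoch_zero]
    rw [e] at h1
    exact h1
  simpa using this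

/-- Uniqueness for the recursion given the limit at infinity. The weights c n absorb the factors 1 +
|q|^(n+1) that one step can cost; since their product converges, smallness far out propagates down
to n. -/
lemma eq_zero_of_rec {q : ℂ} (hq : ‖q‖ < 1) {d : ℕ → ℂ}
    (hd : ∀ n, d n = d (n + 1) + q ^ (n + 1) * d (n + 2)) (h0 : Tendsto d atTop (𝓝 0)) (n : ℕ) :
    d n = 0 := by
  set x := ‖q‖ with hx
  obtain ⟨B, hB⟩ := exists_bound_prod_one_add_pow (norm_nonneg q) hq
  rw [← hx] at hB
  set c : ℕ → ℝ := fun n => ∏ k ∈ Finset.range n, (1 + x ^ (k + 1)) with hc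
  have hx0 : 0 ≤ x := norm_nonneg _
  have hc1 : ∀ n, 1 ≤ c n := fun n =>
    Finset.prod_induction _ (fun y => 1 ≤ y) (fun _ _ => one_le_mul_of_one_le_of_one_le) le_rfl
      fun k _ => by linarith [pow_nonneg hx0 (k + 1)]
  have hcB : ∀ n, c n ≤ B := fun n => le_trans (Finset.prod_le_prod (fun k _ => by positivity)
    fun k _ => by
      have := pow_le_pow_of_le_one hx0 hq.le (Nat.le_succ k)
      simpa using this) (hB n)
  have hcs : ∀ n, c (n + 1) = c n * (1 + x ^ (n + 1)) := fun n => Finset.prod_range_succ _ _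
  have key : ∀ ε > 0, ‖d n‖ ≤ ε * B := by
    intro ε hε
    obtain ⟨N, hN⟩ := (Metric.tendsto_atTop.1 h0) ε hε
    have hN' : ∀ m ≥ N, ‖d m‖ ≤ ε := fun m hm => by simpa using (hN m hm).le
    -- Descending induction from the range m ≥ N, where d is already small; j bounds the distance to
    -- it.
    have : ∀ j m, N ≤ m + j → ‖d m‖ * c m ≤ ε * B := by
      intro j
      induction j using Nat.strong_induction_on with
      | _ j ih =>
        intro m hm
        rcases le_or_gt N m with h | h
        · exact mul_le_mul (hN' m h) (hcB m) (by linarith [hc1 m]) hε.le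
        · have h1 := ih (j - 1) (by omega) (m + 1) (by omega)
          have h2 := ih (j - 1) (by omega) (m + 2) (by omega)
          have h3 : ‖d m‖ ≤ ‖d (m + 1)‖ + x ^ (m + 1) * ‖d (m + 2)‖ := by
            rw [hd m]
            exact (norm_add_le _ _).trans (by rw [norm_mul, norm_pow])
          have h4 : ‖d (m + 2)‖ * c (m + 1) ≤ ε * B := by
            refine le_trans (mul_le_mul_of_nonneg_left ?_ (norm_nonneg _)) h2
            rw [hcs (m + 1)]
            exact le_mul_of_one_le_right (by linarith [hc1 (m + 1)])
              (by linarith [pow_nonneg hx0 (m + 1 + 1)])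
          have hp : 0 < 1 + x ^ (m + 1) := by positivity
          have : ‖d m‖ * c (m + 1) ≤ ε * B * (1 + x ^ (m + 1)) := by
            calc _ ≤ (‖d (m + 1)‖ + x ^ (m + 1) * ‖d (m + 2)‖) * c (m + 1) :=
                  mul_le_mul_of_nonneg_right h3 (by linarith [hc1 (m + 1)])
              _ = ‖d (m + 1)‖ * c (m + 1) + x ^ (m + 1) * (‖d (m + 2)‖ * c (m + 1)) := by ring
              _ ≤ ε * B + x ^ (m + 1) * (ε * B) := by gcongr
              _ = _ := by ring
          rw [hcs, ← mul_assoc] at this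
          exact le_of_mul_le_mul_right this hp
    refine le_trans ?_ (this N n (by omega))
    exact le_mul_of_one_le_right (norm_nonneg _) (hc1 n)
  have hB1 : 0 < B := by linarith [hc1 0, hcB 0]
  refine norm_le_zero_iff.1 (le_of_forall_pos_le_add fun ε hε => ?_)
  have := key (ε / B) (by positivity)
  rw [div_mul_cancel₀ _ hB1.ne'] at this
  linarith

/-- At a = q^(n+1), after multiplication by (q; q)_n, Rogers' recursion becomes that of `rrSeries`.
Both sides have the limit (q; q)_∞, so their difference vanishes. -/
lemma rogersTwo_mul_qPoch {q : ℂ} (hq : ‖q‖ < 1) (n : ℕ) :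
    rogersTwo (q ^ (n + 1)) q * qPoch q q n = qPochInf q q * rrSeries q n := by
  rw [← sub_eq_zero]
  refine eq_zero_of_rec hq (d := fun n => rogersTwo (q ^ (n + 1)) q * qPoch q q n
    - qPochInf q q * rrSeries q n) (fun n => ?_) ?_ n
  · have h := rogersTwo_rec hq (norm_pow_lt_one (n := n + 1) hq n.succ_ne_zero).le
    rw [h, rrSeries_rec hq n, qPoch_succ q q (n + 1), qPoch_succ q q n]
    simp only [← pow_succ, ← pow_succ', ← pow_add]
    ring_nf
  · have := ((tendsto_rogersTwo hq).mul (tendsto_qPoch q hq)).sub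
      ((tendsto_rrSeries hq).const_mul (qPochInf q q))
    simpa using this

lemma G_eq_rrSeries (q : ℂ) : G q = rrSeries q 0 := by simp [G, rrSeries]

lemma H_eq_rrSeries (q : ℂ) : H q = rrSeries q 1 :=
  tsum_congr fun n => by ring_nf

lemma two_mul_choose_two (n : ℕ) : 2 * (n.choose 2 : ℤ) = n * (n - 1) := by
  induction n with
  | zero => simp
  | succ n ih => rw [choose_succ_two]; push_cast; linarith

/-- Splitting an alternating theta series into its nonnegative and negative halves. -/
lemma altTheta_eq_tsum_nat {N r : ℤ} (hN : 3 ≤ N) (hr : |r| ≤ N - 2) {q : ℂ} (hq : ‖q‖ < 1)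
    (u v : ℕ → ℕ) (hu : ∀ n : ℕ, 2 * (u n : ℤ) = N * n ^ 2 + r * n)
    (hv : ∀ n : ℕ, 2 * (v n : ℤ) = N * (n + 1) ^ 2 - r * (n + 1)) :
    altTheta N r q = ∑' n : ℕ, (-1) ^ n * (q ^ u n - q ^ v n) := by
  set F : ℤ → ℂ := fun n => (-1) ^ n * q ^ ((N * n ^ 2 + r * n) / 2) with hF
  have hs : Summable F := (summable_norm_altTheta hN hr hq).of_norm
  have h1 : Summable fun n : ℕ => F n := hs.comp_injective Nat.cast_injective
  have h2 : Summable fun n : ℕ => F (-((n : ℤ) + 1)) :=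
    hs.comp_injective (i := fun n : ℕ => -((n : ℤ) + 1)) fun a b h => by
      simp only at h; omega
  have h3 : altTheta N r q = ∑' n, F n := rfl
  rw [h3, tsum_of_nat_of_neg_add_one h1 h2, ← h1.tsum_add h2]
  refine tsum_congr fun n => ?_
  have e1 : (N * (n : ℤ) ^ 2 + r * n) / 2 = (u n : ℕ) :=
    Int.ediv_eq_of_eq_mul_left two_ne_zero (by linarith [hu n])
  have e2 : (N * (-((n : ℤ) + 1)) ^ 2 + r * (-((n : ℤ) + 1))) / 2 = (v n : ℕ) :=
    Int.ediv_eq_of_eq_mul_left two_ne_zero (by linarith [hv n])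
  simp only [hF]
  rw [e1, e2, zpow_neg, ← inv_zpow, inv_neg_one, ← Nat.cast_add_one]
  simp only [zpow_natCast]
  ring

theorem G_mul_E {q : ℂ} (hq : ‖q‖ < 1) : G q * E q = altTheta 5 1 q := by
  have h := rogersTwo_mul_qPoch hq 0
  rw [zero_add, pow_one, qPoch_zero, mul_one] at h
  rw [G_eq_rrSeries, E_eq_qPochInf hq, mul_comm, ← h, altTheta_eq_tsum_nat (by norm_num)
    (by norm_num) hq (fun n => 5 * n.choose 2 + 3 * n) (fun n => 5 * n.choose 2 + 7 * n + 2)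
    (fun n => by push_cast; linarith [two_mul_choose_two n])
    (fun n => by push_cast; linarith [two_mul_choose_two n]), rogersTwo]
  refine tsum_congr fun n => ?_
  -- At a = q the quotient (a; q)_n/(q; q)_n is 1, and the Rogers series becomes a theta series.
  rw [rogersTerm, div_self (qPoch_self_ne_zero hq n)]
  ring

theorem H_mul_E {q : ℂ} (hq : ‖q‖ < 1) : H q * E q = altTheta 5 3 q := by
  have h := rogersTwo_mul_qPoch hq 1
  have h1 := rogersOne_eq hq hq.le
  rw [qPoch_succ, qPoch_zero, pow_zero, one_mul, mul_one, mul_comm, one_add_one_eq_two, pow_two,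
    ← h1] at h
  rw [H_eq_rrSeries, E_eq_qPochInf hq, mul_comm, ← h, altTheta_eq_tsum_nat (by norm_num)
    (by norm_num) hq (fun n => 5 * n.choose 2 + 4 * n) (fun n => 5 * n.choose 2 + 6 * n + 1)
    (fun n => by push_cast; linarith [two_mul_choose_two n])
    (fun n => by push_cast; linarith [two_mul_choose_two n]), rogersOne]
  refine tsum_congr fun n => ?_
  rw [rogersTerm, div_self (qPoch_self_ne_zero hq n)]
  ring

/-! ### Binary theta series and their folding into products -/

lemma summable_norm_form {Q : ℤ → ℤ → ℤ} (hQ : ∀ n m, |n| + |m| ≤ Q n m) {q : ℂ} (hq : ‖q‖ < 1) :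
    Summable fun p : ℤ × ℤ => ‖q ^ Q p.1 p.2‖ := by
  have h := summable_pow_natAbs (norm_nonneg q) hq
  refine Summable.of_nonneg_of_le (fun _ => norm_nonneg _) (fun p => ?_)
    (h.mul_of_nonneg h (fun _ => by positivity) fun _ => by positivity)
  rw [← pow_add]
  refine norm_zpow_le hq.le ?_
  push_cast
  exact hQ p.1 p.2

/-- The substitution `(n, m) ↦ (u n + v m, w n + z m)` of determinant `±1`. -/
def unimodularEquiv (u v w z : ℤ) (h : (u * z - v * w) ^ 2 = 1) : ℤ × ℤ ≃ ℤ × ℤ where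
  toFun p := (u * p.1 + v * p.2, w * p.1 + z * p.2)
  invFun p := ((u * z - v * w) * (z * p.1 - v * p.2), (u * z - v * w) * (u * p.2 - w * p.1))
  left_inv p := by
    ext
    · linear_combination p.1 * h
    · linear_combination p.2 * h
  right_inv p := by
    ext
    · linear_combination p.1 * h
    · linear_combination p.2 * h

lemma theta_substitution (a b c u v w z : ℤ) (h : (u * z - v * w) ^ 2 = 1) (q : ℂ) :
    theta a b c q = theta (a * u ^ 2 + b * u * w + c * w ^ 2)
      (2 * a * u * v + b * (u * z + v * w) + 2 * c * w * z)
      (a * v ^ 2 + b * v * z + c * z ^ 2) q := by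
  rw [theta, ← (unimodularEquiv u v w z h).tsum_eq]
  refine tsum_congr fun p => ?_
  simp only [unimodularEquiv, Equiv.coe_fn_mk]
  congr 1; ring

/-- The signed theta series `∑_{y odd, s} (-1)^s q^{A y² + B y s + C s²}`. -/
def signedTheta (A B C : ℤ) (q : ℂ) : ℂ :=
  ∑' p : ℤ × ℤ, (-1) ^ p.2 * q ^ (A * (2 * p.1 + 1) ^ 2 + B * (2 * p.1 + 1) * p.2 + C * p.2 ^ 2)

lemma neg_one_zpow_of_even {s : ℤ} (h : s % 2 = 0) : (-1 : ℂ) ^ s = 1 :=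
  Even.neg_one_zpow (Int.even_iff.2 h)

lemma neg_one_zpow_of_odd {s : ℤ} (h : s % 2 = 1) : (-1 : ℂ) ^ s = -1 :=
  Odd.neg_one_zpow (Int.odd_iff.2 h)

lemma tsum_indicator_eq {S : Set (ℤ × ℤ)} {T T' : ℤ × ℤ → ℂ} (g : ℤ × ℤ → ℤ × ℤ)
    (hg : Function.Injective g) (hm : ∀ x, g x ∈ S) (hS : ∀ p ∈ S, ∃ x, g x = p)
    (hT : ∀ x, T (g x) = T' x) : ∑' p, S.indicator T p = ∑' x, T' x := by
  rw [← hg.tsum_eq (f := S.indicator T) fun p hp => hS p (Set.mem_of_indicator_ne_zero hp)]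
  exact tsum_congr fun x => by rw [Set.indicator_of_mem (hm x), hT]

/-- The two theta series on the right run over (y, s) with s even, and with y ≡ s modulo 2. Pairs
with both entries even cancel, leaving odd y with sign + for s even and - for s odd. -/
lemma signedTheta_eq {A B C : ℤ} (hQ : ∀ n m, |n| + |m| ≤ A * n ^ 2 + B * n * m + C * m ^ 2)
    {q : ℂ} (hq : ‖q‖ < 1) : signedTheta A B C q
      = theta A (2 * B) (4 * C) q - theta (A + B + C) (4 * A + 2 * B) (4 * A) q := by
  set T : ℤ × ℤ → ℂ := fun p => q ^ (A * p.1 ^ 2 + B * p.1 * p.2 + C * p.2 ^ 2) with hT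
  have hs : Summable T := (summable_norm_form hQ hq).of_norm
  have e0 : signedTheta A B C q
      = ∑' p, {p : ℤ × ℤ | p.1 % 2 = 1}.indicator (fun p => (-1) ^ p.2 * T p) p :=
    (tsum_indicator_eq (T := fun p => (-1) ^ p.2 * T p) (fun p : ℤ × ℤ => (2 * p.1 + 1, p.2))
      (fun p p' h => by simp only [Prod.mk.injEq] at h; ext <;> omega)
      (fun p => show (2 * p.1 + 1) % 2 = 1 by omega)
      (fun p (hp : p.1 % 2 = 1) => ⟨(p.1 / 2, p.2), by ext <;> dsimp only; omega⟩)
      fun p => rfl).symm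
  have e1 : theta A (2 * B) (4 * C) q = ∑' p, {p : ℤ × ℤ | p.2 % 2 = 0}.indicator T p :=
    (tsum_indicator_eq (fun p : ℤ × ℤ => (p.1, 2 * p.2))
      (fun p p' h => by simp only [Prod.mk.injEq] at h; ext <;> omega)
      (fun p => show (2 * p.2) % 2 = 0 by omega)
      (fun p (hp : p.2 % 2 = 0) => ⟨(p.1, p.2 / 2), by ext <;> dsimp only; omega⟩)
      fun p => by simp only [hT]; congr 1; ring).symm
  have e2 : theta (A + B + C) (4 * A + 2 * B) (4 * A) q
      = ∑' p, {p : ℤ × ℤ | (p.1 - p.2) % 2 = 0}.indicator T p :=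
    (tsum_indicator_eq (fun p : ℤ × ℤ => (p.1 + 2 * p.2, p.1))
      (fun p p' h => by simp only [Prod.mk.injEq] at h; ext <;> omega)
      (fun p => show (p.1 + 2 * p.2 - p.1) % 2 = 0 by omega)
      (fun p (hp : (p.1 - p.2) % 2 = 0) => ⟨(p.2, (p.1 - p.2) / 2), by
        ext <;> dsimp only; omega⟩)
      fun p => by simp only [hT]; congr 1; ring).symm
  rw [e0, e1, e2, ← (hs.indicator _).tsum_sub (hs.indicator _)]
  refine tsum_congr fun p => ?_
  simp only [Set.indicator, Set.mem_ofPred_eq]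
  rcases Int.emod_two_eq_zero_or_one p.1 with h1 | h1 <;>
    rcases Int.emod_two_eq_zero_or_one p.2 with h2 | h2
  · rw [if_neg (by omega), if_pos h2, if_pos (by omega)]; ring
  · rw [if_neg (by omega), if_neg (by omega), if_neg (by omega)]; ring
  · rw [if_pos h1, if_pos h2, if_neg (by omega), neg_one_zpow_of_even h2]; ring
  · rw [if_pos h1, if_neg (by omega), if_pos (by omega), neg_one_zpow_of_odd h2]; ring

lemma summable_signedTheta {A B C : ℤ} (hQ : ∀ n m, |n| + |m| ≤ A * n ^ 2 + B * n * m + C * m ^ 2)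
    {q : ℂ} (hq : ‖q‖ < 1) : Summable fun p : ℤ × ℤ =>
      (-1 : ℂ) ^ p.2 * q ^ (A * (2 * p.1 + 1) ^ 2 + B * (2 * p.1 + 1) * p.2 + C * p.2 ^ 2) := by
  refine Summable.of_norm ?_
  simp only [norm_mul, norm_neg_one_zpow, one_mul]
  exact (summable_norm_form hQ hq).comp_injective (i := fun p : ℤ × ℤ => (2 * p.1 + 1, p.2))
    fun p p' h => by simp only [Prod.mk.injEq] at h; ext <;> omega

lemma tsum_int_residues (N : ℕ) [NeZero N] {F : ℤ → ℂ} (hF : Summable F) :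
    ∑' y, F y = ∑ r : Fin N, ∑' m : ℤ, F (m * N + r) := by
  let e : Fin N × ℤ ≃ ℤ := (Equiv.prodComm (Fin N) ℤ).trans (Int.divModEquiv N).symm
  rw [← e.tsum_eq F]
  exact (e.summable_iff.2 hF).tsum_prod.trans (tsum_fintype _)

lemma tsum_prod_residues (N : ℕ) [NeZero N] {F : ℤ × ℤ → ℂ} (hF : Summable F) :
    ∑' p, F p = ∑ r : Fin N, ∑' p : ℤ × ℤ, F (p.1 * N + r, p.2) := by
  let e : Fin N × (ℤ × ℤ) ≃ ℤ × ℤ := (Equiv.prodAssoc (Fin N) ℤ ℤ).symm.trans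
    (((Equiv.prodComm (Fin N) ℤ).trans (Int.divModEquiv N).symm).prodCongr (Equiv.refl ℤ))
  rw [← e.tsum_eq F]
  exact (e.summable_iff.2 hF).tsum_prod.trans (tsum_fintype _)

/-- The reflection `(n, m) ↦ (-1 - n, m)`. -/
def reflectFst : ℤ × ℤ ≃ ℤ × ℤ := (Equiv.subLeft (-1)).prodCongr (Equiv.refl ℤ)

/-- The reflection `(n, m) ↦ (-1 - n, -1 - m)`. -/
def reflectBoth : ℤ × ℤ ≃ ℤ × ℤ := (Equiv.subLeft (-1)).prodCongr (Equiv.subLeft (-1))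

lemma neg_one_zpow_congr {s t : ℤ} (h : (s - t) % 2 = 0) : (-1 : ℂ) ^ s = (-1) ^ t := by
  rw [← sub_add_cancel s t, zpow_add₀ (by norm_num), neg_one_zpow_of_even h, one_mul]

lemma neg_one_zpow_congr' {s t : ℤ} (h : (s - t) % 2 = 1) : (-1 : ℂ) ^ s = -(-1) ^ t := by
  rw [← sub_add_cancel s t, zpow_add₀ (by norm_num), neg_one_zpow_of_odd h, neg_one_mul]

/-- Passing from the coset variable `s` to `n = s + c m + d`. -/
def shearEquiv (c d : ℤ) : ℤ × ℤ ≃ ℤ × ℤ where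
  toFun p := (p.2, p.1 - c * p.2 - d)
  invFun p := (p.2 + c * p.1 + d, p.1)
  left_inv p := Prod.ext (by dsimp only; ring) rfl
  right_inv p := Prod.ext rfl (by dsimp only; ring)

section Folding

variable {Φ : ℤ → ℤ → ℂ}

/-- The alternating sum of `Φ` over the coset `(r, t)` modulo `2 N`. -/
def cosetSum (N r t : ℤ) (Φ : ℤ → ℤ → ℂ) : ℂ :=
  ∑' p : ℤ × ℤ, (-1) ^ (p.1 + p.2) * Φ (2 * N * p.1 + r) (2 * N * p.2 + t)

/-- The class of N modulo 2N is stable under x ↦ -x, but the index n ↦ -1 - n reverses the sign. -/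
lemma cosetSum_self (hx : ∀ x y, Φ (-x) y = Φ x y) (N t : ℤ) : cosetSum N N t Φ = 0 := by
  have h : cosetSum N N t Φ = -cosetSum N N t Φ := by
    rw [cosetSum, ← tsum_neg]
    nth_rewrite 1 [← reflectFst.tsum_eq]
    refine tsum_congr fun p => ?_
    simp only [reflectFst, Equiv.prodCongr_apply, Prod.map, Equiv.subLeft_apply, Equiv.refl_apply]
    rw [neg_one_zpow_congr' (t := p.1 + p.2) (by omega), ← hx, neg_mul]
    congr 3; ring
  exact self_eq_neg.1 h

lemma cosetSum_reflect (hx : ∀ x y, Φ (-x) y = Φ x y) (hy : ∀ x y, Φ x (-y) = Φ x y)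
    (N r t : ℤ) : cosetSum N (2 * N - r) (2 * N - t) Φ = cosetSum N r t Φ := by
  rw [cosetSum, ← reflectBoth.tsum_eq]
  refine tsum_congr fun p => ?_
  simp only [reflectBoth, Equiv.prodCongr_apply, Prod.map, Equiv.subLeft_apply]
  rw [neg_one_zpow_congr (t := p.1 + p.2) (by omega), ← hx, ← hy]
  congr 2 <;> ring

lemma cosetSum_add (N r t k : ℤ) :
    cosetSum N (r + 2 * N * k) t Φ = (-1) ^ k * cosetSum N r t Φ := by
  rw [cosetSum, ← ((Equiv.subRight k).prodCongr (Equiv.refl ℤ)).tsum_eq, cosetSum, ← tsum_mul_left]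
  refine tsum_congr fun p => ?_
  simp only [Equiv.prodCongr_apply, Prod.map, Equiv.subRight_apply, Equiv.refl_apply]
  rw [← mul_assoc, ← zpow_add₀ (by norm_num), neg_one_zpow_congr (t := k + (p.1 + p.2)) (by omega)]
  congr 2; ring

/-- Sorting by the class of y modulo 2N, with y = 2N m + 2r + 1, gives x = 2N(s + c m) + c(2r + 1),
so (x, y) fills one coset per class. -/
lemma tsum_fold (N : ℕ) [NeZero N] (c : ℤ) (hc : c % 2 = 1)
    (hs : Summable fun p : ℤ × ℤ => (-1) ^ p.2 * Φ (c * (2 * p.1 + 1) + 2 * N * p.2) (2 *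
        p.1 + 1)) :
    ∑' p : ℤ × ℤ, (-1) ^ p.2 * Φ (c * (2 * p.1 + 1) + 2 * N * p.2) (2 * p.1 + 1)
      = ∑ r : Fin N, cosetSum N (c * (2 * r + 1)) (2 * r + 1) Φ := by
  rw [tsum_prod_residues N hs]
  refine Finset.sum_congr rfl fun r _ => ?_
  rw [← (shearEquiv c 0).tsum_eq, cosetSum]
  refine tsum_congr fun p => ?_
  simp only [shearEquiv, Equiv.coe_fn_mk]
  -- As c is odd, (c + 1)m is even, so the sign (-1)^s agrees with the product of the signs of the
  -- two coset indices.
  have h : (p.1 - c * p.2 - 0 - (p.1 + p.2)) % 2 = 0 := by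
    rw [show p.1 - c * p.2 - 0 - (p.1 + p.2) = -((c + 1) * p.2) by ring]
    have : (c + 1) % 2 = 0 := by omega
    have := Dvd.dvd.mul_right (Int.dvd_of_emod_eq_zero this) p.2
    omega
  rw [neg_one_zpow_congr h]
  congr 2 <;> ring

end Folding

lemma zpow_altTheta_exponent {N r : ℤ} (h : (N - r) % 2 = 0) (j : ℕ) (n : ℤ) (q : ℂ) :
    (q ^ (2 * j)) ^ ((N * n ^ 2 + r * n) / 2) = q ^ (j * (N * n ^ 2 + r * n)) := by
  have h2 : 2 ∣ N * n ^ 2 + r * n := by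
    obtain ⟨k, hk⟩ := Int.dvd_of_emod_eq_zero h
    obtain ⟨l, hl⟩ := Int.even_mul_succ_self n
    exact ⟨k * n ^ 2 + r * l, by linear_combination n ^ 2 * hk + r * hl⟩
  obtain ⟨k, hk⟩ := h2
  rw [← zpow_natCast, ← zpow_mul, hk, Int.mul_ediv_cancel_left _ two_ne_zero]
  congr 1; push_cast; ring

lemma natAbs_le_mul_odd_sq {c : ℕ} (hc : c ≠ 0) (y : ℤ) :
    (y.natAbs : ℤ) ≤ c * (2 * y + 1) ^ 2 := by
  have h3 : (1 : ℤ) ≤ c := by omega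
  have h1 : |y| ≤ (2 * y + 1) ^ 2 := by
    rcases le_or_gt 0 y with h | h
    · rw [abs_of_nonneg h]; nlinarith
    · rw [abs_of_neg h]; nlinarith
  rw [Int.natCast_natAbs]
  nlinarith [sq_nonneg (2 * y + 1)]

/-- Completing squares backwards: 4Nα = jD makes α((2Nn + r)² - r²)/D equal to j(Nn² + rn), and
likewise in y. The exponent separates and the double sum factors. -/
lemma cosetSum_eq_mul {N r t α β D e : ℤ} {j k : ℕ} (hN : 3 ≤ N) (hr : |r| ≤ N - 2)
    (ht : |t| ≤ N - 2) (hNr : (N - r) % 2 = 0) (hNt : (N - t) % 2 = 0) (hD : D ≠ 0)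
    (hj : 4 * N * α = j * D) (hk : 4 * N * β = k * D) (he : α * r ^ 2 + β * t ^ 2 = D * e)
    (hj0 : j ≠ 0) (hk0 : k ≠ 0) {q : ℂ} (hq : ‖q‖ < 1) (h0 : q ≠ 0) :
    cosetSum N r t (fun x y => q ^ ((α * x ^ 2 + β * y ^ 2) / D))
      = q ^ e * (altTheta N r (q ^ (2 * j)) * altTheta N t (q ^ (2 * k))) := by
  have s1 := summable_norm_altTheta hN hr (norm_pow_lt_one hq (n := 2 * j) (by omega))
  have s2 := summable_norm_altTheta hN ht (norm_pow_lt_one hq (n := 2 * k) (by omega))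
  rw [altTheta, altTheta, tsum_mul_tsum_of_summable_norm s1 s2, ← tsum_mul_left]
  refine tsum_congr fun p => ?_
  beta_reduce
  rw [zpow_altTheta_exponent hNr, zpow_altTheta_exponent hNt, show (α * (2 * N * p.1 + r) ^ 2
    + β * (2 * N * p.2 + t) ^ 2) / D
      = e + (j * (N * p.1 ^ 2 + r * p.1) + k * (N * p.2 ^ 2 + t * p.2)) from
      Int.ediv_eq_of_eq_mul_left hD (by
        linear_combination he + (N * p.1 ^ 2 + r * p.1) * hj + (N * p.2 ^ 2 + t * p.2) * hk),
    zpow_add₀ h0, zpow_add₀ h0, zpow_add₀ (by norm_num : (-1 : ℂ) ≠ 0)]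
  ring

lemma signedTheta_fold (N : ℕ) [NeZero N] {c α β D A B C : ℤ} (hc : c % 2 = 1) (hD : D ≠ 0)
    (hA : α * c ^ 2 + β = D * A) (hB : 4 * N * α * c = D * B) (hC : 4 * N ^ 2 * α = D * C)
    (hQ : ∀ n m, |n| + |m| ≤ A * n ^ 2 + B * n * m + C * m ^ 2) {q : ℂ} (hq : ‖q‖ < 1) :
    signedTheta A B C q = ∑ r : Fin N, cosetSum N (c * (2 * r + 1)) (2 * r + 1)
      (fun x y => q ^ ((α * x ^ 2 + β * y ^ 2) / D)) := by
  have h : ∀ p : ℤ × ℤ, (α * (c * (2 * p.1 + 1) + 2 * N * p.2) ^ 2 + β * (2 * p.1 + 1) ^ 2) / D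
      = A * (2 * p.1 + 1) ^ 2 + B * (2 * p.1 + 1) * p.2 + C * p.2 ^ 2 := fun p =>
    Int.ediv_eq_of_eq_mul_left hD (by
      linear_combination (2 * p.1 + 1) ^ 2 * hA + (2 * p.1 + 1) * p.2 * hB + p.2 ^ 2 * hC)
  have hs := summable_signedTheta hQ hq
  rw [← tsum_fold N c hc (hs.congr fun p => by rw [h])]
  exact tsum_congr fun p => by rw [h]

lemma cosetSum_neg_left {Φ : ℤ → ℤ → ℂ} (hx : ∀ x y, Φ (-x) y = Φ x y) (N r t : ℤ) :
    cosetSum N (-r) t Φ = cosetSum N r t Φ := by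
  rw [cosetSum, ← ((Equiv.neg ℤ).prodCongr (Equiv.refl ℤ)).tsum_eq]
  refine tsum_congr fun p => ?_
  simp only [Equiv.prodCongr_apply, Prod.map, Equiv.neg_apply, Equiv.refl_apply]
  rw [neg_one_zpow_congr (t := p.1 + p.2) (by omega), ← hx]
  congr 2; ring

lemma abs_add_abs_le_sq_add_sq (n m : ℤ) : |n| + |m| ≤ n ^ 2 + m ^ 2 := by
  have h : ∀ k : ℤ, |k| ≤ k ^ 2 := fun k => by
    rw [← sq_abs]; rcases eq_or_lt_of_le (abs_nonneg k) with h | h <;> nlinarith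
  exact add_le_add (h n) (h m)

/-- The cosets are (1,1), (3,3), (5,5). The middle one vanishes and the outer two agree by
reflection. -/
lemma signedTheta_three {q : ℂ} (hq : ‖q‖ < 1) (h0 : q ≠ 0) {α β D A B C e : ℤ} {j k : ℕ} (hD : D
    ≠ 0)
    (hA : α + β = D * A) (hB : 12 * α = D * B) (hC : 36 * α = D * C)
    (hj : 12 * α = j * D) (hk : 12 * β = k * D) (he : α + β = D * e) (hj0 : j ≠ 0) (hk0 : k ≠ 0)
    (hQ : ∀ n m, |n| + |m| ≤ A * n ^ 2 + B * n * m + C * m ^ 2) :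
    signedTheta A B C q = 2 * q ^ e * (E (q ^ (2 * j)) * E (q ^ (2 * k))) := by
  rw [signedTheta_fold 3 (c := 1) (α := α) (β := β) rfl hD (by linarith) (by push_cast; linarith)
    (by push_cast; linarith) hQ hq, Fin.sum_univ_three, E_eq_altTheta, E_eq_altTheta]
  set Φ : ℤ → ℤ → ℂ := fun x y => q ^ ((α * x ^ 2 + β * y ^ 2) / D) with hΦ
  have hx : ∀ x y, Φ (-x) y = Φ x y := fun x y => by simp [hΦ]
  have hy : ∀ x y, Φ x (-y) = Φ x y := fun x y => by simp [hΦ]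
  have h1 := cosetSum_self hx 3 3
  have h2 := cosetSum_reflect hx hy 3 1 1
  have h3 : cosetSum 3 1 1 Φ = _ := cosetSum_eq_mul (by norm_num) (by norm_num) (by norm_num)
    (by norm_num) (by norm_num) hD (by linarith) (by linarith) (e := e) (by linarith) hj0 hk0 hq h0
  norm_num at h1 h2 ⊢
  rw [h1, h2, h3]
  ring

/-- The coset (5,5) vanishes, and reflection pairs (9,9) with (1,1) and (7,7) with (3,3). -/
lemma signedTheta_five_one {q : ℂ} (hq : ‖q‖ < 1) (h0 : q ≠ 0) {α β D A B C e e' : ℤ} {j k : ℕ}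
    (hD : D ≠ 0)
    (hA : α + β = D * A) (hB : 20 * α = D * B) (hC : 100 * α = D * C)
    (hj : 20 * α = j * D) (hk : 20 * β = k * D) (he : α + β = D * e)
    (he' : 9 * (α + β) = D * e') (hj0 : j ≠ 0) (hk0 : k ≠ 0)
    (hQ : ∀ n m, |n| + |m| ≤ A * n ^ 2 + B * n * m + C * m ^ 2) :
    signedTheta A B C q = 2 * q ^ e * (altTheta 5 1 (q ^ (2 * j)) * altTheta 5 1 (q ^ (2 * k)))
      + 2 * q ^ e' * (altTheta 5 3 (q ^ (2 * j)) * altTheta 5 3 (q ^ (2 * k))) := by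
  rw [signedTheta_fold 5 (c := 1) (α := α) (β := β) rfl hD (by linarith) (by push_cast; linarith)
    (by push_cast; linarith) hQ hq, Fin.sum_univ_five]
  set Φ : ℤ → ℤ → ℂ := fun x y => q ^ ((α * x ^ 2 + β * y ^ 2) / D) with hΦ
  have hx : ∀ x y, Φ (-x) y = Φ x y := fun x y => by simp [hΦ]
  have hy : ∀ x y, Φ x (-y) = Φ x y := fun x y => by simp [hΦ]
  have h1 := cosetSum_self hx 5 5
  have h2 := cosetSum_reflect hx hy 5 1 1
  have h3 := cosetSum_reflect hx hy 5 3 3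
  have h4 : cosetSum 5 1 1 Φ = _ := cosetSum_eq_mul (by norm_num) (by norm_num) (by norm_num)
    (by norm_num) (by norm_num) hD (by linarith) (by linarith) (e := e) (by linarith) hj0 hk0 hq h0
  have h5 : cosetSum 5 3 3 Φ = _ := cosetSum_eq_mul (by norm_num) (by norm_num) (by norm_num)
    (by norm_num) (by norm_num) hD (by linarith) (by linarith) (e := e') (by linarith) hj0 hk0 hq h0
  norm_num at h1 h2 h3 ⊢
  rw [h1, h2, h3, h4, h5]
  ring

/-- With c = 3 the cosets are (3,1), (9,3), (15,5), (21,7), (27,9). Modulo 10, with a sign for each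
shift by 10, the third vanishes, (27,9) equals (3,1), and (9,3) and (21,7) both equal minus (1,3).
Hence the minus sign in the result. -/
lemma signedTheta_five_three {q : ℂ} (hq : ‖q‖ < 1) (h0 : q ≠ 0) {α β D A B C e e' : ℤ} {j k : ℕ}
    (hD : D ≠ 0)
    (hA : 9 * α + β = D * A) (hB : 60 * α = D * B) (hC : 100 * α = D * C)
    (hj : 20 * α = j * D) (hk : 20 * β = k * D) (he : 9 * α + β = D * e)
    (he' : α + 9 * β = D * e') (hj0 : j ≠ 0) (hk0 : k ≠ 0)
    (hQ : ∀ n m, |n| + |m| ≤ A * n ^ 2 + B * n * m + C * m ^ 2) :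
    signedTheta A B C q = 2 * q ^ e * (altTheta 5 3 (q ^ (2 * j)) * altTheta 5 1 (q ^ (2 * k)))
      - 2 * q ^ e' * (altTheta 5 1 (q ^ (2 * j)) * altTheta 5 3 (q ^ (2 * k))) := by
  rw [signedTheta_fold 5 (c := 3) (α := α) (β := β) rfl hD (by linarith) (by push_cast; linarith)
    (by push_cast; linarith) hQ hq, Fin.sum_univ_five]
  set Φ : ℤ → ℤ → ℂ := fun x y => q ^ ((α * x ^ 2 + β * y ^ 2) / D) with hΦ
  have hx : ∀ x y, Φ (-x) y = Φ x y := fun x y => by simp [hΦ]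
  have hy : ∀ x y, Φ x (-y) = Φ x y := fun x y => by simp [hΦ]
  have h0' := cosetSum_self hx 5 5
  have h1 := cosetSum_add (Φ := Φ) 5 5 5 1
  have h2 := cosetSum_add (Φ := Φ) 5 (-1) 3 1
  have h3 := cosetSum_add (Φ := Φ) 5 (-1) 3 (-1)
  have h3' := cosetSum_reflect hx hy 5 (-11) 3
  have h4 := cosetSum_add (Φ := Φ) 5 3 1 (-2)
  have h4' := cosetSum_reflect hx hy 5 (-17) 1
  have h5 := cosetSum_neg_left hx 5 1 3
  have h6 : cosetSum 5 3 1 Φ = _ := cosetSum_eq_mul (by norm_num) (by norm_num) (by norm_num)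
    (by norm_num) (by norm_num) hD (by linarith) (by linarith) (e := e) (by linarith) hj0 hk0 hq h0
  have h7 : cosetSum 5 1 3 Φ = _ := cosetSum_eq_mul (by norm_num) (by norm_num) (by norm_num)
    (by norm_num) (by norm_num) hD (by linarith) (by linarith) (e := e') (by linarith) hj0 hk0 hq h0
  norm_num at h0' h1 h2 h3 h3' h4 h4' ⊢
  rw [h1, h2, h3', h3, h4', h4, h5, h0', h6, h7]
  ring

/-- The odd numbers 2y + 1 split into the two classes modulo 4, exchanged by negation, and (4n - 1)²
= 8(2n² - n) + 1. -/
lemma tsum_odd_sq {q : ℂ} (hq : ‖q‖ < 1) (h0 : q ≠ 0) (c : ℕ) (hc : c ≠ 0) :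
    ∑' y : ℤ, q ^ (c * (2 * y + 1) ^ 2 : ℤ) = 2 * q ^ c * psi (q ^ (8 * c)) := by
  have hs : Summable fun y : ℤ => q ^ (c * (2 * y + 1) ^ 2 : ℤ) := by
    have := summable_norm_series (c := fun _ => 1) (k := fun y : ℤ => c * (2 * y + 1) ^ 2)
      (by simp) (natAbs_le_mul_odd_sq hc) hq
    simpa using this.of_norm
  rw [tsum_int_residues 2 hs, Fin.sum_univ_two, psi_eq_tsum]
  have h : ∀ n : ℤ, (q ^ (8 * c)) ^ (2 * n ^ 2 - n) * q ^ c = q ^ (c * (4 * n - 1) ^ 2 : ℤ) := by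
    intro n
    rw [← zpow_natCast, ← zpow_natCast q c, ← zpow_mul, ← zpow_add₀ h0]
    congr 1; push_cast; ring
  rw [mul_assoc, mul_comm (q ^ c), ← tsum_mul_right, two_mul]
  congr 1
  · rw [← (Equiv.neg ℤ).tsum_eq]
    refine tsum_congr fun n => ?_
    rw [h]; congr 1; simp only [Equiv.neg_apply, Fin.val_zero]; push_cast; ring
  · rw [← (Equiv.subRight (1 : ℤ)).tsum_eq]
    refine tsum_congr fun n => ?_
    rw [h]; congr 1; simp only [Equiv.subRight_apply, Fin.val_one]; push_cast; ring

lemma signedTheta_diagonal {q : ℂ} (hq : ‖q‖ < 1) (h0 : q ≠ 0) (a c : ℕ) (ha : a ≠ 0) (hc : c ≠ 0) :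
    signedTheta a 0 c q = 2 * q ^ a * psi (q ^ (8 * a)) * phi (-q ^ c) := by
  rw [← tsum_odd_sq hq h0 a ha, phi_neg_eq_tsum, tsum_mul_tsum_of_summable_norm]
  · refine tsum_congr fun p => ?_
    rw [← zpow_natCast q c, ← zpow_mul, mul_left_comm, ← zpow_add₀ h0]
    congr 2; ring
  · have := summable_norm_series (c := fun _ => 1) (k := fun y : ℤ => a * (2 * y + 1) ^ 2)
      (by simp) (natAbs_le_mul_odd_sq ha) hq
    simpa using this
  · exact summable_norm_series (fun n => (norm_neg_one_zpow n).le) (fun n => by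
      have h1 := abs_add_abs_le_sq_add_sq n 0
      rw [Int.natCast_natAbs]
      simpa using h1) (norm_pow_lt_one hq hc)

/-! ### The forms of discriminant -1664 -/

section Forms

variable {q : ℂ}

/-- The forms produced by `signedTheta_eq` are only equivalent to the stated ones; unimodular
substitutions bring them into shape. The same applies to the five lemmas that follow. -/
lemma theta_3_2_139_sub (hq : ‖q‖ < 1) :
    theta 3 2 139 q - theta 12 4 35 q = signedTheta 3 8 40 q := by
  rw [signedTheta_eq (fun n m => by
      nlinarith [abs_add_abs_le_sq_add_sq n m, sq_nonneg (n + 2 * m), sq_nonneg m]) hq]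
  norm_num
  rw [theta_substitution 3 16 160 1 3 0 (-1) (by norm_num),
    theta_substitution 51 28 12 0 1 1 (-1) (by norm_num)]
  norm_num

lemma theta_7_4_60_sub (hq : ‖q‖ < 1) :
    theta 7 4 60 q - theta 15 4 28 q = signedTheta 7 12 20 q := by
  rw [signedTheta_eq (fun n m => by
      nlinarith [abs_add_abs_le_sq_add_sq n m, sq_nonneg (n + m), sq_nonneg m]) hq]
  norm_num
  rw [theta_substitution 7 24 80 1 2 0 (-1) (by norm_num),
    theta_substitution 39 52 28 1 0 (-1) (-1) (by norm_num)]
  norm_num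

lemma theta_9_8_48_sub (hq : ‖q‖ < 1) :
    theta 9 8 48 q - theta 17 6 25 q = signedTheta 9 4 12 q := by
  rw [signedTheta_eq (fun n m => by
      nlinarith [abs_add_abs_le_sq_add_sq n m, sq_nonneg (n + m), sq_nonneg m, sq_nonneg n]) hq]
  norm_num
  rw [theta_substitution 25 44 36 1 1 (-1) 0 (by norm_num)]
  norm_num

lemma theta_5_4_84_sub (hq : ‖q‖ < 1) :
    theta 5 4 84 q - theta 20 4 21 q = signedTheta 5 8 24 q := by
  rw [signedTheta_eq (fun n m => by
      nlinarith [abs_add_abs_le_sq_add_sq n m, sq_nonneg (n + m), sq_nonneg m]) hq]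
  norm_num
  rw [theta_substitution 5 16 96 1 2 0 (-1) (by norm_num),
    theta_substitution 37 36 20 0 (-1) 1 1 (by norm_num)]
  norm_num

lemma theta_13_0_32_sub (hq : ‖q‖ < 1) :
    theta 13 0 32 q - theta 21 10 21 q = signedTheta 13 0 8 q := by
  rw [signedTheta_eq (fun n m => by
      nlinarith [abs_add_abs_le_sq_add_sq n m, sq_nonneg n, sq_nonneg m]) hq]
  norm_num
  rw [theta_substitution 21 52 52 1 (-1) 0 1 (by norm_num)]
  norm_num

lemma theta_1_0_416_sub (hq : ‖q‖ < 1) :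
    theta 1 0 416 q - theta 4 4 105 q = signedTheta 1 0 104 q := by
  rw [signedTheta_eq (fun n m => by
      nlinarith [abs_add_abs_le_sq_add_sq n m, sq_nonneg n, sq_nonneg m]) hq]
  norm_num
  rw [theta_substitution 105 4 4 0 1 1 0 (by norm_num)]
  norm_num

lemma abs_form_9_4_12 (n m : ℤ) : |n| + |m| ≤ 9 * n ^ 2 + 4 * n * m + 12 * m ^ 2 := by
  nlinarith [abs_add_abs_le_sq_add_sq n m, sq_nonneg (n + m), sq_nonneg m, sq_nonneg n]

/-- `E(q^8) E(Q^16)` as a difference of theta series. -/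
lemma E_mul_E_eq_theta_9_8_48 (hq : ‖q‖ < 1) (h0 : q ≠ 0) :
    2 * q ^ 9 * E (q ^ 8) * E ((q ^ 13) ^ 16) = theta 9 8 48 q - theta 17 6 25 q := by
  -- 9y² + 4ys + 12s² = (x² + 26y²)/3 with x = y + 6s.
  rw [theta_9_8_48_sub hq, signedTheta_three hq h0 (α := 1) (β := 26) (D := 3) (e := 9) (j := 4)
    (k := 104) (by norm_num) rfl rfl rfl rfl rfl rfl (by norm_num) (by norm_num) abs_form_9_4_12,
    ← pow_mul]
  norm_cast
  ring

/-- `E(q^16) E(Q^8)` as a difference of theta series. -/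
lemma E_mul_E_eq_theta_5_4_84 (hq : ‖q‖ < 1) (h0 : q ≠ 0) :
    2 * q ^ 5 * E (q ^ 16) * E ((q ^ 13) ^ 8) = theta 5 4 84 q - theta 20 4 21 q := by
  -- 5y² + 8ys + 24s² = (2x² + 13y²)/3 with x = y + 6s.
  rw [theta_5_4_84_sub hq, signedTheta_three hq h0 (α := 2) (β := 13) (D := 3) (e := 5) (j := 8)
    (k := 52) (by norm_num) rfl rfl rfl rfl rfl rfl (by norm_num) (by norm_num) (fun n m => by
      nlinarith [abs_add_abs_le_sq_add_sq n m, sq_nonneg (n + m), sq_nonneg m]), ← pow_mul]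
  norm_cast
  ring

lemma U_two_thirteen (q : ℂ) :
    U 2 13 q = G (q ^ 2) * G (q ^ 13) + q ^ 3 * H (q ^ 2) * H (q ^ 13) := by
  simp [U]

lemma U_one_twentysix (q : ℂ) :
    U 1 26 q = H q * G (q ^ 26) - q ^ 5 * G q * H (q ^ 26) := by
  have h : ((25 : ℤ) / 5) = (5 : ℕ) := rfl
  norm_num [U, h]

lemma E_mul_E_mul_U_two_thirteen (hq : ‖q‖ < 1) : E (q ^ 2) * E (q ^ 13) * U 2 13 q
    = altTheta 5 1 (q ^ 2) * altTheta 5 1 (q ^ 13)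
      + q ^ 3 * (altTheta 5 3 (q ^ 2) * altTheta 5 3 (q ^ 13)) := by
  have h2 := norm_pow_lt_one hq two_ne_zero
  have h13 := norm_pow_lt_one hq (show 13 ≠ 0 by norm_num)
  rw [← G_mul_E h2, ← G_mul_E h13, ← H_mul_E h2, ← H_mul_E h13, U_two_thirteen]
  ring

lemma E_mul_E_mul_U_one_twentysix (hq : ‖q‖ < 1) : E q * E (q ^ 26) * U 1 26 q
    = altTheta 5 3 q * altTheta 5 1 (q ^ 26)
      - q ^ 5 * (altTheta 5 1 q * altTheta 5 3 (q ^ 26)) := by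
  have h26 := norm_pow_lt_one hq (show 26 ≠ 0 by norm_num)
  rw [← G_mul_E hq, ← G_mul_E h26, ← H_mul_E hq, ← H_mul_E h26, U_one_twentysix]
  ring

lemma U_two_thirteen_eq_theta (hq : ‖q‖ < 1) (h0 : q ≠ 0) :
    2 * q ^ 3 * E (q ^ 16) * E ((q ^ 13) ^ 8) * U 2 13 (q ^ 8)
      = theta 3 2 139 q - theta 12 4 35 q := by
  have h := E_mul_E_mul_U_two_thirteen (norm_pow_lt_one hq (show 8 ≠ 0 by norm_num))
  -- 3y² + 8ys + 40s² = (2x² + 13y²)/5 with x = y + 10s.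
  rw [theta_3_2_139_sub hq, signedTheta_five_one hq h0 (α := 2) (β := 13) (D := 5) (e := 3)
    (e' := 27) (j := 8) (k := 52) (by norm_num) rfl rfl rfl rfl rfl rfl rfl (by norm_num)
    (by norm_num) (fun n m => by
      nlinarith [abs_add_abs_le_sq_add_sq n m, sq_nonneg (n + 2 * m), sq_nonneg m])]
  simp only [← pow_mul] at h ⊢
  norm_num at h ⊢
  norm_cast
  linear_combination 2 * q ^ 3 * h

lemma U_one_twentysix_eq_theta (hq : ‖q‖ < 1) (h0 : q ≠ 0) :
    2 * q ^ 7 * E (q ^ 8) * E ((q ^ 13) ^ 16) * U 1 26 (q ^ 8)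
      = theta 7 4 60 q - theta 15 4 28 q := by
  have h := E_mul_E_mul_U_one_twentysix (norm_pow_lt_one hq (show 8 ≠ 0 by norm_num))
  -- 7y² + 12ys + 20s² = (x² + 26y²)/5 with x = 3y + 10s.
  rw [theta_7_4_60_sub hq, signedTheta_five_three hq h0 (α := 1) (β := 26) (D := 5) (e := 7)
    (e' := 47) (j := 4) (k := 104) (by norm_num) rfl rfl rfl rfl rfl rfl rfl (by norm_num)
    (by norm_num) (fun n m => by
      nlinarith [abs_add_abs_le_sq_add_sq n m, sq_nonneg (n + m), sq_nonneg m])]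
  simp only [← pow_mul] at h ⊢
  norm_num at h ⊢
  norm_cast
  linear_combination 2 * q ^ 7 * h

lemma psi_mul_phi_eq_theta_13_0_32 (hq : ‖q‖ < 1) (h0 : q ≠ 0) :
    2 * q ^ 13 * psi ((q ^ 13) ^ 8) * phi (-q ^ 8) = theta 13 0 32 q - theta 21 10 21 q := by
  have h := signedTheta_diagonal hq h0 13 8 (by norm_num) (by norm_num)
  rw [theta_13_0_32_sub hq, ← pow_mul]
  exact h.symm

lemma psi_mul_phi_eq_theta_1_0_416 (hq : ‖q‖ < 1) (h0 : q ≠ 0) :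
    2 * q * psi (q ^ 8) * phi (-(q ^ 13) ^ 8) = theta 1 0 416 q - theta 4 4 105 q := by
  have h := signedTheta_diagonal hq h0 1 104 (by norm_num) (by norm_num)
  rw [theta_1_0_416_sub hq, ← pow_mul]
  norm_num at h ⊢
  exact h.symm

end Forms

/-! ### Theta constants under τ ↦ -1/τ -/

open Complex (I)
open scoped Real

/-- `ex x = e^{2π i x}`. -/
def ex (x : ℂ) : ℂ := Complex.exp (2 * π * I * x)

lemma ex_add (x y : ℂ) : ex (x + y) = ex x * ex y := by
  rw [ex, mul_add, Complex.exp_add]; rfl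

lemma ex_ne_zero (x : ℂ) : ex x ≠ 0 := Complex.exp_ne_zero _

lemma ex_zero : ex 0 = 1 := by simp [ex]

lemma ex_neg (x : ℂ) : ex (-x) = (ex x)⁻¹ := by
  rw [ex, mul_neg, Complex.exp_neg]; rfl

lemma ex_int (n : ℤ) : ex n = 1 := by
  rw [ex, mul_comm]; exact Complex.exp_int_mul_two_pi_mul_I n

lemma ex_half : ex (1 / 2) = -1 := by
  rw [ex, show 2 * (π : ℂ) * I * (1 / 2) = π * I by ring, Complex.exp_pi_mul_I]

lemma ex_add_half (x : ℂ) : ex (x + 1 / 2) = -ex x := by rw [ex_add, ex_half, mul_neg_one]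

lemma ex_zpow (x : ℂ) (n : ℤ) : ex x ^ n = ex (n * x) := by
  rw [ex, ← Complex.exp_int_mul, ex]; ring_nf

lemma ex_pow (x : ℂ) (n : ℕ) : ex x ^ n = ex (n * x) := by
  exact_mod_cast ex_zpow x n

lemma neg_one_zpow_eq_ex (n : ℤ) : (-1 : ℂ) ^ n = ex (n / 2) := by
  rw [← ex_half, ex_zpow]; ring_nf

lemma norm_ex (x : ℂ) : ‖ex x‖ = Real.exp (-2 * π * x.im) := by
  rw [ex, Complex.norm_exp]; simp

lemma norm_ex_lt_one {x : ℂ} (hx : 0 < x.im) : ‖ex x‖ < 1 := by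
  rw [norm_ex, Real.exp_lt_one_iff]
  have := Real.pi_pos
  nlinarith [mul_pos this hx]

/-- The theta constant `∑ (-1)^n e^{2π i τ (2 N n + r)^2 / (8 N)}`. -/
def thetaConst (N r : ℤ) (τ : ℂ) : ℂ :=
  ∑' n : ℤ, (-1) ^ n * ex (τ * (2 * N * n + r) ^ 2 / (8 * N))

lemma thetaConst_eq_altTheta {N r : ℤ} (hN : N ≠ 0) (h : (N - r) % 2 = 0) (τ : ℂ) :
    thetaConst N r τ = ex (r ^ 2 * τ / (8 * N)) * altTheta N r (ex τ) := by
  have hN' : (N : ℂ) ≠ 0 := by exact_mod_cast hN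
  rw [thetaConst, altTheta, ← tsum_mul_left]
  refine tsum_congr fun n => ?_
  have h2 : 2 ∣ N * n ^ 2 + r * n := by
    obtain ⟨k, hk⟩ := Int.dvd_of_emod_eq_zero h
    obtain ⟨l, hl⟩ := Int.even_mul_succ_self n
    exact ⟨k * n ^ 2 + r * l, by linear_combination n ^ 2 * hk + r * hl⟩
  rw [ex_zpow, Int.cast_div h2 (by norm_num), mul_left_comm, ← ex_add]
  congr 2
  push_cast
  field_simp
  ring

lemma thetaConst_eq_jacobiTheta₂ {N : ℤ} (hN : N ≠ 0) (r : ℤ) (τ : ℂ) :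
    thetaConst N r τ = ex (r ^ 2 * τ / (8 * N)) * jacobiTheta₂ (1 / 2 + r * τ / 2) (N * τ) := by
  have hN' : (N : ℂ) ≠ 0 := by exact_mod_cast hN
  rw [thetaConst, jacobiTheta₂, ← tsum_mul_left]
  refine tsum_congr fun n => ?_
  have : jacobiTheta₂_term n (1 / 2 + r * τ / 2) (N * τ)
      = ex (n / 2 + (r * n + N * n ^ 2) * τ / 2) := by
    rw [jacobiTheta₂_term, ex]; ring_nf
  rw [this, neg_one_zpow_eq_ex, ← ex_add, ← ex_add]
  congr 1
  field_simp
  ring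

/-- The index change n ↦ -1 - n negates 2Nn + r and flips the sign. The odd classes thus reduce to 1
for N = 3 and to 1, 3 for N = 5. -/
lemma thetaConst_reflect (N r : ℤ) (τ : ℂ) : thetaConst N (2 * N - r) τ = -thetaConst N r τ := by
  rw [thetaConst, ← (Equiv.subLeft (-1 : ℤ)).tsum_eq, thetaConst, ← tsum_neg]
  refine tsum_congr fun n => ?_
  simp only [Equiv.subLeft_apply]
  rw [neg_one_zpow_congr' (t := n) (by omega), neg_mul]
  congr 4
  push_cast
  ring

lemma thetaConst_self (N : ℤ) (τ : ℂ) : thetaConst N N τ = 0 := by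
  have := thetaConst_reflect N N τ
  rw [show 2 * N - N = N by ring] at this
  exact self_eq_neg.1 this

/-- Jacobi's functional equation at z = (τ - r)/(2N) and modulus τ/N. The dual sum runs over odd 2m
+ 1, and grouping m modulo N recovers theta constants of the same level. -/
lemma thetaConst_S_aux (N : ℕ) [NeZero N] {r : ℤ} (hr : r % 2 = 1) {τ : ℂ} (hτ : 0 < τ.im) :
    thetaConst N r (-1 / τ) = (-I * (τ / N)) ^ (1 / 2 : ℂ) *
      ∑ k : Fin N, ex (-(r * (2 * k + 1) / (4 * N))) * thetaConst N (2 * k + 1) τ := by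
  have hN : (N : ℂ) ≠ 0 := Nat.cast_ne_zero.2 (NeZero.ne N)
  have hN0 : (0 : ℝ) < N := Nat.cast_pos.2 (NeZero.pos N)
  have hτ0 : τ ≠ 0 := by rintro rfl; simp at hτ
  have hτN : 0 < (τ / N).im := by
    rw [Complex.div_natCast_im]; positivity
  have hfe := jacobiTheta₂_functional_equation ((τ - r) / (2 * N)) (τ / N)
  have hc : (-I * (τ / N)) ^ (1 / 2 : ℂ) ≠ 0 := by
    simp [Complex.cpow_eq_zero_iff, hτ0, hN]
  have hterm : ∀ m : ℤ, ex ((τ - 2 * r) / (8 * N)) * jacobiTheta₂_term m ((τ - r) / (2 * N)) (τ / N)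
      = ex (τ * (2 * m + 1) ^ 2 / (8 * N) - r * (2 * m + 1) / (4 * N)) := by
    intro m
    have : jacobiTheta₂_term m ((τ - r) / (2 * N)) (τ / N)
        = ex (m * (τ - r) / (2 * N) + m ^ 2 * τ / (2 * N)) := by
      rw [jacobiTheta₂_term, ex]
      congr 1
      field_simp
    rw [this, ← ex_add]
    congr 1
    field_simp
    ring
  have hs := ((summable_jacobiTheta₂_term_iff ((τ - r) / (2 * N)) (τ / N)).2 hτN).mul_left
    (ex ((τ - 2 * r) / (8 * N)))
  simp_rw [hterm] at hs
  have hsum : ex ((τ - 2 * r) / (8 * N)) * jacobiTheta₂ ((τ - r) / (2 * N)) (τ / N)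
      = ∑ k : Fin N, ex (-(r * (2 * k + 1) / (4 * N))) * thetaConst N (2 * k + 1) τ := by
    rw [jacobiTheta₂, ← tsum_mul_left]
    simp_rw [hterm]
    rw [tsum_int_residues N hs]
    refine Finset.sum_congr rfl fun k _ => ?_
    rw [thetaConst, ← tsum_mul_left]
    refine tsum_congr fun j => ?_
    -- This is where r odd is used: the dual character becomes the alternating sign.
    have hj : (-1 : ℂ) ^ j = ex (-(r * j / 2)) := by
      rw [neg_one_zpow_congr (t := -(r * j)), neg_one_zpow_eq_ex]
      · push_cast; ring_nf
      · have : (1 + r) % 2 = 0 := by omega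
        have := Dvd.dvd.mul_right (Int.dvd_of_emod_eq_zero this) j
        rw [show j - -(r * j) = (1 + r) * j by ring]
        omega
    rw [hj, ← ex_add, ← ex_add]
    congr 1
    push_cast
    field_simp
    ring
  rw [← hsum, thetaConst_eq_jacobiTheta₂ (by exact_mod_cast NeZero.ne N), hfe]
  have e1 : (τ - r) / (2 * N) / (τ / N) = 1 / 2 + (r : ℂ) * (-1 / τ) / 2 := by
    field_simp; ring
  have e2 : -1 / (τ / N) = ((N : ℤ) : ℂ) * (-1 / τ) := by push_cast; field_simp
  have e3 : Complex.exp (-π * I * ((τ - r) / (2 * N)) ^ 2 / (τ / N))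
      = ex (-((τ - r) ^ 2 / (8 * N * τ))) := by
    rw [ex]; congr 1; field_simp; ring
  rw [e1, e2, e3]
  have e4 : ex ((r : ℂ) ^ 2 * (-1 / τ) / (8 * ((N : ℤ) : ℂ)))
      = ex ((τ - 2 * r) / (8 * N)) * ex (-((τ - r) ^ 2 / (8 * N * τ))) := by
    rw [← ex_add]; congr 1; push_cast; field_simp; ring
  have key : ∀ κ a b j : ℂ, κ ≠ 0 → a * b * j = κ * (a * (1 / κ * b * j)) := by
    intro κ a b j hκ
    field_simp
  rw [e4]
  exact key _ _ _ _ hc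

lemma cpow_half_div_natCast (N : ℕ) (hN : N ≠ 0) {w : ℂ} (hw : w ≠ 0) :
    (w / N) ^ (1 / 2 : ℂ) = ((√(N : ℝ) : ℝ) : ℂ)⁻¹ * w ^ (1 / 2 : ℂ) := by
  have hN0 : (0 : ℝ) < N := by positivity
  have h1 : w / N = ((N : ℝ)⁻¹ : ℝ) * w := by push_cast; ring
  rw [h1, Complex.cpow_def_of_ne_zero (by simp [hN, hw]), Complex.cpow_def_of_ne_zero hw,
    Complex.log_ofReal_mul (by positivity) hw, add_mul, Complex.exp_add]
  congr 1
  rw [Real.sqrt_eq_rpow, Real.rpow_def_of_pos hN0, ← Complex.ofReal_inv, ← Real.exp_neg,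
    Complex.ofReal_exp, Real.log_inv]
  congr 1
  push_cast
  ring

/-- Extracting √N leaves a factor (-iτ)^(1/2) independent of N, so it cancels in quotients of
constants with N = 5 and N = 3. -/
lemma thetaConst_S (N : ℕ) [NeZero N] {r : ℤ} (hr : r % 2 = 1) {τ : ℂ} (hτ : 0 < τ.im) :
    thetaConst N r (-1 / τ) = (-I * τ) ^ (1 / 2 : ℂ) * (((√(N : ℝ) : ℝ) : ℂ)⁻¹ *
      ∑ k : Fin N, ex (-(r * (2 * k + 1) / (4 * N))) * thetaConst N (2 * k + 1) τ) := by
  have hτ0 : τ ≠ 0 := by rintro rfl; simp at hτ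
  rw [thetaConst_S_aux N hr hτ, ← mul_div_assoc, cpow_half_div_natCast N (NeZero.ne N)
    (by simpa using hτ0)]
  ring

lemma ex_add_ex_neg (x : ℝ) : ex x + ex (-x) = 2 * Real.cos (2 * π * x) := by
  rw [Complex.ofReal_cos, Complex.two_cos, ex, ex]
  push_cast
  congr 2 <;> ring

/-- Class 3 vanishes, class 5 is minus class 1, and the remaining coefficient is 2cos(π/6)/√3 = 1.
-/
lemma eta_S {τ : ℂ} (hτ : 0 < τ.im) :
    thetaConst 3 1 (-1 / τ) = (-I * τ) ^ (1 / 2 : ℂ) * thetaConst 3 1 τ := by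
  have h := thetaConst_S 3 (r := 1) rfl hτ
  have h1 := thetaConst_self 3 τ
  have h2 := thetaConst_reflect 3 1 τ
  rw [Fin.sum_univ_three] at h
  norm_num at h h1 h2
  rw [h, h1, h2]
  have e1 : ex (-(5 / 12)) = -ex (1 / 12) := by
    have := ex_add_half (-(5 / 12))
    norm_num at this
    rw [this, neg_neg]
  have e2 : ex (1 / 12) + ex (-(1 / 12)) = (√3 : ℝ) := by
    have := ex_add_ex_neg (1 / 12)
    rw [show 2 * π * (1 / 12) = π / 6 by ring, Real.cos_pi_div_six] at this
    push_cast at this ⊢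
    rw [this]; ring
  have h3 : ((√3 : ℝ) : ℂ) ≠ 0 := by simp
  rw [e1]
  field_simp
  linear_combination (-(I * τ)) ^ (1 / 2 : ℂ) * thetaConst 3 1 τ * e2

/-! ### Modular behaviour of G, H and η² -/

/-- The normalized Rogers--Ramanujan function `q^{-1/60} G(q)`, `q = e^{2π i τ}`. -/
def gMod (τ : ℂ) : ℂ := ex (-τ / 60) * G (ex τ)

/-- The normalized Rogers--Ramanujan function `q^{11/60} H(q)`, `q = e^{2π i τ}`. -/
def hMod (τ : ℂ) : ℂ := ex (11 * τ / 60) * H (ex τ)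

/-- The square of the Dedekind eta function. -/
def etaSq (τ : ℂ) : ℂ := ex (τ / 12) * E (ex τ) ^ 2

lemma ex_add_int (τ : ℂ) (n : ℤ) : ex (τ + n) = ex τ := by rw [ex_add, ex_int, mul_one]

lemma gMod_add_int (τ : ℂ) (n : ℤ) : gMod (τ + n) = ex (-n / 60) * gMod τ := by
  rw [gMod, gMod, ex_add_int, ← mul_assoc, ← ex_add]; ring_nf

lemma hMod_add_int (τ : ℂ) (n : ℤ) : hMod (τ + n) = ex (11 * n / 60) * hMod τ := by
  rw [hMod, hMod, ex_add_int, ← mul_assoc, ← ex_add]; ring_nf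

lemma etaSq_add_int (τ : ℂ) (n : ℤ) : etaSq (τ + n) = ex (n / 12) * etaSq τ := by
  rw [etaSq, etaSq, ex_add_int, ← mul_assoc, ← ex_add]; ring_nf

lemma thetaConst_three_one (τ : ℂ) : thetaConst 3 1 τ = ex (τ / 24) * E (ex τ) := by
  rw [thetaConst_eq_altTheta (by norm_num) (by norm_num), E_eq_altTheta]
  norm_num

lemma thetaConst_three_one_ne_zero {τ : ℂ} (hτ : 0 < τ.im) : thetaConst 3 1 τ ≠ 0 := by
  rw [thetaConst_three_one]
  exact mul_ne_zero (ex_ne_zero _) (E_ne_zero (norm_ex_lt_one hτ))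

lemma thetaConst_five_one {τ : ℂ} (hτ : 0 < τ.im) :
    thetaConst 5 1 τ = gMod τ * thetaConst 3 1 τ := by
  rw [thetaConst_three_one, thetaConst_eq_altTheta (by norm_num) (by norm_num),
    ← G_mul_E (norm_ex_lt_one hτ), gMod]
  norm_num
  rw [show τ / 40 = -τ / 60 + τ / 24 by ring, ex_add]
  ring

lemma thetaConst_five_three {τ : ℂ} (hτ : 0 < τ.im) :
    thetaConst 5 3 τ = hMod τ * thetaConst 3 1 τ := by
  rw [thetaConst_three_one, thetaConst_eq_altTheta (by norm_num) (by norm_num),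
    ← H_mul_E (norm_ex_lt_one hτ), hMod]
  norm_num
  rw [show 9 * τ / 40 = 11 * τ / 60 + τ / 24 by ring, ex_add]
  ring

lemma etaSq_eq (τ : ℂ) : etaSq τ = thetaConst 3 1 τ ^ 2 := by
  rw [thetaConst_three_one, mul_pow, ex_pow, etaSq]
  congr 2; push_cast; ring

lemma etaSq_ne_zero {τ : ℂ} (hτ : 0 < τ.im) : etaSq τ ≠ 0 := by
  rw [etaSq_eq]; exact pow_ne_zero _ (thetaConst_three_one_ne_zero hτ)

/-- Squaring removes the branch of the square root, so inversions compose without ambiguity. -/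
lemma etaSq_S {τ : ℂ} (hτ : 0 < τ.im) : etaSq (-1 / τ) = -I * τ * etaSq τ := by
  rw [etaSq_eq, etaSq_eq, eta_S hτ, mul_pow, ← Complex.cpow_nat_mul]
  norm_num

/-- The larger matrix entry `2 cos(π/10) / √5` of the inversion. -/
def sBig : ℂ := ((√5 : ℝ) : ℂ)⁻¹ * (ex (1 / 20) + ex (-(1 / 20)))

/-- The smaller matrix entry `2 cos(3π/10) / √5` of the inversion. -/
def sSmall : ℂ := ((√5 : ℝ) : ℂ)⁻¹ * (ex (3 / 20) + ex (-(3 / 20)))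

lemma im_neg_one_div_pos {τ : ℂ} (hτ : 0 < τ.im) : 0 < (-1 / τ).im := by
  have hτ0 : τ ≠ 0 := by rintro rfl; simp at hτ
  rw [neg_div, one_div, Complex.neg_im, Complex.inv_im, neg_div, neg_neg]
  exact div_pos hτ (Complex.normSq_pos.2 hτ0)

/-- By the Rogers-Ramanujan identities this is a quotient of theta constants, so the square roots
and η cancel. Classes 7 and 9 fold onto 3 and 1, leaving two cosines over √5. -/
lemma gMod_S {τ : ℂ} (hτ : 0 < τ.im) : gMod (-1 / τ) = sBig * gMod τ + sSmall * hMod τ := by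
  have hτ0 : τ ≠ 0 := by rintro rfl; simp at hτ
  have hS := im_neg_one_div_pos hτ
  have h := thetaConst_S 5 (r := 1) rfl hτ
  have h1 := thetaConst_self 5 τ
  have h2 := thetaConst_reflect 5 1 τ
  have h3 := thetaConst_reflect 5 3 τ
  rw [Fin.sum_univ_five] at h
  norm_num at h h1 h2 h3
  have e1 : ex (-(9 / 20)) = -ex (1 / 20) := by
    have := ex_add_half (-(9 / 20)); norm_num at this; rw [this, neg_neg]
  have e2 : ex (-(7 / 20)) = -ex (3 / 20) := by
    have := ex_add_half (-(7 / 20)); norm_num at this; rw [this, neg_neg]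
  have hc : (-(I * τ)) ^ (1 / 2 : ℂ) ≠ 0 := by simp [Complex.cpow_eq_zero_iff, hτ0]
  have heta := eta_S hτ
  rw [neg_mul] at heta
  rw [thetaConst_five_one hS, heta, h1, h2, h3, thetaConst_five_one hτ, thetaConst_five_three hτ,
    e1, e2] at h
  have h4 := thetaConst_three_one_ne_zero hτ
  refine mul_right_cancel₀ (mul_ne_zero hc h4) ?_
  rw [h, sBig, sSmall]
  ring

lemma hMod_S {τ : ℂ} (hτ : 0 < τ.im) : hMod (-1 / τ) = sSmall * gMod τ - sBig * hMod τ := by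
  have hτ0 : τ ≠ 0 := by rintro rfl; simp at hτ
  have hS := im_neg_one_div_pos hτ
  have h := thetaConst_S 5 (r := 3) rfl hτ
  have h1 := thetaConst_self 5 τ
  have h2 := thetaConst_reflect 5 1 τ
  have h3 := thetaConst_reflect 5 3 τ
  rw [Fin.sum_univ_five] at h
  norm_num at h h1 h2 h3
  have e1 : ex (-(27 / 20)) = -ex (3 / 20) := by
    have := ex_add_half (-(27 / 20))
    have h' := ex_add_int (-(17 / 20)) 1
    norm_num at this h'
    have h'' := ex_add_half (-(7 / 20))
    norm_num at h''
    have h3 := ex_add_int (-(27 / 20)) 1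
    norm_num at h3
    rw [← h3, h'', neg_neg]
  have e2 : ex (-(9 / 20)) = -ex (1 / 20) := by
    have := ex_add_half (-(9 / 20)); norm_num at this; rw [this, neg_neg]
  have e3 : ex (-(21 / 20)) = ex (-(1 / 20)) := by
    have := ex_add_int (-(21 / 20)) 1; norm_num at this; exact this.symm
  have hc : (-(I * τ)) ^ (1 / 2 : ℂ) ≠ 0 := by simp [Complex.cpow_eq_zero_iff, hτ0]
  have heta := eta_S hτ
  rw [neg_mul] at heta
  rw [thetaConst_five_three hS, heta, h1, h2, h3, thetaConst_five_one hτ, thetaConst_five_three hτ,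
    e1, e2, e3] at h
  have h4 := thetaConst_three_one_ne_zero hτ
  refine mul_right_cancel₀ (mul_ne_zero hc h4) ?_
  rw [h, sBig, sSmall]
  ring

/-- The fifth root of unity `e^{2π i / 5}`. -/
def zeta5 : ℂ := ex (1 / 5)

lemma zeta5_pow (n : ℕ) : zeta5 ^ n = ex (n / 5) := by
  rw [zeta5, ex_pow]; ring_nf

lemma zeta5_pow_five : zeta5 ^ 5 = 1 := by
  rw [zeta5_pow]; norm_num; exact_mod_cast ex_int 1

lemma zeta5_ne_one : zeta5 ≠ 1 := by
  intro h
  rw [zeta5, ex, Complex.exp_eq_one_iff] at h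
  obtain ⟨n, hn⟩ := h
  have h1 : (1 : ℂ) / 5 = n := by
    have : (2 * π * I : ℂ) ≠ 0 := Complex.two_pi_I_ne_zero
    refine mul_left_cancel₀ this (hn.trans (mul_comm _ _))
  have h2 : (1 : ℂ) = ((n * 5 : ℤ) : ℂ) := by push_cast; linear_combination 5 * h1
  have h3 : (1 : ℤ) = n * 5 := by exact_mod_cast h2
  omega

lemma zeta5_relation : zeta5 ^ 4 + zeta5 ^ 3 + zeta5 ^ 2 + zeta5 + 1 = 0 := by
  refine (mul_eq_zero.1 ?_).resolve_left (sub_ne_zero.2 zeta5_ne_one)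
  linear_combination zeta5_pow_five

lemma ex_twentieth_pow (n : ℕ) : ex (1 / 20) ^ n = ex (n / 20) := by rw [ex_pow]; ring_nf

lemma ex_twentieth_pow_ten : ex (1 / 20) ^ 10 = -1 := by
  rw [ex_twentieth_pow, ← ex_half]; norm_num

lemma zeta5_eq_ex_twentieth_pow : zeta5 = ex (1 / 20) ^ 4 := by
  rw [ex_twentieth_pow, zeta5]; norm_num

lemma ex_neg_twentieth : ex (-(1 / 20)) = -ex (1 / 20) ^ 9 := by
  have := ex_add_half (-(1 / 20))
  rw [ex_twentieth_pow, ← neg_eq_iff_eq_neg, ← this]; norm_num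

lemma ex_neg_three_twentieths : ex (-(3 / 20)) = -ex (1 / 20) ^ 7 := by
  have := ex_add_half (-(3 / 20))
  rw [ex_twentieth_pow, ← neg_eq_iff_eq_neg, ← this]; norm_num

lemma ex_three_twentieths : ex (3 / 20) = ex (1 / 20) ^ 3 := by
  rw [ex_twentieth_pow]; norm_num

/-- The ratio of the two entries is the golden ratio -(ζ² + ζ³). Together with `sSmall_sq`, this
turns the inversion matrix into algebra over ζ₅. -/
lemma sBig_eq : sBig = -(zeta5 ^ 2 + zeta5 ^ 3) * sSmall := by
  rw [sBig, sSmall, zeta5_eq_ex_twentieth_pow, ex_three_twentieths, ex_neg_three_twentieths,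
    ex_neg_twentieth]
  have h := ex_twentieth_pow_ten
  grind

lemma sSmall_sq : 5 * sSmall ^ 2 = 3 + zeta5 ^ 2 + zeta5 ^ 3 := by
  have h5 : ((√5 : ℝ) : ℂ) ^ 2 = 5 := by
    rw [← Complex.ofReal_pow, Real.sq_sqrt (by norm_num)]; norm_num
  have h : (ex (3 / 20) + ex (-(3 / 20))) ^ 2 = 3 + zeta5 ^ 2 + zeta5 ^ 3 := by
    have h1 := ex_twentieth_pow_ten
    have h2 := zeta5_relation
    rw [zeta5_eq_ex_twentieth_pow] at *
    rw [ex_three_twentieths, ex_neg_three_twentieths]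
    grind
  rw [sSmall, mul_pow, inv_pow, h5, h]
  ring

lemma zeta5_zpow_congr {n : ℤ} {k : ℕ} (h : (n - k) % 5 = 0) : zeta5 ^ n = zeta5 ^ k := by
  obtain ⟨m, hm⟩ := Int.dvd_of_emod_eq_zero h
  have h0 : zeta5 ≠ 0 := ex_ne_zero _
  have h5 : zeta5 ^ (5 : ℤ) = 1 := by exact_mod_cast zeta5_pow_five
  rw [show n = 5 * m + k by omega, zpow_add₀ h0, zpow_mul, h5, one_zpow, one_mul, zpow_natCast]

lemma hMod_add_int_zeta {n : ℤ} {k : ℕ} (h : (n - k) % 5 = 0) (τ : ℂ) :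
    hMod (τ + n) = ex (-n / 60) * zeta5 ^ k * hMod τ := by
  rw [hMod_add_int, ← zeta5_zpow_congr h, zeta5, ex_zpow, ← ex_add]
  ring_nf

lemma im_word_pos {x : ℂ} (hx : 0 < x.im) (a b : ℤ) : 0 < (a - 1 / (x + b)).im := by
  have := im_neg_one_div_pos (τ := x + b) (by simpa using hx)
  rw [neg_div] at this
  simpa using this

/-- One block T^a S T^b of a word in the modular group. The 60th root of unity depends only on a + b
and is the same for g and h; what distinguishes them is a power of ζ₅, so iterated words stay
polynomial in ζ₅ and `sSmall`. -/
lemma gMod_word {x : ℂ} (hx : 0 < x.im) (a : ℤ) {b : ℤ} {k : ℕ} (hk : (b - k) % 5 = 0) :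
    gMod (a - 1 / (x + b)) = ex (-((a + b : ℤ) : ℂ) / 60) * sSmall *
      (-(zeta5 ^ 2 + zeta5 ^ 3) * gMod x + zeta5 ^ k * hMod x) := by
  rw [show a - 1 / (x + b) = -1 / (x + b) + a by ring, gMod_add_int,
    gMod_S (by simpa using hx), gMod_add_int, hMod_add_int_zeta hk, sBig_eq]
  push_cast
  rw [show -((a : ℂ) + b) / 60 = -a / 60 + -b / 60 by ring, ex_add]
  ring

lemma hMod_word {x : ℂ} (hx : 0 < x.im) {a b : ℤ} {j k : ℕ} (hj : (a - j) % 5 = 0)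
    (hk : (b - k) % 5 = 0) :
    hMod (a - 1 / (x + b)) = ex (-((a + b : ℤ) : ℂ) / 60) * sSmall * zeta5 ^ j *
      (gMod x + (zeta5 ^ 2 + zeta5 ^ 3) * zeta5 ^ k * hMod x) := by
  rw [show a - 1 / (x + b) = -1 / (x + b) + a by ring, hMod_add_int_zeta hj,
    hMod_S (by simpa using hx), gMod_add_int, hMod_add_int_zeta hk, sBig_eq]
  push_cast
  rw [show -((a : ℂ) + b) / 60 = -a / 60 + -b / 60 by ring, ex_add]
  ring

lemma etaSq_word {x : ℂ} (hx : 0 < x.im) (a b : ℤ) :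
    etaSq (a - 1 / (x + b)) = ex (((a + b : ℤ) : ℂ) / 12) * (-I * (x + b)) * etaSq x := by
  rw [show a - 1 / (x + b) = -1 / (x + b) + a by ring, etaSq_add_int,
    etaSq_S (by simpa using hx), etaSq_add_int]
  push_cast
  rw [show ((a : ℂ) + b) / 12 = a / 12 + b / 12 by ring, ex_add]
  ring

/-! ### Atkin-Lehner transformations of level 26 -/

/-- The normalized form of `U(2, 13, q)`. -/
def uOne (τ : ℂ) : ℂ := gMod (2 * τ) * gMod (13 * τ) + hMod (2 * τ) * hMod (13 * τ)

/-- The normalized form of `U(1, 26, q)`. -/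
def uTwo (τ : ℂ) : ℂ := hMod τ * gMod (26 * τ) - gMod τ * hMod (26 * τ)

/-- The eta quotient `(η(2τ) η(13τ) / (η(τ) η(26τ)))²`. -/
def etaQuot (τ : ℂ) : ℂ := etaSq (2 * τ) * etaSq (13 * τ) / (etaSq τ * etaSq (26 * τ))

/-- The values of `uOne`, `uTwo`, `etaQuot` at two points agree up to a common fourth root of unity
and possibly the simultaneous exchange of `uOne`, `uTwo` and inversion of `etaQuot`. -/
def Linked (τ τ' : ℂ) : Prop :=
  ∃ c : ℂ, c ^ 4 = 1 ∧
    ((uOne τ' = c * uOne τ ∧ uTwo τ' = c * uTwo τ ∧ etaQuot τ' = etaQuot τ) ∨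
      (uOne τ' = c * uTwo τ ∧ uTwo τ' = c * uOne τ ∧ etaQuot τ' = (etaQuot τ)⁻¹))

lemma mul_im_pos {τ : ℂ} (hτ : 0 < τ.im) (n : ℕ) [NeZero n] : 0 < ((n : ℂ) * τ).im := by
  have : 0 < (n : ℝ) := by exact_mod_cast Nat.pos_of_ne_zero (NeZero.ne n)
  simpa using mul_pos this hτ

lemma ex_neg_quarter : ex (-(1 / 4)) = -I := by
  rw [ex, show 2 * (π : ℂ) * I * -(1 / 4) = -(π / 2 * I) by ring, Complex.exp_neg,
    Complex.exp_pi_div_two_mul_I, Complex.inv_I]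

lemma linear_ne_zero {τ : ℂ} (hτ : 0 < τ.im) {m : ℤ} (hm : m ≠ 0) (n : ℤ) :
    (m : ℂ) * τ + n ≠ 0 := by
  intro h
  have := congrArg Complex.im h
  simp [hm, hτ.ne'] at this

lemma sqrt_five_eq : ((√5 : ℝ) : ℂ) = -1 - 2 * (zeta5 ^ 2 + zeta5 ^ 3) := by
  have h1 : ex (1 / 10) + ex (-(1 / 10)) = 2 * Complex.cos (π / 5) := by
    rw [Complex.two_cos, ex, ex]; ring_nf
  have h2 : zeta5 ^ 2 = -ex (-(1 / 10)) := by rw [zeta5_pow, ← ex_add_half]; norm_num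
  have h3 : zeta5 ^ 3 = -ex (1 / 10) := by rw [zeta5_pow, ← ex_add_half]; norm_num
  have h4 : Complex.cos (π / 5) = (1 + ((√5 : ℝ) : ℂ)) / 4 := by
    have := congrArg ((↑) : ℝ → ℂ) Real.cos_pi_div_five
    push_cast at this
    exact this
  rw [h2, h3]
  linear_combination -2 * h1 - 4 * h4

/-- An odd number of inversions leaves an odd power of `sSmall`, hence a √5; this relation is what
removes it. -/
lemma ex_mul_sSmall : ex (3 / 60) * sSmall * (1 - zeta5 ^ 2) = 1 := by
  have h0 : ((√5 : ℝ) : ℂ) ≠ 0 := by simp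
  have h1 := ex_twentieth_pow_ten
  have h2 := zeta5_relation
  have h3 := sqrt_five_eq
  rw [zeta5_eq_ex_twentieth_pow] at *
  rw [show (3 / 60 : ℂ) = 1 / 20 by norm_num, sSmall, ex_three_twentieths, ex_neg_three_twentieths,
    mul_left_comm, mul_assoc, inv_mul_eq_one₀ h0, h3]
  grind

/-- The Fricke involution exchanges τ with 26τ and 2τ with 13τ, each through a single inversion; so
u₁ and u₂ are individually preserved. -/
lemma linked_fricke {τ : ℂ} (hτ : 0 < τ.im) : Linked τ (-1 / (26 * τ)) := by
  have h2 : 0 < (2 * τ).im := mul_im_pos hτ 2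
  have h13 : 0 < (13 * τ).im := mul_im_pos hτ 13
  have h26 : 0 < (26 * τ).im := mul_im_pos hτ 26
  have d0 : τ ≠ 0 := by
    simpa [sub_eq_add_neg] using linear_ne_zero hτ (show (1 : ℤ) ≠ 0 by norm_num) 0
  have d1 : 2 * τ ≠ 0 := by
    simpa [sub_eq_add_neg] using linear_ne_zero hτ (show (2 : ℤ) ≠ 0 by norm_num) 0
  have d2 : 13 * τ ≠ 0 := by
    simpa [sub_eq_add_neg] using linear_ne_zero hτ (show (13 : ℤ) ≠ 0 by norm_num) 0
  have d3 : 26 * τ ≠ 0 := by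
    simpa [sub_eq_add_neg] using linear_ne_zero hτ (show (26 : ℤ) ≠ 0 by norm_num) 0
  set τ' := -1 / (26 * τ) with hτ'
  have e1 : τ' = (0 : ℤ) - 1 / ((26 * τ) + (0 : ℤ)) := by
    rw [hτ']; push_cast; grind
  have e2 : 2 * τ' = (0 : ℤ) - 1 / ((13 * τ) + (0 : ℤ)) := by
    rw [hτ']; push_cast; grind
  have e13 : 13 * τ' = (0 : ℤ) - 1 / ((2 * τ) + (0 : ℤ)) := by
    rw [hτ']; push_cast; grind
  have e26 : 26 * τ' = (0 : ℤ) - 1 / (τ + (0 : ℤ)) := by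
    rw [hτ']; push_cast; grind
  have hz := zeta5_relation
  have hs := sSmall_sq
  have k0 : ((0 : ℤ) - (0 : ℕ)) % 5 = 0 := rfl
  refine ⟨1, ?_, Or.inl ⟨?_, ?_, ?_⟩⟩
  · norm_num
  · rw [uOne, e2, e13, gMod_word h13 0 k0, hMod_word h13 k0 k0,
      gMod_word h2 0 k0, hMod_word h2 k0 k0, uOne]
    have hp : ex (-((0 + 0 : ℤ) : ℂ) / 60) ^ 2 = 1 := by
      simp only [ex_pow, ← ex_zero]; norm_num
    generalize ex (-((0 + 0 : ℤ) : ℂ) / 60) = p0 at *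
    generalize gMod (13 * τ) = g1 at *
    generalize hMod (13 * τ) = h1 at *
    generalize gMod (2 * τ) = g2 at *
    generalize hMod (2 * τ) = h2 at *
    generalize zeta5 = z at *
    generalize sSmall = s at *
    -- What remains is polynomial in the values of g and h, modulo the relations for ζ₅, for
    -- `sSmall`² and for the root-of-unity factors.
    clear * - hz hs hp
    grind
  · rw [uTwo, e26, e1, gMod_word hτ 0 k0, hMod_word hτ k0 k0,
      gMod_word h26 0 k0, hMod_word h26 k0 k0, uTwo]
    have hp : ex (-((0 + 0 : ℤ) : ℂ) / 60) ^ 2 = 1 := by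
      simp only [ex_pow, ← ex_zero]; norm_num
    generalize ex (-((0 + 0 : ℤ) : ℂ) / 60) = p0 at *
    generalize gMod τ = g1 at *
    generalize hMod τ = h1 at *
    generalize gMod (26 * τ) = g2 at *
    generalize hMod (26 * τ) = h2 at *
    generalize zeta5 = z at *
    generalize sSmall = s at *
    clear * - hz hs hp
    grind
  · have w1 : etaSq τ' = ex (0 / 12) * (-I * (26 * τ)) * etaSq (26 * τ) := by
      rw [e1, etaSq_word h26 0 0]
      push_cast; ring_nf
    have w2 : etaSq (2 * τ') = ex (0 / 12) * (-I * (13 * τ)) * etaSq (13 * τ) := by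
      rw [e2, etaSq_word h13 0 0]
      push_cast; ring_nf
    have w13 : etaSq (13 * τ') = ex (0 / 12) * (-I * (2 * τ)) * etaSq (2 * τ) := by
      rw [e13, etaSq_word h2 0 0]
      push_cast; ring_nf
    have w26 : etaSq (26 * τ') = ex (0 / 12) * (-I * (τ)) * etaSq τ := by
      rw [e26, etaSq_word hτ 0 0]
      push_cast; ring_nf
    have hv : ex (0 / 12) * ex (0 / 12) = (ex (0 / 12) * ex (0 / 12)) := by
      ring
    have hI := Complex.I_sq
    have n1 := etaSq_ne_zero hτ
    have n2 := etaSq_ne_zero h2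
    have n13 := etaSq_ne_zero h13
    have n26 := etaSq_ne_zero h26
    have x1 := ex_ne_zero (0 / 12)
    have x2 := ex_ne_zero (0 / 12)
    have p1 : -I * (26 * τ) ≠ 0 := by clear * - d3 hI; grind
    have p2 : -I * (τ) ≠ 0 := by clear * - d0 hI; grind
    rw [etaQuot, w2, w13, w26, w1, etaQuot, 
      div_eq_div_iff (mul_ne_zero (mul_ne_zero (mul_ne_zero x1 p1) n26) (mul_ne_zero (mul_ne_zero
          x2 p2) n1))
        (mul_ne_zero n1 n26)]
    clear * - hv hI
    grind

/-- An Atkin-Lehner matrix of determinant 13: 2τ' and 13τ' are modular images of 26τ and τ, so u₁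
and u₂ are exchanged. -/
lemma linked_half {τ : ℂ} (hτ : 0 < τ.im) : Linked τ ((13 * τ - 7) / (26 * τ - 13)) := by
  have h2 : 0 < (2 * τ).im := mul_im_pos hτ 2
  have h13 : 0 < (13 * τ).im := mul_im_pos hτ 13
  have h26 : 0 < (26 * τ).im := mul_im_pos hτ 26
  have hx1_1 := im_word_pos h13 0 (-7)
  have hx13_1 := im_word_pos hτ 0 (-1)
  have d0 : τ - 1 ≠ 0 := by
    simpa [sub_eq_add_neg] using linear_ne_zero hτ (show (1 : ℤ) ≠ 0 by norm_num) (-1)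
  have d1 : 2 * τ - 1 ≠ 0 := by
    simpa [sub_eq_add_neg] using linear_ne_zero hτ (show (2 : ℤ) ≠ 0 by norm_num) (-1)
  have d2 : 13 * τ - 7 ≠ 0 := by
    simpa [sub_eq_add_neg] using linear_ne_zero hτ (show (13 : ℤ) ≠ 0 by norm_num) (-7)
  have d3 : 26 * τ - 13 ≠ 0 := by
    simpa [sub_eq_add_neg] using linear_ne_zero hτ (show (26 : ℤ) ≠ 0 by norm_num) (-13)
  set τ' := (13 * τ - 7) / (26 * τ - 13) with hτ'
  -- Continued fraction expansions write each multiple of τ' as a word of blocks T^a S T^b applied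
  -- to a multiple of τ.
  have e1 : τ' = (0 : ℤ) - 1 / (((0 : ℤ) - 1 / ((13 * τ) + (-7 : ℤ))) + (-2 : ℤ)) := by
    have f0 : (0 : ℤ) - 1 / ((13 * τ) + (-7 : ℤ)) = (-1) / (13 * τ - 7) := by push_cast; grind
    rw [f0, hτ']
    push_cast; grind
  have e2 : 2 * τ' = (1 : ℤ) - 1 / ((26 * τ) + (-13 : ℤ)) := by
    rw [hτ']; push_cast; grind
  have e13 : 13 * τ' = (6 : ℤ) - 1 / (((0 : ℤ) - 1 / (τ + (-1 : ℤ))) + (-2 : ℤ)) := by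
    have f0 : (0 : ℤ) - 1 / (τ + (-1 : ℤ)) = (-1) / (τ - 1) := by push_cast; grind
    rw [f0, hτ']
    push_cast; grind
  have e26 : 26 * τ' = (13 : ℤ) - 1 / ((2 * τ) + (-1 : ℤ)) := by
    rw [hτ']; push_cast; grind
  have hz := zeta5_relation
  have hs := sSmall_sq
  have k0 : ((-13 : ℤ) - (2 : ℕ)) % 5 = 0 := rfl
  have k1 : ((1 : ℤ) - (1 : ℕ)) % 5 = 0 := rfl
  have k2 : ((-2 : ℤ) - (3 : ℕ)) % 5 = 0 := rfl
  have k3 : ((6 : ℤ) - (1 : ℕ)) % 5 = 0 := rfl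
  have k4 : ((-1 : ℤ) - (4 : ℕ)) % 5 = 0 := rfl
  have k5 : ((0 : ℤ) - (0 : ℕ)) % 5 = 0 := rfl
  have k6 : ((13 : ℤ) - (3 : ℕ)) % 5 = 0 := rfl
  have k7 : ((-7 : ℤ) - (3 : ℕ)) % 5 = 0 := rfl
  -- Each product in u₁ or u₂ undergoes three inversions, so the constant keeps an odd power of
  -- `sSmall`; its fourth power is computed from `sSmall_sq`.
  refine ⟨ex (-3 / 60) * sSmall * (1 - zeta5 ^ 3), ?_, Or.inr ⟨?_, ?_, ?_⟩⟩
  · have hp : ex (-3 / 60) ^ 4 = zeta5 ^ 4 := by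
      rw [ex_pow, zeta5_pow, ← ex_add_int _ 1]; norm_num
    generalize ex (-3 / 60) = p at *
    generalize zeta5 = z at *
    generalize sSmall = s at *
    have : s ^ 4 = ((3 + z ^ 2 + z ^ 3) / 5) ^ 2 := by rw [← hs]; ring
    rw [mul_pow, mul_pow, hp, this]
    clear * - hz
    grind
  · rw [uOne, e2, e13, gMod_word h26 1 k0, hMod_word h26 k1 k0,
      gMod_word hx13_1 6 k2, hMod_word hx13_1 k3 k2, gMod_word hτ 0 k4, hMod_word hτ k5 k4, uTwo]
    have hp : ex (-((1 + -13 : ℤ) : ℂ) / 60) * ex (-((0 + -1 : ℤ) : ℂ) / 60) *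
        ex (-((6 + -2 : ℤ) : ℂ) / 60) = ex (-3 / 60) * zeta5 ^ 1 := by
      simp only [zeta5_pow, ← ex_add]; norm_num
    generalize ex (-((1 + -13 : ℤ) : ℂ) / 60) = p0 at *
    generalize ex (-((0 + -1 : ℤ) : ℂ) / 60) = p1 at *
    generalize ex (-((6 + -2 : ℤ) : ℂ) / 60) = p2 at *
    generalize ex (-3 / 60) = p at *
    generalize gMod τ = g1 at *
    generalize hMod τ = h1 at *
    generalize gMod (26 * τ) = g2 at *
    generalize hMod (26 * τ) = h2 at *
    generalize zeta5 = z at *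
    generalize sSmall = s at *
    clear * - hz hs hp
    grind
  · rw [uTwo, e26, e1, gMod_word h2 13 k4, hMod_word h2 k6 k4,
      gMod_word hx1_1 0 k2, hMod_word hx1_1 k5 k2, gMod_word h13 0 k7, hMod_word h13 k5 k7, uOne]
    have hp : ex (-((13 + -1 : ℤ) : ℂ) / 60) * ex (-((0 + -7 : ℤ) : ℂ) / 60) *
        ex (-((0 + -2 : ℤ) : ℂ) / 60) = ex (-3 / 60) := by
      simp only [← ex_add]; norm_num
    generalize ex (-((13 + -1 : ℤ) : ℂ) / 60) = p0 at *
    generalize ex (-((0 + -7 : ℤ) : ℂ) / 60) = p1 at *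
    generalize ex (-((0 + -2 : ℤ) : ℂ) / 60) = p2 at *
    generalize ex (-3 / 60) = p at *
    generalize gMod (13 * τ) = g1 at *
    generalize hMod (13 * τ) = h1 at *
    generalize gMod (2 * τ) = g2 at *
    generalize hMod (2 * τ) = h2 at *
    generalize zeta5 = z at *
    generalize sSmall = s at *
    clear * - hz hs hp
    grind
  · have w1 : etaSq τ' = ex (-9 / 12) * (-(-26 * τ + 13)) * etaSq (13 * τ) := by
      rw [e1, etaSq_word hx1_1 0 (-2), etaSq_word h13 0 (-7)]
      have hw : (-I * (((0 : ℤ) - 1 / ((13 * τ) + (-7 : ℤ))) + (-2 : ℤ))) * (-I * ((13 *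
          τ) + (-7 : ℤ))) = -(-26 * τ + 13) := by
        have hI := Complex.I_sq
        push_cast; grind
      have hv : ex (((0 + -2 : ℤ) : ℂ) / 12) * ex (((0 + -7 : ℤ) : ℂ) / 12) = ex (-9 / 12) := by
        simp only [← ex_add]; norm_num
      rw [← hw, ← hv]; ring
    have w2 : etaSq (2 * τ') = ex (-12 / 12) * (-I * (26 * τ - 13)) * etaSq (26 * τ) := by
      rw [e2, etaSq_word h26 1 (-13)]
      push_cast; ring_nf
    have w13 : etaSq (13 * τ') = ex (3 / 12) * (-(-2 * τ + 1)) * etaSq τ := by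
      rw [e13, etaSq_word hx13_1 6 (-2), etaSq_word hτ 0 (-1)]
      have hw : (-I * (((0 : ℤ) - 1 / (τ + (-1 : ℤ))) + (-2 : ℤ))) * (-I * (τ + (-1 : ℤ))) =
          -(-2 * τ + 1) := by
        have hI := Complex.I_sq
        push_cast; grind
      have hv : ex (((6 + -2 : ℤ) : ℂ) / 12) * ex (((0 + -1 : ℤ) : ℂ) / 12) = ex (3 / 12) := by
        simp only [← ex_add]; norm_num
      rw [← hw, ← hv]; ring
    have w26 : etaSq (26 * τ') = ex (12 / 12) * (-I * (2 * τ - 1)) * etaSq (2 * τ) := by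
      rw [e26, etaSq_word h2 13 (-1)]
      push_cast; ring_nf
    have hv : ex (-12 / 12) * ex (3 / 12) = (ex (-9 / 12) * ex (12 / 12)) := by
      rw [← ex_add, ← ex_add, ← ex_add_int (_ + _) 1]; norm_num
    have hI := Complex.I_sq
    have n1 := etaSq_ne_zero hτ
    have n2 := etaSq_ne_zero h2
    have n13 := etaSq_ne_zero h13
    have n26 := etaSq_ne_zero h26
    have x1 := ex_ne_zero (-9 / 12)
    have x2 := ex_ne_zero (12 / 12)
    have p1 : -(-26 * τ + 13) ≠ 0 := by clear * - d3 hI; grind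
    have p2 : -I * (2 * τ - 1) ≠ 0 := by clear * - d1 hI; grind
    rw [etaQuot, w2, w13, w26, w1, etaQuot, inv_div, 
      div_eq_div_iff (mul_ne_zero (mul_ne_zero (mul_ne_zero x1 p1) n13) (mul_ne_zero (mul_ne_zero
          x2 p2) n2))
        (mul_ne_zero n2 n13)]
    clear * - hv hI
    grind

/-- An Atkin-Lehner matrix of determinant 2: it sends 2τ, 13τ to images of τ, 26τ, and again
exchanges u₁ and u₂. -/
lemma linked_three_thirteenths {τ : ℂ} (hτ : 0 < τ.im) : Linked τ ((4 * τ - 1) / (26 * τ - 6)) := by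
  have h2 : 0 < (2 * τ).im := mul_im_pos hτ 2
  have h13 : 0 < (13 * τ).im := mul_im_pos hτ 13
  have h26 : 0 < (26 * τ).im := mul_im_pos hτ 26
  have hx1_2 := im_word_pos h2 0 0
  have hx1_1 := im_word_pos hx1_2 0 2
  have hx2_2 := im_word_pos hτ 0 0
  have hx2_1 := im_word_pos hx2_2 0 4
  have d0 : τ ≠ 0 := by
    simpa [sub_eq_add_neg] using linear_ne_zero hτ (show (1 : ℤ) ≠ 0 by norm_num) 0
  have d1 : 2 * τ ≠ 0 := by
    simpa [sub_eq_add_neg] using linear_ne_zero hτ (show (2 : ℤ) ≠ 0 by norm_num) 0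
  have d2 : 4 * τ - 1 ≠ 0 := by
    simpa [sub_eq_add_neg] using linear_ne_zero hτ (show (4 : ℤ) ≠ 0 by norm_num) (-1)
  have d3 : 13 * τ - 3 ≠ 0 := by
    simpa [sub_eq_add_neg] using linear_ne_zero hτ (show (13 : ℤ) ≠ 0 by norm_num) (-3)
  have d4 : 26 * τ - 6 ≠ 0 := by
    simpa [sub_eq_add_neg] using linear_ne_zero hτ (show (26 : ℤ) ≠ 0 by norm_num) (-6)
  set τ' := (4 * τ - 1) / (26 * τ - 6) with hτ'
  have e1 : τ' =
      (0 : ℤ) - 1 / (((0 : ℤ) - 1 / (((0 : ℤ) - 1 / ((2 *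
      τ) + (0 : ℤ))) + (2 : ℤ))) + (-6 : ℤ)) := by
    have f0 : (0 : ℤ) - 1 / ((2 * τ) + (0 : ℤ)) = (-1) / (2 * τ) := by push_cast; grind
    have f1 : (0 : ℤ) - 1 / ((-1) / (2 * τ) + (2 : ℤ)) = (-2 * τ) / (4 * τ - 1) := by
      push_cast; grind
    rw [f0, f1, hτ']
    push_cast; grind
  have e2 : 2 * τ' =
      (0 : ℤ) - 1 / (((0 : ℤ) - 1 / (((0 : ℤ) - 1 / (τ + (0 : ℤ))) + (4 : ℤ))) + (-3 : ℤ)) := by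
    have f0 : (0 : ℤ) - 1 / (τ + (0 : ℤ)) = (-1) / (τ) := by push_cast; grind
    have f1 : (0 : ℤ) - 1 / ((-1) / (τ) + (4 : ℤ)) = (-τ) / (4 * τ - 1) := by push_cast; grind
    rw [f0, f1, hτ']
    push_cast; grind
  have e13 : 13 * τ' = (2 : ℤ) - 1 / ((26 * τ) + (-6 : ℤ)) := by
    rw [hτ']; push_cast; grind
  have e26 : 26 * τ' = (4 : ℤ) - 1 / ((13 * τ) + (-3 : ℤ)) := by
    rw [hτ']; push_cast; grind
  have hz := zeta5_relation
  have hs := sSmall_sq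
  have k0 : ((-3 : ℤ) - (2 : ℕ)) % 5 = 0 := rfl
  have k1 : ((0 : ℤ) - (0 : ℕ)) % 5 = 0 := rfl
  have k2 : ((4 : ℤ) - (4 : ℕ)) % 5 = 0 := rfl
  have k3 : ((-6 : ℤ) - (4 : ℕ)) % 5 = 0 := rfl
  have k4 : ((2 : ℤ) - (2 : ℕ)) % 5 = 0 := rfl
  -- The constant is e^(2πi(1/20 + 1/5)) = i.
  refine ⟨ex (3 / 60) * zeta5, ?_, Or.inr ⟨?_, ?_, ?_⟩⟩
  · rw [mul_pow, zeta5_pow, ex_pow, ← ex_add, ← ex_int 1]; norm_num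
  · rw [uOne, e2, e13, gMod_word hx2_1 0 k0, hMod_word hx2_1 k1 k0, gMod_word hx2_2 0 k2,
      hMod_word hx2_2 k1 k2, gMod_word hτ 0 k1, hMod_word hτ k1 k1,
      gMod_word h26 2 k3, hMod_word h26 k4 k3, uTwo]
    have hp : ex (-((0 + 0 : ℤ) : ℂ) / 60) * ex (-((0 + 4 : ℤ) : ℂ) / 60) *
        ex (-((0 + -3 : ℤ) : ℂ) / 60) * ex (-((2 + -6 : ℤ) : ℂ) / 60) = ex (3 / 60) := by
      simp only [← ex_add]; norm_num
    generalize ex (-((0 + 0 : ℤ) : ℂ) / 60) = p0 at *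
    generalize ex (-((0 + 4 : ℤ) : ℂ) / 60) = p1 at *
    generalize ex (-((0 + -3 : ℤ) : ℂ) / 60) = p2 at *
    generalize ex (-((2 + -6 : ℤ) : ℂ) / 60) = p3 at *
    generalize ex (3 / 60) = p at *
    generalize gMod τ = g1 at *
    generalize hMod τ = h1 at *
    generalize gMod (26 * τ) = g2 at *
    generalize hMod (26 * τ) = h2 at *
    generalize zeta5 = z at *
    generalize sSmall = s at *
    clear * - hz hs hp
    grind
  · rw [uTwo, e26, e1, gMod_word h13 4 k0, hMod_word h13 k2 k0,
      gMod_word hx1_1 0 k3, hMod_word hx1_1 k1 k3, gMod_word hx1_2 0 k4, hMod_word hx1_2 k1 k4,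
          gMod_word h2 0 k1, hMod_word h2 k1 k1, uOne]
    have hp : ex (-((4 + -3 : ℤ) : ℂ) / 60) * ex (-((0 + 0 : ℤ) : ℂ) / 60) *
        ex (-((0 + 2 : ℤ) : ℂ) / 60) * ex (-((0 + -6 : ℤ) : ℂ) / 60) = ex (3 / 60) := by
      simp only [← ex_add]; norm_num
    generalize ex (-((4 + -3 : ℤ) : ℂ) / 60) = p0 at *
    generalize ex (-((0 + 0 : ℤ) : ℂ) / 60) = p1 at *
    generalize ex (-((0 + 2 : ℤ) : ℂ) / 60) = p2 at *
    generalize ex (-((0 + -6 : ℤ) : ℂ) / 60) = p3 at *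
    generalize ex (3 / 60) = p at *
    generalize gMod (13 * τ) = g1 at *
    generalize hMod (13 * τ) = h1 at *
    generalize gMod (2 * τ) = g2 at *
    generalize hMod (2 * τ) = h2 at *
    generalize zeta5 = z at *
    generalize sSmall = s at *
    clear * - hz hs hp
    grind
  · have w1 : etaSq τ' = ex (-4 / 12) * (I * (-26 * τ + 6)) * etaSq (2 * τ) := by
      rw [e1, etaSq_word hx1_1 0 (-6), etaSq_word hx1_2 0 2, etaSq_word h2 0 0]
      have hw : (-I * (((0 : ℤ) - 1 / (((0 : ℤ) - 1 / ((2 *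
          τ) + (0 : ℤ))) + (2 : ℤ))) + (-6 : ℤ))) * (-I * (((0 : ℤ) - 1 / ((2 *
          τ) + (0 : ℤ))) + (2 : ℤ))) * (-I * ((2 * τ) + (0 : ℤ))) = I * (-26 * τ + 6) := by
        have hI := Complex.I_sq
        push_cast; grind
      have hv : ex (((0 + -6 : ℤ) : ℂ) / 12) * ex (((0 + 2 : ℤ) : ℂ) / 12) *
          ex (((0 + 0 : ℤ) : ℂ) / 12) = ex (-4 / 12) := by
        simp only [← ex_add]; norm_num
      rw [← hw, ← hv]; ring
    have w2 : etaSq (2 * τ') = ex (1 / 12) * (I * (-13 * τ + 3)) * etaSq τ := by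
      rw [e2, etaSq_word hx2_1 0 (-3), etaSq_word hx2_2 0 4, etaSq_word hτ 0 0]
      have hw : (-I * (((0 : ℤ) - 1 / (((0 : ℤ) - 1 / (τ + (0 : ℤ))) + (4 : ℤ))) + (-3 : ℤ))) *
          (-I * (((0 : ℤ) - 1 / (τ + (0 : ℤ))) + (4 : ℤ))) * (-I * (τ + (0 : ℤ))) =
          I * (-13 * τ + 3) := by
        have hI := Complex.I_sq
        push_cast; grind
      have hv : ex (((0 + -3 : ℤ) : ℂ) / 12) * ex (((0 + 4 : ℤ) : ℂ) / 12) *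
          ex (((0 + 0 : ℤ) : ℂ) / 12) = ex (1 / 12) := by
        simp only [← ex_add]; norm_num
      rw [← hw, ← hv]; ring
    have w13 : etaSq (13 * τ') = ex (-4 / 12) * (-I * (26 * τ - 6)) * etaSq (26 * τ) := by
      rw [e13, etaSq_word h26 2 (-6)]
      push_cast; ring_nf
    have w26 : etaSq (26 * τ') = ex (1 / 12) * (-I * (13 * τ - 3)) * etaSq (13 * τ) := by
      rw [e26, etaSq_word h13 4 (-3)]
      push_cast; ring_nf
    have hv : ex (1 / 12) * ex (-4 / 12) = (ex (-4 / 12) * ex (1 / 12)) := by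
      ring
    have hI := Complex.I_sq
    have n1 := etaSq_ne_zero hτ
    have n2 := etaSq_ne_zero h2
    have n13 := etaSq_ne_zero h13
    have n26 := etaSq_ne_zero h26
    have x1 := ex_ne_zero (-4 / 12)
    have x2 := ex_ne_zero (1 / 12)
    have p1 : I * (-26 * τ + 6) ≠ 0 := by clear * - d4 hI; grind
    have p2 : -I * (13 * τ - 3) ≠ 0 := by clear * - d3 hI; grind
    rw [etaQuot, w2, w13, w26, w1, etaQuot, inv_div, 
      div_eq_div_iff (mul_ne_zero (mul_ne_zero (mul_ne_zero x1 p1) n2) (mul_ne_zero (mul_ne_zero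
          x2 p2) n13))
        (mul_ne_zero n2 n13)]
    clear * - hv hI
    grind

/-- A second matrix of determinant 26, with pole at 1/3 instead of 0; it is needed to reach the
points with real part near 1/3. -/
lemma linked_third {τ : ℂ} (hτ : 0 < τ.im) : Linked τ ((26 * τ - 9) / (78 * τ - 26)) := by
  have h2 : 0 < (2 * τ).im := mul_im_pos hτ 2
  have h13 : 0 < (13 * τ).im := mul_im_pos hτ 13
  have h26 : 0 < (26 * τ).im := mul_im_pos hτ 26
  have hx1_1 := im_word_pos h26 0 (-9)
  have hx2_2 := im_word_pos h13 0 (-4)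
  have hx2_1 := im_word_pos hx2_2 0 2
  have hx13_1 := im_word_pos h2 0 (-1)
  have hx26_1 := im_word_pos hτ 0 0
  have d0 : τ ≠ 0 := by
    simpa [sub_eq_add_neg] using linear_ne_zero hτ (show (1 : ℤ) ≠ 0 by norm_num) 0
  have d1 : 2 * τ - 1 ≠ 0 := by
    simpa [sub_eq_add_neg] using linear_ne_zero hτ (show (2 : ℤ) ≠ 0 by norm_num) (-1)
  have d2 : 3 * τ - 1 ≠ 0 := by
    simpa [sub_eq_add_neg] using linear_ne_zero hτ (show (3 : ℤ) ≠ 0 by norm_num) (-1)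
  have d3 : 6 * τ - 2 ≠ 0 := by
    simpa [sub_eq_add_neg] using linear_ne_zero hτ (show (6 : ℤ) ≠ 0 by norm_num) (-2)
  have d4 : 13 * τ - 4 ≠ 0 := by
    simpa [sub_eq_add_neg] using linear_ne_zero hτ (show (13 : ℤ) ≠ 0 by norm_num) (-4)
  have d5 : 26 * τ - 9 ≠ 0 := by
    simpa [sub_eq_add_neg] using linear_ne_zero hτ (show (26 : ℤ) ≠ 0 by norm_num) (-9)
  have d6 : 39 * τ - 13 ≠ 0 := by
    simpa [sub_eq_add_neg] using linear_ne_zero hτ (show (39 : ℤ) ≠ 0 by norm_num) (-13)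
  have d7 : 78 * τ - 26 ≠ 0 := by
    simpa [sub_eq_add_neg] using linear_ne_zero hτ (show (78 : ℤ) ≠ 0 by norm_num) (-26)
  set τ' := (26 * τ - 9) / (78 * τ - 26) with hτ'
  have e1 : τ' = (0 : ℤ) - 1 / (((0 : ℤ) - 1 / ((26 * τ) + (-9 : ℤ))) + (-3 : ℤ)) := by
    have f0 : (0 : ℤ) - 1 / ((26 * τ) + (-9 : ℤ)) = (-1) / (26 * τ - 9) := by push_cast; grind
    rw [f0, hτ']
    push_cast; grind
  have e2 : 2 * τ' =
      (0 : ℤ) - 1 / (((0 : ℤ) - 1 / (((0 : ℤ) - 1 / ((13 *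
      τ) + (-4 : ℤ))) + (2 : ℤ))) + (-1 : ℤ)) := by
    have f0 : (0 : ℤ) - 1 / ((13 * τ) + (-4 : ℤ)) = (-1) / (13 * τ - 4) := by push_cast; grind
    have f1 : (0 : ℤ) - 1 / ((-1) / (13 * τ - 4) + (2 : ℤ)) = (-13 * τ + 4) / (26 * τ - 9) := by
      push_cast; grind
    rw [f0, f1, hτ']
    push_cast; grind
  have e13 : 13 * τ' = (4 : ℤ) - 1 / (((0 : ℤ) - 1 / ((2 * τ) + (-1 : ℤ))) + (-3 : ℤ)) := by
    have f0 : (0 : ℤ) - 1 / ((2 * τ) + (-1 : ℤ)) = (-1) / (2 * τ - 1) := by push_cast; grind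
    rw [f0, hτ']
    push_cast; grind
  have e26 : 26 * τ' = (9 : ℤ) - 1 / (((0 : ℤ) - 1 / (τ + (0 : ℤ))) + (3 : ℤ)) := by
    have f0 : (0 : ℤ) - 1 / (τ + (0 : ℤ)) = (-1) / (τ) := by push_cast; grind
    rw [f0, hτ']
    push_cast; grind
  have hz := zeta5_relation
  have hs := sSmall_sq
  have k0 : ((-1 : ℤ) - (4 : ℕ)) % 5 = 0 := rfl
  have k1 : ((0 : ℤ) - (0 : ℕ)) % 5 = 0 := rfl
  have k2 : ((2 : ℤ) - (2 : ℕ)) % 5 = 0 := rfl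
  have k3 : ((-4 : ℤ) - (1 : ℕ)) % 5 = 0 := rfl
  have k4 : ((-3 : ℤ) - (2 : ℕ)) % 5 = 0 := rfl
  have k5 : ((4 : ℤ) - (4 : ℕ)) % 5 = 0 := rfl
  have k6 : ((3 : ℤ) - (3 : ℕ)) % 5 = 0 := rfl
  have k7 : ((9 : ℤ) - (4 : ℕ)) % 5 = 0 := rfl
  have k8 : ((-9 : ℤ) - (1 : ℕ)) % 5 = 0 := rfl
  refine ⟨1, ?_, Or.inl ⟨?_, ?_, ?_⟩⟩
  · norm_num
  · rw [uOne, e2, e13, gMod_word hx2_1 0 k0, hMod_word hx2_1 k1 k0, gMod_word hx2_2 0 k2,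
      hMod_word hx2_2 k1 k2, gMod_word h13 0 k3, hMod_word h13 k1 k3,
      gMod_word hx13_1 4 k4, hMod_word hx13_1 k5 k4, gMod_word h2 0 k0, hMod_word h2 k1 k0, uOne]
    have hp : ex (-((0 + -4 : ℤ) : ℂ) / 60) * ex (-((0 + 2 : ℤ) : ℂ) / 60) *
        ex (-((0 + -1 : ℤ) : ℂ) / 60) ^ 2 * ex (-((4 + -3 : ℤ) : ℂ) / 60) = ex (3 / 60) := by
      simp only [ex_pow, ← ex_add]; norm_num
    have hq := ex_mul_sSmall
    generalize ex (-((0 + -4 : ℤ) : ℂ) / 60) = p0 at *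
    generalize ex (-((0 + 2 : ℤ) : ℂ) / 60) = p1 at *
    generalize ex (-((0 + -1 : ℤ) : ℂ) / 60) = p2 at *
    generalize ex (-((4 + -3 : ℤ) : ℂ) / 60) = p3 at *
    generalize ex (3 / 60) = p at *
    generalize gMod (13 * τ) = g1 at *
    generalize hMod (13 * τ) = h1 at *
    generalize gMod (2 * τ) = g2 at *
    generalize hMod (2 * τ) = h2 at *
    generalize zeta5 = z at *
    generalize sSmall = s at *
    -- The two words of u₁ contain five inversions, so the constant 1 is rewritten with one factor
    -- `sSmall` to match.
    rw [← hq]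
    clear * - hz hs hp
    grind
  · rw [uTwo, e26, e1, gMod_word hx26_1 9 k6, hMod_word hx26_1 k7 k6, gMod_word hτ 0 k1,
      hMod_word hτ k1 k1,
      gMod_word hx1_1 0 k4, hMod_word hx1_1 k1 k4, gMod_word h26 0 k8, hMod_word h26 k1 k8, uTwo]
    have hp : ex (-((0 + 0 : ℤ) : ℂ) / 60) * ex (-((9 + 3 : ℤ) : ℂ) / 60) *
        ex (-((0 + -9 : ℤ) : ℂ) / 60) * ex (-((0 + -3 : ℤ) : ℂ) / 60) = 1 := by
      simp only [← ex_add, ← ex_zero]; norm_num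
    generalize ex (-((0 + 0 : ℤ) : ℂ) / 60) = p0 at *
    generalize ex (-((9 + 3 : ℤ) : ℂ) / 60) = p1 at *
    generalize ex (-((0 + -9 : ℤ) : ℂ) / 60) = p2 at *
    generalize ex (-((0 + -3 : ℤ) : ℂ) / 60) = p3 at *
    generalize gMod τ = g1 at *
    generalize hMod τ = h1 at *
    generalize gMod (26 * τ) = g2 at *
    generalize hMod (26 * τ) = h2 at *
    generalize zeta5 = z at *
    generalize sSmall = s at *
    clear * - hz hs hp
    grind
  · have w1 : etaSq τ' = ex (-12 / 12) * (-(-78 * τ + 26)) * etaSq (26 * τ) := by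
      rw [e1, etaSq_word hx1_1 0 (-3), etaSq_word h26 0 (-9)]
      have hw : (-I * (((0 : ℤ) - 1 / ((26 * τ) + (-9 : ℤ))) + (-3 : ℤ))) * (-I * ((26 *
          τ) + (-9 : ℤ))) = -(-78 * τ + 26) := by
        have hI := Complex.I_sq
        push_cast; grind
      have hv : ex (((0 + -3 : ℤ) : ℂ) / 12) * ex (((0 + -9 : ℤ) : ℂ) / 12) = ex (-12 / 12) := by
        simp only [← ex_add]; norm_num
      rw [← hw, ← hv]; ring
    have w2 : etaSq (2 * τ') = ex (-3 / 12) * (I * (-39 * τ + 13)) * etaSq (13 * τ) := by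
      rw [e2, etaSq_word hx2_1 0 (-1), etaSq_word hx2_2 0 2, etaSq_word h13 0 (-4)]
      have hw : (-I * (((0 : ℤ) - 1 / (((0 : ℤ) - 1 / ((13 *
          τ) + (-4 : ℤ))) + (2 : ℤ))) + (-1 : ℤ))) * (-I * (((0 : ℤ) - 1 / ((13 *
          τ) + (-4 : ℤ))) + (2 : ℤ))) * (-I * ((13 * τ) + (-4 : ℤ))) = I * (-39 * τ + 13) := by
        have hI := Complex.I_sq
        push_cast; grind
      have hv : ex (((0 + -1 : ℤ) : ℂ) / 12) * ex (((0 + 2 : ℤ) : ℂ) / 12) *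
          ex (((0 + -4 : ℤ) : ℂ) / 12) = ex (-3 / 12) := by
        simp only [← ex_add]; norm_num
      rw [← hw, ← hv]; ring
    have w13 : etaSq (13 * τ') = ex (0 / 12) * (-(-6 * τ + 2)) * etaSq (2 * τ) := by
      rw [e13, etaSq_word hx13_1 4 (-3), etaSq_word h2 0 (-1)]
      have hw : (-I * (((0 : ℤ) - 1 / ((2 * τ) + (-1 : ℤ))) + (-3 : ℤ))) * (-I * ((2 *
          τ) + (-1 : ℤ))) = -(-6 * τ + 2) := by
        have hI := Complex.I_sq
        push_cast; grind
      have hv : ex (((4 + -3 : ℤ) : ℂ) / 12) * ex (((0 + -1 : ℤ) : ℂ) / 12) = ex (0 / 12) := by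
        simp only [← ex_add]; norm_num
      rw [← hw, ← hv]; ring
    have w26 : etaSq (26 * τ') = ex (12 / 12) * (-(3 * τ - 1)) * etaSq τ := by
      rw [e26, etaSq_word hx26_1 9 3, etaSq_word hτ 0 0]
      have hw : (-I * (((0 : ℤ) - 1 / (τ + (0 : ℤ))) + (3 : ℤ))) * (-I * (τ + (0 : ℤ))) =
          -(3 * τ - 1) := by
        have hI := Complex.I_sq
        push_cast; grind
      have hv : ex (((9 + 3 : ℤ) : ℂ) / 12) * ex (((0 + 0 : ℤ) : ℂ) / 12) = ex (12 / 12) := by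
        simp only [← ex_add]; norm_num
      rw [← hw, ← hv]; ring
    -- Five inversions in the numerator against four in the denominator leave a factor i,
    -- compensated by this -i.
    have hv : ex (-3 / 12) * ex (0 / 12) = -I * (ex (-12 / 12) * ex (12 / 12)) := by
      rw [← ex_neg_quarter, ← ex_add, ← ex_add, ← ex_add]; norm_num
    have hI := Complex.I_sq
    have n1 := etaSq_ne_zero hτ
    have n2 := etaSq_ne_zero h2
    have n13 := etaSq_ne_zero h13
    have n26 := etaSq_ne_zero h26
    have x1 := ex_ne_zero (-12 / 12)
    have x2 := ex_ne_zero (12 / 12)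
    have p1 : -(-78 * τ + 26) ≠ 0 := by clear * - d7 hI; grind
    have p2 : -(3 * τ - 1) ≠ 0 := by clear * - d2 hI; grind
    rw [etaQuot, w2, w13, w26, w1, etaQuot, 
      div_eq_div_iff (mul_ne_zero (mul_ne_zero (mul_ne_zero x1 p1) n26) (mul_ne_zero (mul_ne_zero
          x2 p2) n1))
        (mul_ne_zero n1 n26)]
    clear * - hv hI
    grind

lemma linked_add_int (τ : ℂ) (n : ℤ) : Linked τ (τ + n) := by
  have e2 : 2 * (τ + n) = 2 * τ + (2 * n : ℤ) := by push_cast; ring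
  have e13 : 13 * (τ + n) = 13 * τ + (13 * n : ℤ) := by push_cast; ring
  have e26 : 26 * (τ + n) = 26 * τ + (26 * n : ℤ) := by push_cast; ring
  refine ⟨ex (-n / 4), ?_, Or.inl ⟨?_, ?_, ?_⟩⟩
  · rw [ex_pow, ← ex_int (-n)]; push_cast; ring_nf
  · rw [uOne, uOne, e2, e13, gMod_add_int, gMod_add_int, hMod_add_int, hMod_add_int]
    have h1 : ex (-((2 * n : ℤ) : ℂ) / 60) * ex (-((13 * n : ℤ) : ℂ) / 60) = ex (-n / 4) := by
      rw [← ex_add]; push_cast; ring_nf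
    have h2 : ex (11 * ((2 * n : ℤ) : ℂ) / 60) * ex (11 * ((13 * n : ℤ) : ℂ) / 60)
        = ex (-n / 4) := by
      rw [← ex_add, ← ex_add_int (-n / 4) (3 * n)]; push_cast; ring_nf
    linear_combination gMod (2 * τ) * gMod (13 * τ) * h1 + hMod (2 * τ) * hMod (13 * τ) * h2
  · rw [uTwo, uTwo, e26, gMod_add_int, gMod_add_int, hMod_add_int, hMod_add_int]
    have h1 : ex (11 * n / 60) * ex (-((26 * n : ℤ) : ℂ) / 60) = ex (-n / 4) := by
      rw [← ex_add]; push_cast; ring_nf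
    have h2 : ex (-n / 60) * ex (11 * ((26 * n : ℤ) : ℂ) / 60) = ex (-n / 4) := by
      rw [← ex_add, ← ex_add_int (-n / 4) (5 * n)]; push_cast; ring_nf
    linear_combination hMod τ * gMod (26 * τ) * h1 - gMod τ * hMod (26 * τ) * h2
  · rw [etaQuot, etaQuot, e2, e13, e26, etaSq_add_int, etaSq_add_int, etaSq_add_int,
      etaSq_add_int]
    have h : ex (((2 * n : ℤ) : ℂ) / 12) * ex (((13 * n : ℤ) : ℂ) / 12)
        = ex (n / 12) * ex (((26 * n : ℤ) : ℂ) / 12) := by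
      rw [← ex_add, ← ex_add, ← ex_add_int (_ + _) n]; push_cast; ring_nf
    rw [mul_mul_mul_comm, h, mul_mul_mul_comm (ex (n / 12)) (etaSq τ),
      mul_div_mul_left _ _ (mul_ne_zero (ex_ne_zero _) (ex_ne_zero _))]

/-! ### Reduction to a strip and the maximum modulus argument -/

lemma im_sub_one_div (a N c : ℝ) (τ : ℂ) :
    ((a : ℂ) - 1 / (N * (τ - c))).im = τ.im / (N * ((τ.re - c) ^ 2 + τ.im ^ 2)) := by
  rw [Complex.sub_im, Complex.ofReal_im, one_div, Complex.inv_im, Complex.im_ofReal_mul,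
    Complex.normSq_mul, Complex.normSq_ofReal, Complex.normSq_apply]
  simp only [Complex.sub_im, Complex.ofReal_im, Complex.sub_re, Complex.ofReal_re, sub_zero,
      zero_sub]
  rcases eq_or_ne N 0 with rfl | hN
  · simp
  · rw [neg_div, neg_neg, mul_assoc, mul_div_mul_left _ _ hN]; ring_nf

/-- Each of the four transformations is a - 1/(N(τ - c)) and divides Im τ by N|τ - c|². For Im τ ≤
1/60 the discs N|τ - c|² ≤ 9/10 about c = 0, 3/13, 1/3, 1/2 cover 0 ≤ Re τ ≤ 1/2; the cut points
0.185, 0.2766, 0.38 lie in their overlaps. -/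
lemma exists_linked_im_ge {τ : ℂ} (hτ : 0 < τ.im) (h0 : 0 ≤ τ.re) (h1 : τ.re ≤ 1 / 2)
    (h : τ.im ≤ 1 / 60) : ∃ τ', Linked τ τ' ∧ 10 / 9 * τ.im ≤ τ'.im := by
  have key (a N c : ℝ) (hN : 0 < N) (hc : N * ((τ.re - c) ^ 2 + τ.im ^ 2) ≤ 9 / 10) (τ' : ℂ)
      (hτ' : τ' = a - 1 / (N * (τ - c))) : 10 / 9 * τ.im ≤ τ'.im := by
    rw [hτ', im_sub_one_div, le_div_iff₀ (by positivity)]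
    nlinarith
  have hy : τ.im ^ 2 ≤ 1 / 3600 := by nlinarith
  rcases le_total τ.re 0.185 with h2 | h2
  · refine ⟨_, linked_fricke hτ, key 0 26 0 (by norm_num) (by nlinarith) _ ?_⟩
    push_cast; ring
  rcases le_total τ.re 0.2766 with h3 | h3
  · refine ⟨_, linked_three_thirteenths hτ, key (2 / 13) 338 (3 / 13) (by norm_num)
      (by nlinarith) _ ?_⟩
    have := linear_ne_zero hτ (show (13 : ℤ) ≠ 0 by norm_num) (-3)
    push_cast at *
    grind
  rcases le_total τ.re 0.38 with h4 | h4
  · refine ⟨_, linked_third hτ, key (1 / 3) 234 (1 / 3) (by norm_num) (by nlinarith) _ ?_⟩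
    have := linear_ne_zero hτ (show (3 : ℤ) ≠ 0 by norm_num) (-1)
    push_cast at *
    grind
  · refine ⟨_, linked_half hτ, key (1 / 2) 52 (1 / 2) (by norm_num) (by nlinarith) _ ?_⟩
    have := linear_ne_zero hτ (show (2 : ℤ) ≠ 0 by norm_num) (-1)
    push_cast at *
    grind

/-- A real function on the upper half plane which is invariant under the group generated by the
transformations in `Linked` and the reflection in the imaginary axis. -/
structure LinkInvariant (F : ℂ → ℝ) : Prop where
  linked : ∀ τ τ', 0 < τ.im → Linked τ τ' → F τ' = F τ
  reflect : ∀ τ, 0 < τ.im → F (-(starRingEnd ℂ) τ) = F τ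

lemma LinkInvariant.exists_re_mem {F : ℂ → ℝ} (hF : LinkInvariant F) {τ : ℂ} (hτ : 0 < τ.im) :
    ∃ τ', 0 ≤ τ'.re ∧ τ'.re ≤ 1 / 2 ∧ τ'.im = τ.im ∧ F τ' = F τ := by
  have h := abs_le.1 (abs_sub_round τ.re)
  have hT := hF.linked τ _ hτ (linked_add_int τ (-round τ.re))
  push_cast at hT
  have hre : (τ + -(round τ.re : ℂ)).re = τ.re - round τ.re := by simp [sub_eq_add_neg]
  have him : (τ + -(round τ.re : ℂ)).im = τ.im := by simp
  rcases le_total 0 (τ.re - round τ.re) with h0 | h0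
  · exact ⟨_, by rwa [hre], by rw [hre]; exact h.2, him, hT⟩
  · refine ⟨_, ?_, ?_, ?_, (hF.reflect _ (by rwa [him])).trans hT⟩
    · rw [Complex.neg_re, Complex.conj_re, hre]; linarith
    · rw [Complex.neg_re, Complex.conj_re, hre]; linarith [h.1]
    · rw [Complex.neg_im, Complex.conj_im, him, neg_neg]

/-- Each round multiplies Im τ by at least 10/9, so finitely many suffice; n bounds their number. -/
lemma LinkInvariant.exists_mem_strip {F : ℂ → ℝ} (hF : LinkInvariant F) {τ : ℂ} (hτ : 0 < τ.im) :
    ∃ τ', 0 ≤ τ'.re ∧ τ'.re ≤ 1 / 2 ∧ 1 / 60 ≤ τ'.im ∧ F τ' = F τ := by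
  obtain ⟨n, hn⟩ := exists_pow_lt_of_lt_one (show 0 < 60 * τ.im by linarith)
    (show (9 / 10 : ℝ) < 1 by norm_num)
  induction n generalizing τ with
  | zero =>
    obtain ⟨τ', h1, h2, h3, h4⟩ := hF.exists_re_mem hτ
    exact ⟨τ', h1, h2, by rw [h3]; linarith [pow_zero (9 / 10 : ℝ)], h4⟩
  | succ n ih =>
    obtain ⟨τ', h1, h2, h3, h4⟩ := hF.exists_re_mem hτ
    rcases le_total (1 / 60) τ'.im with h5 | h5
    · exact ⟨τ', h1, h2, h5, h4⟩
    · obtain ⟨τ'', h6, h7⟩ := exists_linked_im_ge (h3 ▸ hτ) h1 h2 h5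
      rw [h3] at h7
      obtain ⟨σ, s1, s2, s3, s4⟩ := ih (τ := τ'') (by linarith) (by rw [pow_succ] at hn; linarith)
      exact ⟨σ, s1, s2, s3, s4.trans ((hF.linked _ _ (h3 ▸ hτ) h6).trans h4)⟩

/-- If e τ ≠ 0, decay at the cusp confines all values of modulus at least |e τ| to a compact part of
the strip. So |e| attains its maximum over the half plane and is constant, against the decay. -/
lemma eq_zero_of_linkInvariant {e : ℂ → ℂ} (hd : DifferentiableOn ℂ e {τ | 0 < τ.im})
    (hF : LinkInvariant fun τ => ‖e τ‖)
    (hlim : ∀ ε > 0, ∃ Y : ℝ, ∀ τ : ℂ, 0 < τ.im → Y ≤ τ.im → ‖e τ‖ < ε) {τ : ℂ} (hτ : 0 < τ.im) :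
    e τ = 0 := by
  by_contra hne
  obtain ⟨Y, hY⟩ := hlim ‖e τ‖ (norm_pos_iff.2 hne)
  set K : Set ℂ := Set.Icc 0 (1 / 2) ×ℂ Set.Icc (1 / 60) Y with hK
  have hKc : IsCompact K := isCompact_Icc.reProdIm isCompact_Icc
  have hKpos : ∀ z ∈ K, 0 < z.im := fun z hz => by
    have := (Complex.mem_reProdIm.1 hz).2.1
    linarith
  have hmem : ∀ z : ℂ, 0 < z.im → ‖e τ‖ ≤ ‖e z‖ → ∃ w ∈ K, ‖e w‖ = ‖e z‖ := by
    intro z hz hle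
    obtain ⟨w, h1, h2, h3, h4⟩ := hF.exists_mem_strip hz
    refine ⟨w, Complex.mem_reProdIm.2 ⟨⟨h1, h2⟩, h3, ?_⟩, h4⟩
    by_contra hlt
    have := hY w (by linarith) (not_le.1 hlt).le
    exact absurd (h4 ▸ this) (not_lt.2 hle)
  obtain ⟨w₀, hw₀, hw₀e⟩ := hmem τ hτ le_rfl
  obtain ⟨m, hm, hmax⟩ := hKc.exists_isMaxOn ⟨w₀, hw₀⟩
    ((hd.continuousOn.mono hKpos).norm)
  have hm1 : ‖e τ‖ ≤ ‖e m‖ := hw₀e ▸ hmax hw₀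
  have hU : IsOpen {z : ℂ | 0 < z.im} := isOpen_lt continuous_const Complex.continuous_im
  have hc : IsPreconnected {z : ℂ | 0 < z.im} := (convex_halfSpace_im_gt 0).isPreconnected
  have hmax' : IsMaxOn (norm ∘ e) {z : ℂ | 0 < z.im} m := by
    intro z hz
    rcases le_total ‖e τ‖ ‖e z‖ with h | h
    · obtain ⟨w, hw, hwe⟩ := hmem z hz h
      exact hwe.symm.trans_le (hmax hw)
    · exact h.trans hm1
  have hconst := Complex.norm_eqOn_of_isPreconnected_of_isMaxOn hc hU hd (hKpos m hm) hmax'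
  have h1 : 0 < (((max Y 1 : ℝ) : ℂ) * I).im := by simp
  have h2 := hY (((max Y 1 : ℝ) : ℂ) * I) h1 (by simp)
  have h3 := hconst h1
  simp only [Function.comp, Function.const] at h3
  linarith

/-! ### Reflection symmetry and the invariant functions -/

open scoped ComplexConjugate

/-- The reflection τ ↦ -conj τ acts on q as complex conjugation, which commutes with series having
real coefficients. -/
lemma ex_neg_conj (τ : ℂ) : ex (-conj τ) = conj (ex τ) := by
  rw [ex, ex, ← Complex.exp_conj]
  simp [Complex.conj_ofNat]

lemma qPoch_conj (a q : ℂ) (n : ℕ) : qPoch (conj a) (conj q) n = conj (qPoch a q n) := by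
  simp [qPoch]

lemma G_conj (q : ℂ) : G (conj q) = conj (G q) := by
  simp [G, Complex.conj_tsum, qPoch_conj]

lemma H_conj (q : ℂ) : H (conj q) = conj (H q) := by
  simp [H, Complex.conj_tsum, qPoch_conj]

lemma E_conj (q : ℂ) : E (conj q) = conj (E q) := by
  simp [E, f, Complex.conj_tsum]

lemma gMod_neg_conj (τ : ℂ) : gMod (-conj τ) = conj (gMod τ) := by
  rw [gMod, gMod, map_mul, ← G_conj, ← ex_neg_conj, ← ex_neg_conj]
  simp [map_div₀, neg_div, Complex.conj_ofNat]

lemma hMod_neg_conj (τ : ℂ) : hMod (-conj τ) = conj (hMod τ) := by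
  rw [hMod, hMod, map_mul, ← H_conj, ← ex_neg_conj, ← ex_neg_conj]
  simp [map_div₀, neg_div, Complex.conj_ofNat]

lemma etaSq_neg_conj (τ : ℂ) : etaSq (-conj τ) = conj (etaSq τ) := by
  rw [etaSq, etaSq, map_mul, map_pow, ← E_conj, ← ex_neg_conj, ← ex_neg_conj]
  simp [map_div₀, neg_div, Complex.conj_ofNat]

lemma natCast_mul_neg_conj (n : ℕ) (τ : ℂ) : (n : ℂ) * -conj τ = -conj (n * τ) := by simp

lemma uOne_neg_conj (τ : ℂ) : uOne (-conj τ) = conj (uOne τ) := by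
  have h2 := natCast_mul_neg_conj 2 τ
  have h13 := natCast_mul_neg_conj 13 τ
  push_cast at h2 h13
  rw [uOne, uOne, h2, h13]
  rw [gMod_neg_conj, gMod_neg_conj, hMod_neg_conj, hMod_neg_conj, map_add, map_mul, map_mul]

lemma uTwo_neg_conj (τ : ℂ) : uTwo (-conj τ) = conj (uTwo τ) := by
  have h26 := natCast_mul_neg_conj 26 τ
  push_cast at h26
  rw [uTwo, uTwo, h26]
  rw [gMod_neg_conj, gMod_neg_conj, hMod_neg_conj, hMod_neg_conj, map_sub, map_mul, map_mul]

lemma etaQuot_neg_conj (τ : ℂ) : etaQuot (-conj τ) = conj (etaQuot τ) := by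
  have h2 := natCast_mul_neg_conj 2 τ
  have h13 := natCast_mul_neg_conj 13 τ
  have h26 := natCast_mul_neg_conj 26 τ
  push_cast at h2 h13 h26
  rw [etaQuot, etaQuot, h2, h13, h26]
  rw [etaSq_neg_conj, etaSq_neg_conj, etaSq_neg_conj, etaSq_neg_conj, map_div₀, map_mul, map_mul]

lemma norm_eq_one_of_pow_four {c : ℂ} (h : c ^ 4 = 1) : ‖c‖ = 1 :=
  Complex.norm_eq_one_of_pow_eq_one h (by norm_num)

/-- The common factor has modulus 1, and an exchange only changes the sign of the difference. -/
lemma linkInvariant_uOne_sub_uTwo : LinkInvariant fun τ => ‖uOne τ - uTwo τ‖ where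
  linked τ τ' _ h := by
    obtain ⟨c, hc, ⟨h1, h2, -⟩ | ⟨h1, h2, -⟩⟩ := h
    · simp only [h1, h2]
      rw [← mul_sub, norm_mul, norm_eq_one_of_pow_four hc, one_mul]
    · simp only [h1, h2]
      rw [← mul_sub, norm_mul, norm_eq_one_of_pow_four hc, one_mul, norm_sub_rev]
  reflect τ _ := by
    simp only [uOne_neg_conj, uTwo_neg_conj]
    rw [← map_sub, Complex.norm_conj]

/-- The fourth power kills c, the expression is symmetric under t ↦ 1/t, and the exchange is
harmless once u₁ = u₂. -/
lemma linkInvariant_of_uOne_eq_uTwo (h : ∀ τ : ℂ, 0 < τ.im → uOne τ = uTwo τ) :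
    LinkInvariant fun τ => ‖uOne τ ^ 4 - etaQuot τ - (etaQuot τ)⁻¹ + 2‖ where
  linked τ τ' hτ hl := by
    obtain ⟨c, hc, ⟨h1, -, h3⟩ | ⟨h1, -, h3⟩⟩ := hl
    · simp only [h1, h3, mul_pow, hc, one_mul]
    · simp only [h1, h3, mul_pow, hc, one_mul, inv_inv, ← h τ hτ]
      congr 1; ring
  reflect τ _ := by
    simp only [uOne_neg_conj, etaQuot_neg_conj]
    rw [← Complex.norm_conj]
    simp [Complex.conj_ofNat]

/-! ### Holomorphy and first-order expansions at q = 0 -/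

lemma differentiableOn_E : DifferentiableOn ℂ E (Metric.ball 0 1) :=
  (differentiableOn_altTheta (N := 3) (r := 1) le_rfl (by norm_num)).congr
    fun q _ => E_eq_altTheta q

lemma mem_ball_zero_one {q : ℂ} : q ∈ Metric.ball (0 : ℂ) 1 ↔ ‖q‖ < 1 := by simp

lemma differentiableOn_G : DifferentiableOn ℂ G (Metric.ball 0 1) := by
  refine ((differentiableOn_altTheta (N := 5) (r := 1) (by norm_num) (by norm_num)).div
    differentiableOn_E fun q hq => E_ne_zero (mem_ball_zero_one.1 hq)).congr fun q hq => ?_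
  have hq := mem_ball_zero_one.1 hq
  exact eq_div_of_mul_eq (E_ne_zero hq) (G_mul_E hq)

lemma differentiableOn_H : DifferentiableOn ℂ H (Metric.ball 0 1) := by
  refine ((differentiableOn_altTheta (N := 5) (r := 3) (by norm_num) (by norm_num)).div
    differentiableOn_E fun q hq => E_ne_zero (mem_ball_zero_one.1 hq)).congr fun q hq => ?_
  have hq := mem_ball_zero_one.1 hq
  exact eq_div_of_mul_eq (E_ne_zero hq) (H_mul_E hq)

lemma differentiableOn_comp_pow {F : ℂ → ℂ} (hF : DifferentiableOn ℂ F (Metric.ball 0 1)) {n : ℕ}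
    (hn : n ≠ 0) : DifferentiableOn ℂ (fun q => F (q ^ n)) (Metric.ball 0 1) :=
  hF.comp (differentiableOn_id.pow n) fun _ hq =>
    mem_ball_zero_one.2 (norm_pow_lt_one (mem_ball_zero_one.1 hq) hn)

lemma differentiableOn_U_two_thirteen : DifferentiableOn ℂ (U 2 13) (Metric.ball 0 1) := by
  have e : U 2 13 = fun q => G (q ^ 2) * G (q ^ 13) + q ^ 3 * H (q ^ 2) * H (q ^ 13) :=
    funext U_two_thirteen
  rw [e]
  have g2 := differentiableOn_comp_pow differentiableOn_G two_ne_zero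
  have g13 := differentiableOn_comp_pow differentiableOn_G (n := 13) (by norm_num)
  have h2 := differentiableOn_comp_pow differentiableOn_H two_ne_zero
  have h13 := differentiableOn_comp_pow differentiableOn_H (n := 13) (by norm_num)
  fun_prop

lemma differentiableOn_U_one_twentysix : DifferentiableOn ℂ (U 1 26) (Metric.ball 0 1) := by
  have e : U 1 26 = fun q => H q * G (q ^ 26) - q ^ 5 * G q * H (q ^ 26) :=
    funext U_one_twentysix
  rw [e]
  have g1 := differentiableOn_G
  have g26 := differentiableOn_comp_pow differentiableOn_G (n := 26) (by norm_num)
  have h1 := differentiableOn_H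
  have h26 := differentiableOn_comp_pow differentiableOn_H (n := 26) (by norm_num)
  fun_prop

lemma ball_mem_nhds_zero : Metric.ball (0 : ℂ) 1 ∈ 𝓝 (0 : ℂ) := Metric.ball_mem_nhds _ one_pos

lemma E_zero : E 0 = 1 := by rw [E_eq_altTheta, altTheta_zero le_rfl (by norm_num)]

lemma G_zero : G 0 = 1 := by
  have := G_mul_E (q := 0) (by simp)
  rwa [E_zero, mul_one, altTheta_zero (by norm_num) (by norm_num)] at this

lemma H_zero : H 0 = 1 := by
  have := H_mul_E (q := 0) (by simp)
  rwa [E_zero, mul_one, altTheta_zero (by norm_num) (by norm_num)] at this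

lemma deriv_altTheta_zero_eq_neg_one {N r : ℤ} (hN : 3 ≤ N) (hr : |r| ≤ N - 2) (h : N - r = 2)
    (h0 : 0 < r) : deriv (altTheta N r) 0 = -1 := by
  rw [deriv_altTheta_zero hN hr, tsum_eq_single (-1)]
  · rw [if_pos (by rw [show N * (-1) ^ 2 + r * (-1) = N - r by ring, h]; rfl)]
    norm_num
  · intro n hn
    rw [if_neg]
    intro h1
    have h2 : N * n ^ 2 + r * n = n * (N * n + r) := by ring
    -- Floor division sends both 2 and 3 to 1, so every other numerator must be shown to be 0 or at
    -- least 4.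
    rcases lt_trichotomy n 0 with h3 | rfl | h3
    · have h4 : n ≤ -2 := by omega
      have h5 : N * n + r ≤ -4 := by
        rw [show N * n + r = r * (n + 1) + 2 * n by linear_combination n * h]
        nlinarith
      have : 6 ≤ n * (N * n + r) := by nlinarith
      omega
    · simp at h1
    · have : 4 ≤ n * (N * n + r) := by nlinarith
      omega

lemma hasDerivAt_E_zero : HasDerivAt E (-1) 0 := by
  have h := (differentiableOn_E.differentiableAt ball_mem_nhds_zero).hasDerivAt
  rwa [show E = altTheta 3 1 from funext E_eq_altTheta,
    deriv_altTheta_zero_eq_neg_one le_rfl (by norm_num) rfl one_pos,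
    ← show E = altTheta 3 1 from funext E_eq_altTheta] at h

/-- E and H·E both have slope -1 and all values at 0 are 1, so H has slope 0. -/
lemma hasDerivAt_H_zero : HasDerivAt H 0 0 := by
  have h := (differentiableOn_H.differentiableAt ball_mem_nhds_zero).hasDerivAt
  have h1 := h.mul hasDerivAt_E_zero
  have h2 : (H * E) =ᶠ[𝓝 0] altTheta 5 3 := by
    filter_upwards [ball_mem_nhds_zero] with q hq using H_mul_E (mem_ball_zero_one.1 hq)
  have h3 := h2.deriv_eq
  rw [h1.deriv, deriv_altTheta_zero_eq_neg_one (by norm_num) (by norm_num) rfl (by norm_num),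
    E_zero, H_zero] at h3
  have h4 : deriv H 0 = 0 := by linear_combination h3
  rwa [h4] at h

lemma hasDerivAt_comp_pow_zero {F : ℂ → ℂ} {F' : ℂ} (hF : HasDerivAt F F' 0) {n : ℕ} (hn : 2 ≤ n) :
    HasDerivAt (fun q => F (q ^ n)) 0 0 := by
  have h := hasDerivAt_pow n (0 : ℂ)
  rw [zero_pow (by omega), mul_zero] at h
  have h0 : (0 : ℂ) ^ n = 0 := zero_pow (by omega)
  rw [← h0] at hF
  exact (hF.comp 0 h).congr_deriv (mul_zero _)

lemma hasDerivAt_pow_zero {n : ℕ} (hn : 2 ≤ n) : HasDerivAt (fun q : ℂ => q ^ n) 0 0 :=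
  hasDerivAt_comp_pow_zero (hasDerivAt_id (0 : ℂ)) hn

/-- Every factor involves q only through a power of exponent at least 2, so the slope of G itself is
irrelevant. -/
lemma hasDerivAt_U_two_thirteen_zero : HasDerivAt (U 2 13) 0 0 := by
  have e : U 2 13 = fun q => G (q ^ 2) * G (q ^ 13) + q ^ 3 * H (q ^ 2) * H (q ^ 13) :=
    funext U_two_thirteen
  have g := (differentiableOn_G.differentiableAt ball_mem_nhds_zero).hasDerivAt
  have h := hasDerivAt_H_zero
  rw [e]
  have := ((hasDerivAt_comp_pow_zero g le_rfl).mul (hasDerivAt_comp_pow_zero g (n :=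
      13) (by norm_num))).add
    (((hasDerivAt_pow_zero (n := 3) (by norm_num)).mul (hasDerivAt_comp_pow_zero h le_rfl)).mul
      (hasDerivAt_comp_pow_zero h (n := 13) (by norm_num)))
  exact this.congr_deriv (by simp)

lemma hasDerivAt_U_one_twentysix_zero : HasDerivAt (U 1 26) 0 0 := by
  have e : U 1 26 = fun q => H q * G (q ^ 26) - q ^ 5 * G q * H (q ^ 26) :=
    funext U_one_twentysix
  have g := (differentiableOn_G.differentiableAt ball_mem_nhds_zero).hasDerivAt
  have h := hasDerivAt_H_zero
  rw [e]
  have := (h.mul (hasDerivAt_comp_pow_zero g (n := 26) (by norm_num))).sub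
    (((hasDerivAt_pow_zero (n := 5) (by norm_num)).mul g).mul
      (hasDerivAt_comp_pow_zero h (n := 26) (by norm_num)))
  exact this.congr_deriv (by simp)

lemma U_two_thirteen_zero : U 2 13 0 = 1 := by simp [U_two_thirteen, G_zero]

lemma U_one_twentysix_zero : U 1 26 0 = 1 := by simp [U_one_twentysix, G_zero, H_zero]

/-- The quotient `E(q²) E(q¹³) / (E(q) E(q²⁶))`. -/
def eulerQuot (q : ℂ) : ℂ := E (q ^ 2) * E (q ^ 13) / (E q * E (q ^ 26))

lemma eulerQuot_ne_zero {q : ℂ} (hq : ‖q‖ < 1) : eulerQuot q ≠ 0 :=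
  div_ne_zero
    (mul_ne_zero (E_ne_zero (norm_pow_lt_one hq (by norm_num)))
      (E_ne_zero (norm_pow_lt_one hq (by norm_num))))
    (mul_ne_zero (E_ne_zero hq) (E_ne_zero (norm_pow_lt_one hq (by norm_num))))

lemma differentiableOn_eulerQuot : DifferentiableOn ℂ eulerQuot (Metric.ball 0 1) :=
  ((differentiableOn_comp_pow differentiableOn_E (by norm_num)).mul (differentiableOn_comp_pow
      differentiableOn_E (by norm_num))).div
    (differentiableOn_E.mul (differentiableOn_comp_pow differentiableOn_E (by norm_num))) fun q hq
        =>
      have hq := mem_ball_zero_one.1 hq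
      mul_ne_zero (E_ne_zero hq) (E_ne_zero (norm_pow_lt_one hq (by norm_num)))

lemma eulerQuot_zero : eulerQuot 0 = 1 := by simp [eulerQuot, E_zero]

lemma hasDerivAt_eulerQuot_zero : HasDerivAt eulerQuot 1 0 := by
  have h := hasDerivAt_E_zero
  have := ((hasDerivAt_comp_pow_zero h le_rfl).mul (hasDerivAt_comp_pow_zero h (n :=
      13) (by norm_num))).div
    (h.mul (hasDerivAt_comp_pow_zero h (n := 26) (by norm_num))) (by simp [E_zero])
  exact this.congr_deriv (by simp [E_zero])

/-- The difference `U⁴ - (v - q v⁻¹)²` for `U = U(2, 13, q)`, `v = eulerQuot q`. -/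
def quarticDefect (q : ℂ) : ℂ := U 2 13 q ^ 4 - (eulerQuot q - q / eulerQuot q) ^ 2

lemma differentiableOn_quarticDefect : DifferentiableOn ℂ quarticDefect (Metric.ball 0 1) :=
  (differentiableOn_U_two_thirteen.pow 4).sub ((differentiableOn_eulerQuot.sub
    (differentiableOn_id.div differentiableOn_eulerQuot
      fun _ hq => eulerQuot_ne_zero (mem_ball_zero_one.1 hq))).pow 2)

/-- Here v = 1 + q + O(q²), so v - q/v = 1 + O(q²), and U = 1 + O(q²). The defect therefore vanishes
to second order. -/
lemma hasDerivAt_quarticDefect_zero : HasDerivAt quarticDefect 0 0 := by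
  have h := hasDerivAt_eulerQuot_zero
  have := (hasDerivAt_U_two_thirteen_zero.pow 4).sub ((h.sub
    ((hasDerivAt_id (0 : ℂ)).div h (eulerQuot_ne_zero (by simp)))).pow 2)
  exact this.congr_deriv (by simp [eulerQuot_zero])

lemma uOne_eq (τ : ℂ) : uOne τ = ex (-τ / 4) * U 2 13 (ex τ) := by
  rw [uOne, U_two_thirteen, gMod, gMod, hMod, hMod]
  have e (n : ℕ) : ex (n * τ) = ex τ ^ n := (ex_pow τ n).symm
  have e2 := e 2
  have e13 := e 13
  push_cast at e2 e13
  have h1 : ex (-(2 * τ) / 60) * ex (-(13 * τ) / 60) = ex (-τ / 4) := by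
    rw [← ex_add]; ring_nf
  have h2 : ex (11 * (2 * τ) / 60) * ex (11 * (13 * τ) / 60) = ex (-τ / 4) * ex τ ^ 3 := by
    rw [ex_pow, ← ex_add, ← ex_add]; push_cast; ring_nf
  rw [e2, e13]
  linear_combination G (ex τ ^ 2) * G (ex τ ^ 13) * h1 + H (ex τ ^ 2) * H (ex τ ^ 13) * h2

lemma uTwo_eq (τ : ℂ) : uTwo τ = ex (-τ / 4) * U 1 26 (ex τ) := by
  rw [uTwo, U_one_twentysix, gMod, gMod, hMod, hMod]
  have e (n : ℕ) : ex (n * τ) = ex τ ^ n := (ex_pow τ n).symm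
  have e26 := e 26
  push_cast at e26
  have h1 : ex (11 * τ / 60) * ex (-(26 * τ) / 60) = ex (-τ / 4) := by
    rw [← ex_add]; ring_nf
  have h2 : ex (-τ / 60) * ex (11 * (26 * τ) / 60) = ex (-τ / 4) * ex τ ^ 5 := by
    rw [ex_pow, ← ex_add, ← ex_add]; push_cast; ring_nf
  rw [e26]
  linear_combination H (ex τ) * G (ex τ ^ 26) * h1 - G (ex τ) * H (ex τ ^ 26) * h2

lemma etaQuot_eq (τ : ℂ) : etaQuot τ = ex (-τ) * eulerQuot (ex τ) ^ 2 := by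
  rw [etaQuot, etaSq, etaSq, etaSq, etaSq, eulerQuot]
  have e (n : ℕ) : ex (n * τ) = ex τ ^ n := (ex_pow τ n).symm
  have e2 := e 2
  have e13 := e 13
  have e26 := e 26
  push_cast at e2 e13 e26
  rw [e2, e13, e26, mul_mul_mul_comm, mul_mul_mul_comm (ex (τ / 12)), mul_div_mul_comm, ← ex_add,
    ← ex_add, ← mul_pow, ← mul_pow, ← div_pow]
  congr 1
  rw [div_eq_iff (ex_ne_zero _), ← ex_add]
  ring_nf

/-- From t = v²/q one gets t + 1/t - 2 = (v - q/v)²/q. -/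
lemma uOne_pow_four_sub {τ : ℂ} (hτ : 0 < τ.im) :
    uOne τ ^ 4 - etaQuot τ - (etaQuot τ)⁻¹ + 2 = ex (-τ) * quarticDefect (ex τ) := by
  have h0 := ex_ne_zero τ
  have h1 := eulerQuot_ne_zero (norm_ex_lt_one hτ)
  rw [uOne_eq, etaQuot_eq, quarticDefect, mul_pow, ex_pow,
    show ((4 : ℕ) : ℂ) * (-τ / 4) = -τ by push_cast; ring, ex_neg]
  field_simp
  ring

/-! ### The two modular identities for U -/

/-- The unit disc is covered by the exponential of the upper half plane. -/
lemma exists_ex_eq {q : ℂ} (hq : ‖q‖ < 1) (h0 : q ≠ 0) : ∃ τ : ℂ, 0 < τ.im ∧ ex τ = q := by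
  refine ⟨Complex.log q / (2 * π * I), ?_, ?_⟩
  · have h1 : Real.log ‖q‖ < 0 := Real.log_neg (norm_pos_iff.2 h0) hq
    have h2 : Complex.log q / (2 * π * I) = ((1 / (2 * π) : ℝ) : ℂ) * (-I * Complex.log q) := by
      have := Real.pi_ne_zero
      push_cast
      field_simp
      rw [Complex.I_sq]; ring
    rw [h2, Complex.im_ofReal_mul]
    refine mul_pos (by positivity) ?_
    simp [Complex.log_re, h1]
  · rw [ex, mul_div_cancel₀ _ Complex.two_pi_I_ne_zero, Complex.exp_log h0]

/-- B(q) = o(q) beats the pole 1/q at the cusp. -/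
lemma exists_im_bound_of_hasDerivAt {B : ℂ → ℂ} (hB : HasDerivAt B 0 0) (h0 : B 0 = 0) {ε : ℝ}
    (hε : 0 < ε) : ∃ Y : ℝ, ∀ τ : ℂ, 0 < τ.im → Y ≤ τ.im → ‖ex (-τ) * B (ex τ)‖ < ε := by
  have h1 := (hasDerivAt_iff_isLittleO.1 hB).def (half_pos hε)
  simp only [sub_zero, h0, smul_zero] at h1
  obtain ⟨δ, hδ, h2⟩ := Metric.eventually_nhds_iff.1 h1
  have h3 : Tendsto (fun y : ℝ => Real.exp (-2 * π * y)) atTop (𝓝 0) := by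
    refine Real.tendsto_exp_atBot.comp ?_
    exact tendsto_id.const_mul_atTop_of_neg (by nlinarith [Real.pi_pos])
  obtain ⟨Y, hY⟩ := eventually_atTop.1 (h3.eventually (gt_mem_nhds hδ))
  refine ⟨Y, fun τ _ hτ => ?_⟩
  have h4 := @h2 (ex τ) (by rw [dist_zero_right, norm_ex]; exact hY _ hτ)
  have h5 : 0 < ‖ex τ‖ := norm_pos_iff.2 (ex_ne_zero τ)
  rw [norm_mul, ex_neg, norm_inv, inv_mul_lt_iff₀ h5]
  nlinarith

lemma differentiable_ex : Differentiable ℂ ex := by unfold ex; fun_prop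

lemma differentiableOn_comp_ex {F : ℂ → ℂ} (hF : DifferentiableOn ℂ F (Metric.ball 0 1)) :
    DifferentiableOn ℂ (fun τ => F (ex τ)) {τ | 0 < τ.im} :=
  hF.comp differentiable_ex.differentiableOn fun _ hτ =>
    mem_ball_zero_one.2 (norm_ex_lt_one hτ)

/-- The difference is q^(-1/4) times a function vanishing to second order at q = 0; the bound with
the larger factor 1/q suffices. -/
lemma uOne_eq_uTwo {τ : ℂ} (hτ : 0 < τ.im) : uOne τ = uTwo τ := by
  have e : (fun τ => uOne τ - uTwo τ) = fun τ => ex (-τ / 4) * (U 2 13 (ex τ) - U 1 26 (ex τ)) := by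
    funext τ; rw [uOne_eq, uTwo_eq, mul_sub]
  have hd : DifferentiableOn ℂ (fun τ => uOne τ - uTwo τ) {τ | 0 < τ.im} := by
    rw [e]
    refine DifferentiableOn.mul ?_ ((differentiableOn_comp_ex differentiableOn_U_two_thirteen).sub
      (differentiableOn_comp_ex differentiableOn_U_one_twentysix))
    exact (differentiable_ex.comp (by fun_prop)).differentiableOn
  refine sub_eq_zero.1 (eq_zero_of_linkInvariant hd linkInvariant_uOne_sub_uTwo (fun ε hε => ?_) hτ)
  have hB : HasDerivAt (fun q => U 2 13 q - U 1 26 q) 0 0 := by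
    exact (hasDerivAt_U_two_thirteen_zero.sub hasDerivAt_U_one_twentysix_zero).congr_deriv (by simp)
  obtain ⟨Y, hY⟩ := exists_im_bound_of_hasDerivAt hB
    (by simp [U_two_thirteen_zero, U_one_twentysix_zero]) hε
  refine ⟨Y, fun τ hτ hle => lt_of_le_of_lt ?_ (hY τ hτ hle)⟩
  rw [uOne_eq, uTwo_eq, ← mul_sub, norm_mul, norm_mul]
  refine mul_le_mul_of_nonneg_right ?_ (norm_nonneg _)
  rw [norm_ex, norm_ex, Real.exp_le_exp]
  have h1 : (-τ / 4).im = -τ.im / 4 := by simp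
  rw [h1, Complex.neg_im]
  nlinarith [mul_pos Real.pi_pos hτ]

/-- The two functions `U(2, 13, q)` and `U(1, 26, q)` agree on the unit disc. -/
theorem U_two_thirteen_eq_U_one_twentysix {q : ℂ} (hq : ‖q‖ < 1) : U 2 13 q = U 1 26 q := by
  rcases eq_or_ne q 0 with rfl | h0
  · rw [U_two_thirteen_zero, U_one_twentysix_zero]
  obtain ⟨τ, hτ, rfl⟩ := exists_ex_eq hq h0
  have := uOne_eq_uTwo hτ
  rw [uOne_eq, uTwo_eq] at this
  exact mul_left_cancel₀ (ex_ne_zero _) this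

lemma quarticDefect_eq_zero {q : ℂ} (hq : ‖q‖ < 1) : quarticDefect q = 0 := by
  have hz : quarticDefect 0 = 0 := by
    simp [quarticDefect, U_two_thirteen_zero, eulerQuot_zero]
  rcases eq_or_ne q 0 with rfl | h0
  · exact hz
  obtain ⟨τ, hτ, rfl⟩ := exists_ex_eq hq h0
  have h := eq_zero_of_linkInvariant
    (e := fun τ => uOne τ ^ 4 - etaQuot τ - (etaQuot τ)⁻¹ + 2) ?_
    (linkInvariant_of_uOne_eq_uTwo fun _ => uOne_eq_uTwo) (fun ε hε => ?_) hτ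
  · rw [uOne_pow_four_sub hτ] at h
    exact (mul_eq_zero.1 h).resolve_left (ex_ne_zero _)
  · refine DifferentiableOn.congr (f := fun τ => ex (-τ) * quarticDefect (ex τ)) ?_
      fun τ hτ => uOne_pow_four_sub hτ
    exact ((differentiable_ex.comp (by fun_prop)).differentiableOn).mul
      (differentiableOn_comp_ex differentiableOn_quarticDefect)
  · obtain ⟨Y, hY⟩ := exists_im_bound_of_hasDerivAt hasDerivAt_quarticDefect_zero hz hε
    exact ⟨Y, fun τ hτ hle => by rw [uOne_pow_four_sub hτ]; exact hY τ hτ hle⟩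

/-- `U(2, 13, q)² = v - q / v` with `v = E(q²) E(q¹³) / (E(q) E(q²⁶))`. -/
theorem U_two_thirteen_sq {q : ℂ} (hq : ‖q‖ < 1) :
    U 2 13 q ^ 2 = eulerQuot q - q / eulerQuot q := by
  have hd : DifferentiableOn ℂ (fun q => eulerQuot q - q / eulerQuot q) (Metric.ball 0 1) :=
    differentiableOn_eulerQuot.sub (differentiableOn_id.div differentiableOn_eulerQuot
      fun _ hq => eulerQuot_ne_zero (mem_ball_zero_one.1 hq))
  have hU := differentiableOn_U_two_thirteen.pow 2
  have h1 := (hU.sub hd).analyticOnNhd Metric.isOpen_ball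
  have hc : ContinuousAt (fun q => U 2 13 q ^ 2 + (eulerQuot q - q / eulerQuot q)) 0 :=
    ((hU.add hd).differentiableAt ball_mem_nhds_zero).continuousAt
  -- This fixes the sign of the square root: the sum equals 2 at q = 0, so near 0 the difference is
  -- the vanishing factor.
  have hne : ∀ᶠ q in 𝓝 (0 : ℂ), U 2 13 q ^ 2 + (eulerQuot q - q / eulerQuot q) ≠ 0 :=
    hc.eventually_ne (by simp [U_two_thirteen_zero, eulerQuot_zero])
  have h2 : (U 2 13 ^ 2 - fun q => eulerQuot q - q / eulerQuot q) =ᶠ[𝓝 0] 0 := by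
    filter_upwards [hne, ball_mem_nhds_zero] with q h hq
    have h3 := quarticDefect_eq_zero (mem_ball_zero_one.1 hq)
    rw [quarticDefect] at h3
    refine (mul_eq_zero.1 (?_ : _ * (U 2 13 q ^ 2 + (eulerQuot q - q / eulerQuot q)) =
        0)).resolve_right h
    simp only [Pi.sub_apply, Pi.pow_apply]
    linear_combination h3
  have h3 := h1.eqOn_zero_of_preconnected_of_eventuallyEq_zero
    (convex_ball (0 : ℂ) 1).isPreconnected (Metric.mem_ball_self one_pos) h2
    (mem_ball_zero_one.2 hq)
  exact sub_eq_zero.1 h3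

/-! ### Assembly of the theta identities -/

lemma theta_zero {a b c : ℤ} (ha : 0 < a) (h : b ^ 2 < 4 * a * c) : theta a b c 0 = 1 := by
  rw [theta, tsum_eq_single (0, 0)]
  · simp
  · rintro ⟨n, m⟩ hnm
    refine zero_zpow _ fun h0 => hnm ?_
    have h1 : (2 * a * n + b * m) ^ 2 + (4 * a * c - b ^ 2) * m ^ 2 = 0 := by
      linear_combination 4 * a * h0
    have hm : m = 0 := by
      by_contra hm
      have : 0 < (4 * a * c - b ^ 2) * m ^ 2 := by
        have : 0 < m ^ 2 := by positivity
        nlinarith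
      nlinarith [sq_nonneg (2 * a * n + b * m)]
    subst hm
    have hn : a * n ^ 2 = 0 := by linear_combination h0
    simp_all [ha.ne']

/-- Multiply U² = v - p/v by E(p)E(p²⁶): the first term is E(p²)E(p¹³), and in the second
E(p)²/E(p²) = φ(-p) and E(p²⁶)²/E(p¹³) = ψ(p¹³). -/
lemma E_mul_E_mul_U_sq {p : ℂ} (hp : ‖p‖ < 1) (h0 : p ≠ 0) :
    E p * E (p ^ 26) * U 1 26 p ^ 2
      = E (p ^ 2) * E (p ^ 13) - p * (psi (p ^ 13) * phi (-p)) := by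
  have h13 := norm_pow_lt_one hp (show 13 ≠ 0 by norm_num)
  have e1 := E_ne_zero hp
  have e2 := E_ne_zero (norm_pow_lt_one hp two_ne_zero)
  have e13 := E_ne_zero h13
  have e26 := E_ne_zero (norm_pow_lt_one hp (show 26 ≠ 0 by norm_num))
  have hpsi := psi_mul_E h13 (pow_ne_zero _ h0)
  have hphi := phi_neg_mul_E hp h0
  rw [← pow_mul] at hpsi
  rw [eq_div_of_mul_eq e13 hpsi, eq_div_of_mul_eq e2 hphi,
    ← U_two_thirteen_eq_U_one_twentysix hp, U_two_thirteen_sq hp, eulerQuot]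
  field_simp

lemma E_mul_E_mul_U_sq' {p : ℂ} (hp : ‖p‖ < 1) (h0 : p ≠ 0) :
    E (p ^ 2) * E (p ^ 13) * U 2 13 p ^ 2
      = psi p * phi (-p ^ 13) - p * (E p * E (p ^ 26)) := by
  have h13 := norm_pow_lt_one hp (show 13 ≠ 0 by norm_num)
  have e1 := E_ne_zero hp
  have e2 := E_ne_zero (norm_pow_lt_one hp two_ne_zero)
  have e13 := E_ne_zero h13
  have e26 := E_ne_zero (norm_pow_lt_one hp (show 26 ≠ 0 by norm_num))
  have hpsi := psi_mul_E hp h0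
  have hphi := phi_neg_mul_E h13 (pow_ne_zero _ h0)
  rw [← pow_mul] at hphi
  rw [eq_div_of_mul_eq e1 hpsi, eq_div_of_mul_eq e26 hphi, U_two_thirteen_sq hp, eulerQuot]
  field_simp

/-- A nonzero analytic function on the disc has discrete zeros, and U(2,13,0) = 1. The factor q is
included because the denominators also vanish at q = 0. -/
lemma eventually_codiscreteWithin_U_ne_zero :
    ∀ᶠ q in codiscreteWithin (Metric.ball (0 : ℂ) 1), q * U 2 13 (q ^ 8) ≠ 0 := by
  have hd : DifferentiableOn ℂ (fun q => q * U 2 13 (q ^ 8)) (Metric.ball 0 1) :=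
    differentiableOn_id.mul (differentiableOn_comp_pow differentiableOn_U_two_thirteen (by
      norm_num))
  have ha := hd.analyticOnNhd Metric.isOpen_ball
  have hc : ContinuousAt (fun q => U 2 13 (q ^ 8)) (0 : ℂ) :=
    ((differentiableOn_comp_pow differentiableOn_U_two_thirteen
      (show 8 ≠ 0 by norm_num)).differentiableAt ball_mem_nhds_zero).continuousAt
  have hne : ∀ᶠ q in 𝓝[≠] (0 : ℂ), U 2 13 (q ^ 8) ≠ 0 :=
    (hc.eventually_ne (by simp [U_two_thirteen_zero])).filter_mono nhdsWithin_le_nhds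
  obtain ⟨x, ⟨hx, hxb⟩, hx0⟩ := ((hne.and (nhdsWithin_le_nhds ball_mem_nhds_zero)).and
    self_mem_nhdsWithin).exists
  exact ha.preimage_zero_mem_codiscreteWithin (x := x) (mul_ne_zero hx0 hx) hxb
    (Metric.isConnected_ball one_pos)

/-- The six theta identities of discriminant `-1664`. -/
theorem theta_identities {q : ℂ} (hq : ‖q‖ < 1) {Q : ℂ} (hQ : Q = q ^ 13) :
    2 * q ^ 3 * E (q ^ 16) * E (Q ^ 8) * U 2 13 (q ^ 8)
        = theta 3 2 139 q - theta 12 4 35 q ∧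
    2 * q ^ 7 * E (q ^ 8) * E (Q ^ 16) * U 1 26 (q ^ 8)
        = theta 7 4 60 q - theta 15 4 28 q ∧
    2 * q ^ 9 * E (q ^ 8) * E (Q ^ 16)
        = theta 9 8 48 q - theta 17 6 25 q ∧
    2 * q ^ 5 * E (q ^ 16) * E (Q ^ 8)
        = theta 5 4 84 q - theta 20 4 21 q ∧
    (2 * q ^ 5 * E (q ^ 8) * E (Q ^ 16) * U 1 26 (q ^ 8) ^ 2
        = theta 5 4 84 q + theta 21 10 21 q - theta 13 0 32 q - theta 20 4 21 q ∧
      theta 5 4 84 q + theta 21 10 21 q - theta 13 0 32 q - theta 20 4 21 q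
        = 2 * q ^ 5 * E (q ^ 16) * E (Q ^ 8) - 2 * q ^ 13 * psi (Q ^ 8) * phi (-q ^ 8)) ∧
    (2 * q * E (q ^ 16) * E (Q ^ 8) * U 2 13 (q ^ 8) ^ 2
        = theta 1 0 416 q + theta 17 6 25 q - theta 4 4 105 q - theta 9 8 48 q ∧
      theta 1 0 416 q + theta 17 6 25 q - theta 4 4 105 q - theta 9 8 48 q
        = 2 * q * psi (q ^ 8) * phi (-Q ^ 8) - 2 * q ^ 9 * E (q ^ 8) * E (Q ^ 16)) := by
  subst hQ
  rcases eq_or_ne q 0 with rfl | h0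
  -- At q = 0 all these theta series equal 1, and every product carries a positive power of q.
  · simp [theta_zero]
  have hp := norm_pow_lt_one hq (show 8 ≠ 0 by norm_num)
  have hp0 : q ^ 8 ≠ 0 := pow_ne_zero _ h0
  have h3 := E_mul_E_eq_theta_9_8_48 hq h0
  have h4 := E_mul_E_eq_theta_5_4_84 hq h0
  have h5 := psi_mul_phi_eq_theta_13_0_32 hq h0
  have h6 := psi_mul_phi_eq_theta_1_0_416 hq h0
  have h7 := E_mul_E_mul_U_sq hp hp0
  have h8 := E_mul_E_mul_U_sq' hp hp0
  simp only [← pow_mul, Nat.reduceMul] at h3 h4 h5 h6 h7 h8 ⊢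
  have h1 := U_two_thirteen_eq_theta hq h0
  have h2 := U_one_twentysix_eq_theta hq h0
  simp only [← pow_mul, Nat.reduceMul] at h1 h2
  refine ⟨h1, h2, h3, h4, ⟨?_, ?_⟩, ?_, ?_⟩
  · linear_combination 2 * q ^ 5 * h7 + h4 - h5
  · linear_combination h5 - h4
  · linear_combination 2 * q * h8 + h6 - h3
  · linear_combination h3 - h6

end RogersRamanujan
end

open RogersRamanujan in
theorem mainTheorem7 :
    -- the identities, for every `q` in the unit disc
    (∀ q : ℂ, ‖q‖ < 1 → ∀ Q : ℂ, Q = q ^ 13 →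
      2 * q ^ 3 * E (q ^ 16) * E (Q ^ 8) * U 2 13 (q ^ 8)
          = theta 3 2 139 q - theta 12 4 35 q ∧
      2 * q ^ 7 * E (q ^ 8) * E (Q ^ 16) * U 1 26 (q ^ 8)
          = theta 7 4 60 q - theta 15 4 28 q ∧
      2 * q ^ 9 * E (q ^ 8) * E (Q ^ 16)
          = theta 9 8 48 q - theta 17 6 25 q ∧
      2 * q ^ 5 * E (q ^ 16) * E (Q ^ 8)
          = theta 5 4 84 q - theta 20 4 21 q ∧
      (2 * q ^ 5 * E (q ^ 8) * E (Q ^ 16) * U 1 26 (q ^ 8) ^ 2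
          = theta 5 4 84 q + theta 21 10 21 q - theta 13 0 32 q - theta 20 4 21 q ∧
        theta 5 4 84 q + theta 21 10 21 q - theta 13 0 32 q - theta 20 4 21 q
          = 2 * q ^ 5 * E (q ^ 16) * E (Q ^ 8) - 2 * q ^ 13 * psi (Q ^ 8) * phi (-q ^ 8)) ∧
      (2 * q * E (q ^ 16) * E (Q ^ 8) * U 2 13 (q ^ 8) ^ 2
          = theta 1 0 416 q + theta 17 6 25 q - theta 4 4 105 q - theta 9 8 48 q ∧
        theta 1 0 416 q + theta 17 6 25 q - theta 4 4 105 q - theta 9 8 48 q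
          = 2 * q * psi (q ^ 8) * phi (-Q ^ 8) - 2 * q ^ 9 * E (q ^ 8) * E (Q ^ 16))) ∧
    -- the chain of quotients, wherever the respective denominators do not vanish
    (∀ q : ℂ, 0 < ‖q‖ → ‖q‖ < 1 → ∀ Q : ℂ, Q = q ^ 13 →
      E (q ^ 16) * E (Q ^ 8) ≠ 0 ∧
      theta 5 4 84 q - theta 20 4 21 q ≠ 0 ∧
      (theta 9 8 48 q - theta 17 6 25 q) / (theta 5 4 84 q - theta 20 4 21 q)
          = q ^ 4 * ((E (q ^ 8) * E (Q ^ 16)) / (E (q ^ 16) * E (Q ^ 8))) ∧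
      (theta 1 0 416 q + theta 17 6 25 q - theta 4 4 105 q - theta 9 8 48 q ≠ 0 →
        (theta 5 4 84 q + theta 21 10 21 q - theta 13 0 32 q - theta 20 4 21 q) /
            (theta 1 0 416 q + theta 17 6 25 q - theta 4 4 105 q - theta 9 8 48 q)
          = (theta 9 8 48 q - theta 17 6 25 q) / (theta 5 4 84 q - theta 20 4 21 q)) ∧
      (theta 3 2 139 q - theta 12 4 35 q ≠ 0 →
        (theta 9 8 48 q - theta 17 6 25 q) / (theta 5 4 84 q - theta 20 4 21 q)
          = (theta 7 4 60 q - theta 15 4 28 q) / (theta 3 2 139 q - theta 12 4 35 q))) ∧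
    -- the other two denominators vanish at most on a discrete closed subset of the unit disc
    (∀ᶠ q in codiscreteWithin (Metric.ball (0 : ℂ) 1),
      theta 1 0 416 q + theta 17 6 25 q - theta 4 4 105 q - theta 9 8 48 q ≠ 0 ∧
      theta 3 2 139 q - theta 12 4 35 q ≠ 0) := by
  refine ⟨fun q hq Q hQ => theta_identities hq hQ, ?_, ?_⟩
  · intro q hq0 hq Q hQ
    have h0 : q ≠ 0 := norm_pos_iff.1 hq0
    have hQ1 : ‖Q‖ < 1 := hQ ▸ norm_pow_lt_one hq (by norm_num)
    have e1 := E_ne_zero (norm_pow_lt_one hq (show 8 ≠ 0 by norm_num))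
    have e2 := E_ne_zero (norm_pow_lt_one hq (show 16 ≠ 0 by norm_num))
    have e13 := E_ne_zero (norm_pow_lt_one hQ1 (show 8 ≠ 0 by norm_num))
    -- Because the two functions U coincide, they cancel from every quotient in the chain.
    have hU := U_two_thirteen_eq_U_one_twentysix (norm_pow_lt_one hq (show 8 ≠ 0 by norm_num))
    obtain ⟨h1, h2, h3, h4, ⟨h5, -⟩, h6, -⟩ := theta_identities hq hQ
    rw [← h1, ← h2, ← h3, ← h4, ← h5, ← h6, hU]
    refine ⟨mul_ne_zero e2 e13, by simp [h0, e2, e13], ?_, fun h => ?_, fun h => ?_⟩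
    · field_simp
    · have hU0 : U 1 26 (q ^ 8) ≠ 0 := fun h' => h (by rw [h']; ring)
      field_simp
    · have hU0 : U 1 26 (q ^ 8) ≠ 0 := fun h' => h (by rw [h']; ring)
      field_simp
  · filter_upwards [eventually_codiscreteWithin_U_ne_zero, self_mem_codiscreteWithin _]
      with q hqU hqb
    have hq := mem_ball_zero_one.1 hqb
    obtain ⟨h1, -, -, -, -, h6, -⟩ := theta_identities hq rfl
    have e2 := E_ne_zero (norm_pow_lt_one hq (show 16 ≠ 0 by norm_num))
    have e13 := E_ne_zero (norm_pow_lt_one (norm_pow_lt_one hq (show 13 ≠ 0 by norm_num))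
      (show 8 ≠ 0 by norm_num))
    obtain ⟨h0, hU⟩ := mul_ne_zero_iff.1 hqU
    rw [← h1, ← h6]
    constructor <;> simp [h0, hU, e2, e13]
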